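/- **Theorem.** Let $\mathcal X$ be a complete connected smooth finite-dimensional Riemannian manifold without boundary, with distance $d$ and Levi-Civita connection $\nabla$. Let $f(t,x)$, $t\ge 0$, $x\in\mathcal X$, be a time-varying $C^1$ vector field on $\mathcal X$ (jointly $C^1$ in $(t,x)$), and denote by $\phi(t;t_0,x_0)$ the value at time $t$ of the solution of $\dot x=f(t,x)$ with $x(t_0)=x_0$. Assume: * (Lipschitz) there is $L>0$ such that for every $t\ge 0$, all $p,q\in\mathcal X$ and every minimizing geodesic $\gamma$ from $p$ to $q$, $$|P_p^q f(t,p)-f(t,q)|\le L\,d(p,q),$$ where $P_p^q:T_p\mathcal X\to T_q\mathcal X$ is the parallel transport along $\gamma$ and $|\cdot|$ is the Riemannian norm; * (UGES) $x_*$ is a uniformly globally exponentially stable equilibrium: $\phi(t;t_0,x_*)=x_*$ for all $t\ge t_0\ge 0$, and there are $K,\lambda>0$ such that for all $t\ge t_0\ge 0$ and all $x_0\in\mathcal X$ the point $\phi(t;t_0,x_0)$ exists and $d(\phi(t;t_0,x_0),x_*)\le K e^{-\lambda(t-t_0)}d(x_0,x_*)$. For $\delta>0$, $t\ge0$ and $x\in\mathcal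 X$ put $$V(t,x)=\int_t^{t+\delta} d(\phi(\tau;t,x),x_*)\,d\tau .$$ Then there is $\delta_0>0$ such that for every $\delta\ge\delta_0$ the function $V$ is a Lyapunov candidate, that is, $V(t,x)\ge 0$, with $V(t,x)=0$ if and only if $x=x_*$ (for all $t\ge0$), and it has the following properties. 1. There are constants $c_1,c_2>0$ such that $c_1 d(x,x_*)\le V(t,x)\le c_2 d(x,x_*)$ for all $t\ge 0$ and $x\in\mathcal X$. 2. There is a constant $c_3>0$ such that for all $t\ge 0$ and $x\in\mathcal X$ the timed Lie derivative $$\mathcal L_fV(t,x)=\left.\frac{d}{ds}\right|_{s=t}V(s,\phi(s;t,x))$$ exists (as a one-sided derivative, from the right, if $t=0$) and satisfies $\mathcal L_fV(t,x)\le -c_3V(t,x)$. 3. There is a constant $c_4>0$, independent of $t$ and $x$, such that: if $d(\cdot,x_*)$ is $C^1$ on $\mathcal X$, then for all $t\ge0$ and $x\in\mathcal X$ the function $V(t,\cdot)$ is differentiable at $x$ and its differential satisfies $|dV(t,x)|\le c_4$ in the norm of $T_x^*\mathcal X$; and if $d(\cdot,x_*)$ is $C^1$ on $\mathcal X\setminus\{x_*\}$,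 then the same holds for all $t\ge 0$ and all $x\ne x_*$. -/

import Mathlib

open Set Filter Topology Bundle
open scoped Manifold ContDiff

namespace RiemLyap

/-!
Manifolds are modelled on a finite-dimensional real normed space `E` through `𝓘(ℝ, E)`, so they
have no boundary.
-/

section Geometry

variable {E : Type*} [NormedAddCommGroup E] [NormedSpace ℝ E]
  {M : Type*} [TopologicalSpace M] [ChartedSpace E M]

/-- The components of a tangent vector `v` at `x` in the preferred chart around `p`
(meaningful when `x` lies in the domain of that chart). -/
noncomputable def coordVec (p x : M) (v : TangentSpace 𝓘(ℝ, E) x) : E :=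
  mfderiv 𝓘(ℝ, E) 𝓘(ℝ, E) (extChartAt 𝓘(ℝ, E) p) x v

variable [RiemannianBundle (fun x : M ↦ TangentSpace 𝓘(ℝ, E) x)]

/-- The Riemannian metric in the preferred chart around `p`: the coefficient `g_y(u, v)` at the
point with coordinates `y`. -/
noncomputable def chartMetric (p : M) (y u v : E) : ℝ :=
  inner ℝ (mfderiv 𝓘(ℝ, E) 𝓘(ℝ, E) (extChartAt 𝓘(ℝ, E) p).symm y u)
    (mfderiv 𝓘(ℝ, E) 𝓘(ℝ, E) (extChartAt 𝓘(ℝ, E) p).symm y v)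

/-- The Christoffel symbols (of the first kind) of the Levi-Civita connection in the preferred
chart around `p`: `g(∇_u v, w) = (∂_u g(v, w) + ∂_v g(u, w) - ∂_w g(u, v)) / 2` for vectors
`u, v, w` with constant components. -/
noncomputable def christoffel (p : M) (y u v w : E) : ℝ :=
  (fderiv ℝ (fun z ↦ chartMetric p z v w) y u + fderiv ℝ (fun z ↦ chartMetric p z u w) y v
    - fderiv ℝ (fun z ↦ chartMetric p z u v) y w) / 2

/-- `W` is the (Levi-Civita) covariant derivative `DV/dt` at time `t` of the vector field `V`
along the curve `c : J → M`. In local coordinates `DV/dt = V' + Γ(c', V)`; the equation is written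
after taking the scalar product with an arbitrary vector `w`. By the transformation law of the
Christoffel symbols it does not depend on the chart around `c t` in which it is written. -/
def HasCovariantDerivWithinAt (c : ℝ → M) (V : ∀ s, TangentSpace 𝓘(ℝ, E) (c s)) (J : Set ℝ)
    (t : ℝ) (W : TangentSpace 𝓘(ℝ, E) (c t)) : Prop :=
  ∃ p : M, c t ∈ (chartAt E p).source ∧
  ∃ c' : TangentSpace 𝓘(ℝ, E) (c t),
    HasMFDerivWithinAt 𝓘(ℝ, ℝ) 𝓘(ℝ, E) c J t ((1 : ℝ →L[ℝ] ℝ).smulRight c') ∧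
  ∃ V' : E, HasDerivWithinAt (fun s ↦ coordVec p (c s) (V s)) V' J t ∧
  ∀ w : E, chartMetric p (extChartAt 𝓘(ℝ, E) p (c t)) (coordVec p (c t) W) w =
    chartMetric p (extChartAt 𝓘(ℝ, E) p (c t)) V' w +
    christoffel p (extChartAt 𝓘(ℝ, E) p (c t)) (coordVec p (c t) c') (coordVec p (c t) (V t)) w

/-- The vector field `V` along the curve `c : J → M` is parallel: `DV/dt = 0`. -/
def IsParallelOn (c : ℝ → M) (V : ∀ s, TangentSpace 𝓘(ℝ, E) (c s)) (J : Set ℝ) : Prop :=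
  ∀ t ∈ J, HasCovariantDerivWithinAt c V J t 0

/-- The curve `c : J → M` is a geodesic: its velocity is parallel along it. -/
def IsGeodesicOn (E : Type*) [NormedAddCommGroup E] [NormedSpace ℝ E] {M : Type*}
    [TopologicalSpace M] [ChartedSpace E M]
    [RiemannianBundle (fun x : M ↦ TangentSpace 𝓘(ℝ, E) x)] (c : ℝ → M) (J : Set ℝ) : Prop :=
  ∃ c' : ∀ s, TangentSpace 𝓘(ℝ, E) (c s),
    (∀ s ∈ J, HasMFDerivWithinAt 𝓘(ℝ, ℝ) 𝓘(ℝ, E) c J s ((1 : ℝ →L[ℝ] ℝ).smulRight (c' s))) ∧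
    IsParallelOn c c' J

/-- `w` is the parallel transport of `v` along `c : [0, 1] → M`. -/
def IsParallelTransport (c : ℝ → M) (v : TangentSpace 𝓘(ℝ, E) (c 0))
    (w : TangentSpace 𝓘(ℝ, E) (c 1)) : Prop :=
  ∃ V : ∀ s, TangentSpace 𝓘(ℝ, E) (c s), IsParallelOn c V (Icc 0 1) ∧ V 0 = v ∧ V 1 = w

end Geometry

section Dynamics

variable {E : Type*} [NormedAddCommGroup E] [NormedSpace ℝ E]
  {M : Type*} [MetricSpace M] [ChartedSpace E M]

/-- `c : [0, 1] → M` is a minimizing geodesic joining `c 0` to `c 1`. -/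
def IsMinimizingGeodesic (E : Type*) [NormedAddCommGroup E] [NormedSpace ℝ E] {M : Type*}
    [MetricSpace M] [ChartedSpace E M]
    [RiemannianBundle (fun x : M ↦ TangentSpace 𝓘(ℝ, E) x)] (c : ℝ → M) : Prop :=
  IsGeodesicOn E c (Icc 0 1) ∧ Manifold.pathELength 𝓘(ℝ, E) c 0 1 = edist (c 0) (c 1)

/-- The vector field `X` is globally Lipschitz with constant `L`: for all points `p`, `q` and every
minimizing geodesic from `p` to `q`, the parallel transport `P_p^q` along it satisfies
`|P_p^q X(p) - X(q)| ≤ L d(p, q)`. -/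
def IsLipschitzField [RiemannianBundle (fun x : M ↦ TangentSpace 𝓘(ℝ, E) x)]
    (X : ∀ x : M, TangentSpace 𝓘(ℝ, E) x) (L : ℝ) : Prop :=
  ∀ c : ℝ → M, IsMinimizingGeodesic E c → ∀ w : TangentSpace 𝓘(ℝ, E) (c 1),
    IsParallelTransport c (X (c 0)) w → ‖w - X (c 1)‖ ≤ L * dist (c 0) (c 1)

/-- The time-varying vector field `f(t, x)`, `t ≥ 0`, is (jointly) of class `C¹`. -/
def IsC1TimeVaryingField [IsManifold 𝓘(ℝ, E) 1 M] (f : ℝ → ∀ x : M, TangentSpace 𝓘(ℝ, E) x) :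
    Prop :=
  ContMDiffOn (𝓘(ℝ, ℝ).prod 𝓘(ℝ, E)) (𝓘(ℝ, E).tangent) 1
    (fun p : ℝ × M ↦ (⟨p.2, f p.1 p.2⟩ : TangentBundle 𝓘(ℝ, E) M)) (Ici 0 ×ˢ univ)

/-- `c : J → M` solves `ẋ = f(t, x)`. -/
def IsSolutionOn (f : ℝ → ∀ x : M, TangentSpace 𝓘(ℝ, E) x) (c : ℝ → M) (J : Set ℝ) : Prop :=
  ∀ s ∈ J, HasMFDerivWithinAt 𝓘(ℝ, ℝ) 𝓘(ℝ, E) c J s ((1 : ℝ →L[ℝ] ℝ).smulRight (f s (c s)))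

/-- The solution of `ẋ = f(t, x)` with value `x₀` at time `t₀` exists up to time `t`
(`t < t₀` is allowed). -/
def FlowDefined (f : ℝ → ∀ x : M, TangentSpace 𝓘(ℝ, E) x) (t t₀ : ℝ) (x₀ : M) : Prop :=
  ∃ c : ℝ → M, c t₀ = x₀ ∧ IsSolutionOn f c (uIcc t₀ t)

open Classical in
/-- The flow `φ(t; t₀, x₀)`: the value at time `t` of the solution with value `x₀` at time `t₀`
(and `x₀` where there is no such solution). -/
noncomputable def flow (f : ℝ → ∀ x : M, TangentSpace 𝓘(ℝ, E) x) (t t₀ : ℝ) (x₀ : M) : M :=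
  if h : FlowDefined f t t₀ x₀ then h.choose t else x₀

/-- `xs` is an equilibrium: `φ(t; t₀, xs) = xs` for all `t ≥ t₀ ≥ 0`. -/
def IsEquilibrium (f : ℝ → ∀ x : M, TangentSpace 𝓘(ℝ, E) x) (xs : M) : Prop :=
  ∀ t₀ ≥ 0, ∀ t ≥ t₀, FlowDefined f t t₀ xs ∧ flow f t t₀ xs = xs

/-- `xs` is a uniformly globally exponentially stable equilibrium: for some `K, lam > 0`, all
`t ≥ t₀ ≥ 0` and all `x₀`, the point `φ(t; t₀, x₀)` exists and
`d(φ(t; t₀, x₀), xs) ≤ K exp(-lam (t - t₀)) d(x₀, xs)`. -/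
def IsUGES (f : ℝ → ∀ x : M, TangentSpace 𝓘(ℝ, E) x) (xs : M) : Prop :=
  IsEquilibrium f xs ∧ ∃ K > 0, ∃ lam > 0, ∀ t₀ ≥ 0, ∀ t ≥ t₀, ∀ x₀ : M,
    FlowDefined f t t₀ x₀ ∧
    dist (flow f t t₀ x₀) xs ≤ K * Real.exp (-lam * (t - t₀)) * dist x₀ xs

/-- `V : [0, ∞) × M → [0, ∞)` is a Lyapunov candidate about `xs` on all of `M`: it is
nonnegative, and `V(t, x) = 0` if and only if `x = xs`. -/
def IsLyapunovCandidate (V : ℝ → M → ℝ) (xs : M) : Prop :=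
  ∀ t ≥ 0, ∀ x, 0 ≤ V t x ∧ (V t x = 0 ↔ x = xs)

/-- `l` is the timed Lie derivative of `V` along `f` at `(t, x)`: the derivative at `s = t` of
`s ↦ V(s, φ(s; t, x))`, where times are restricted to `[0, ∞)`; so the derivative is two-sided
for `t > 0` and one-sided for `t = 0`. -/
def HasTimedLieDerivAt (f : ℝ → ∀ x : M, TangentSpace 𝓘(ℝ, E) x) (V : ℝ → M → ℝ) (l t : ℝ)
    (x : M) : Prop :=
  HasDerivWithinAt (fun s ↦ V s (flow f s t x)) l (Ici 0) t

/-- `V(t, x) = ∫_t^{t+δ} d(φ(τ; t, x), xs) dτ`. -/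
noncomputable def lyapunovFun (f : ℝ → ∀ x : M, TangentSpace 𝓘(ℝ, E) x) (xs : M) (δ : ℝ) (t : ℝ)
    (x : M) : ℝ :=
  ∫ τ in t..(t + δ), dist (flow f τ t x) xs

end Dynamics

end RiemLyap

/-! The heart of the matter is infinitesimal: the Lipschitz condition by parallel transport says
that |∇_v f| ≤ L|v|. To see this, carry f(p) in parallel along the geodesic leaving p with velocity
v, subtract f, and divide by the elapsed time; the limit is -∇_v f
(`IsLipschitzField.abs_covariant_le`). Since the hypothesis is tested only on minimizing geodesics,
short geodesics must be shown to minimize. A calibration does this in coordinates: an explicit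
function of a parameter and a position, equal to the squared speed of the geodesic times the
parameter plus a linear and a quadratic correction in the displacement from the geodesic, has total
derivative at most the energy density of any nearby curve (`IsMetricOn.exists_calibration`,
`exists_minimizing_geodesic`).

The bound on ∇f has two consequences for the flow φ.

Upper bound: the derivative of g(Zw, Zw) along a solution Z of the linearized equation is 2 g(∇_{Zw}
f, Zw) ≤ 2L g(Zw, Zw). By Grönwall, dφ(t₂; t₁, ·) has norm at most exp(L(t₂ - t₁)); integration
along almost minimizing curves makes φ(t₂; t₁, ·) Lipschitz with that constant
(`IsForwardComplete.flowDiffBound`, `IsForwardComplete.dist_flow_le`).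

Lower bound: f(t, xs) = 0, so |f(t, x)| ≤ L d(x, xs), and the distance to xs along an orbit decays
no faster than exp(-L(t - t₀)) (`IsLipschitzField.norm_le`, `IsUGES.le_dist_flow`).

The rest is short. The lower bound and exponential stability enclose V between multiples of d(x,
xs). Along an orbit V is the integral of one fixed continuous function over a sliding window, so its
derivative is d(φ(t+δ; t, x), xs) - d(x, xs), which is at most -d(x, xs)/2 once K exp(-λδ) ≤ 1/2.
The Lipschitz constant of φ makes V(t, ·) Lipschitz and justifies differentiation under the
integral; the norm of dV is then at most the Lipschitz constant of V. Away from xs only the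
smoothness of d off xs is needed, because by the lower bound orbits never reach xs. -/

namespace RiemLyap

set_option maxSynthPendingDepth 3

/-! ### Tangent vectors, fields and the metric in a chart -/

section ChartCalculus

variable {E : Type*} [NormedAddCommGroup E] [NormedSpace ℝ E]
  {M : Type*} [TopologicalSpace M] [ChartedSpace E M]

/-- The tangent vector at the point with coordinates `y` with components `u`. -/
noncomputable def ofCoord (p : M) (y u : E) : TangentSpace 𝓘(ℝ, E) ((extChartAt 𝓘(ℝ, E) p).symm y) :=
  mfderiv 𝓘(ℝ, E) 𝓘(ℝ, E) (extChartAt 𝓘(ℝ, E) p).symm y u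

theorem isOpen_target (p : M) : IsOpen (extChartAt 𝓘(ℝ, E) p).target :=
  isOpen_extChartAt_target p

theorem symm_mem_source {p : M} {y : E} (hy : y ∈ (extChartAt 𝓘(ℝ, E) p).target) :
    (extChartAt 𝓘(ℝ, E) p).symm y ∈ (chartAt E p).source := by
  rw [← extChartAt_source 𝓘(ℝ, E)]; exact (extChartAt 𝓘(ℝ, E) p).map_target hy

theorem ext_mem_target {p x : M} (hx : x ∈ (chartAt E p).source) :
    extChartAt 𝓘(ℝ, E) p x ∈ (extChartAt 𝓘(ℝ, E) p).target :=
  (extChartAt 𝓘(ℝ, E) p).map_source (by rwa [extChartAt_source])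

theorem symm_ext {p x : M} (hx : x ∈ (chartAt E p).source) :
    (extChartAt 𝓘(ℝ, E) p).symm (extChartAt 𝓘(ℝ, E) p x) = x :=
  (extChartAt 𝓘(ℝ, E) p).left_inv (by rwa [extChartAt_source])

theorem ext_symm {p : M} {y : E} (hy : y ∈ (extChartAt 𝓘(ℝ, E) p).target) :
    extChartAt 𝓘(ℝ, E) p ((extChartAt 𝓘(ℝ, E) p).symm y) = y :=
  (extChartAt 𝓘(ℝ, E) p).right_inv hy

theorem exists_eq_symm {p x : M} (hx : x ∈ (chartAt E p).source) :
    ∃ y ∈ (extChartAt 𝓘(ℝ, E) p).target, (extChartAt 𝓘(ℝ, E) p).symm y = x :=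
  ⟨_, ext_mem_target hx, symm_ext hx⟩

theorem coordVec_zero (p x : M) : coordVec p x (0 : TangentSpace 𝓘(ℝ, E) x) = 0 := map_zero _

theorem coordVec_sub (p x : M) (v w : TangentSpace 𝓘(ℝ, E) x) :
    coordVec p x (v - w) = coordVec p x v - coordVec p x w := map_sub _ _ _

section Algebra

variable [RiemannianBundle (fun x : M ↦ TangentSpace 𝓘(ℝ, E) x)]

theorem chartMetric_comm (p : M) (y u v : E) : chartMetric p y u v = chartMetric p y v u :=
  real_inner_comm _ _

theorem chartMetric_add_left (p : M) (y u v w : E) :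
    chartMetric p y (u + v) w = chartMetric p y u w + chartMetric p y v w := by
  unfold chartMetric
  rw [← inner_add_left]
  congr 1
  exact map_add (mfderiv 𝓘(ℝ, E) 𝓘(ℝ, E) (extChartAt 𝓘(ℝ, E) p).symm y) u v

theorem chartMetric_smul_left (p : M) (y : E) (a : ℝ) (u w : E) :
    chartMetric p y (a • u) w = a * chartMetric p y u w := by
  unfold chartMetric
  rw [← real_inner_smul_left]
  congr 1
  exact map_smul (mfderiv 𝓘(ℝ, E) 𝓘(ℝ, E) (extChartAt 𝓘(ℝ, E) p).symm y) a u

variable [FiniteDimensional ℝ E]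

/-- The Riemannian metric in a chart as a continuous bilinear map. -/
noncomputable def metricL (p : M) (y : E) : E →L[ℝ] E →L[ℝ] ℝ :=
  LinearMap.toContinuousLinearMap
    { toFun := fun u ↦ LinearMap.toContinuousLinearMap
        { toFun := fun v ↦ chartMetric p y u v
          map_add' := fun v w ↦ by
            rw [chartMetric_comm, chartMetric_add_left, chartMetric_comm p y v,
              chartMetric_comm p y w]
          map_smul' := fun a v ↦ by
            rw [chartMetric_comm, chartMetric_smul_left, chartMetric_comm p y v]; rfl }
      map_add' := fun v w ↦ by ext u; exact chartMetric_add_left p y v w u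
      map_smul' := fun a v ↦ by ext u; exact chartMetric_smul_left p y a v u }

@[simp] theorem metricL_apply (p : M) (y u v : E) : metricL p y u v = chartMetric p y u v := rfl

end Algebra

variable [IsManifold 𝓘(ℝ, E) ∞ M]

theorem hasMFDerivAt_symm {p : M} {y : E} (hy : y ∈ (extChartAt 𝓘(ℝ, E) p).target) :
    HasMFDerivAt 𝓘(ℝ, E) 𝓘(ℝ, E) (extChartAt 𝓘(ℝ, E) p).symm y
      (mfderiv 𝓘(ℝ, E) 𝓘(ℝ, E) (extChartAt 𝓘(ℝ, E) p).symm y) := by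
  have h := mdifferentiableWithinAt_extChartAt_symm (I := 𝓘(ℝ, E)) hy
  rw [modelWithCornersSelf_coe, range_id, mdifferentiableWithinAt_univ] at h
  exact h.hasMFDerivAt

theorem coordVec_ofCoord {p : M} {y : E} (hy : y ∈ (extChartAt 𝓘(ℝ, E) p).target) (u : E) :
    coordVec p ((extChartAt 𝓘(ℝ, E) p).symm y) (ofCoord p y u) = u := by
  have h := mfderiv_extChartAt_comp_mfderivWithin_extChartAt_symm (I := 𝓘(ℝ, E)) hy
  rw [modelWithCornersSelf_coe, range_id, mfderivWithin_univ] at h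
  exact DFunLike.congr_fun h u

theorem ofCoord_coordVec {p : M} {y : E} (hy : y ∈ (extChartAt 𝓘(ℝ, E) p).target)
    (v : TangentSpace 𝓘(ℝ, E) ((extChartAt 𝓘(ℝ, E) p).symm y)) :
    ofCoord p y (coordVec p ((extChartAt 𝓘(ℝ, E) p).symm y) v) = v := by
  have h := mfderivWithin_extChartAt_symm_comp_mfderiv_extChartAt (I := 𝓘(ℝ, E)) hy
  rw [modelWithCornersSelf_coe, range_id, mfderivWithin_univ] at h
  exact DFunLike.congr_fun h v

/-- The curve `symm ∘ c` in `M` has velocity `ofCoord c'`. -/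
theorem hasMFDerivWithinAt_symm_comp {p : M} {c : ℝ → E} {c' : E} {J : Set ℝ} {t : ℝ}
    (ht : c t ∈ (extChartAt 𝓘(ℝ, E) p).target) (h : HasDerivWithinAt c c' J t) :
    HasMFDerivWithinAt 𝓘(ℝ, ℝ) 𝓘(ℝ, E) (fun s ↦ (extChartAt 𝓘(ℝ, E) p).symm (c s)) J t
      ((1 : ℝ →L[ℝ] ℝ).smulRight (ofCoord p (c t) c')) := by
  have h1 : HasMFDerivWithinAt 𝓘(ℝ, ℝ) 𝓘(ℝ, E) c J t ((1 : ℝ →L[ℝ] ℝ).smulRight c') :=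
    (hasDerivWithinAt_iff_hasFDerivWithinAt.1 h).hasMFDerivWithinAt
  have h2 := (hasMFDerivAt_symm ht).comp_hasMFDerivWithinAt t h1
  refine h2.congr_mfderiv (ContinuousLinearMap.ext fun (r : ℝ) ↦ ?_)
  exact map_smul (mfderiv 𝓘(ℝ, E) 𝓘(ℝ, E) (extChartAt 𝓘(ℝ, E) p).symm (c t)) r c'

/-- In the chart, a curve with velocity `c'` has derivative `coordVec c'`. -/
theorem hasDerivWithinAt_ext_comp {p : M} {c : ℝ → M} {J : Set ℝ} {t : ℝ}
    {c' : TangentSpace 𝓘(ℝ, E) (c t)} (ht : c t ∈ (chartAt E p).source)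
    (h : HasMFDerivWithinAt 𝓘(ℝ, ℝ) 𝓘(ℝ, E) c J t ((1 : ℝ →L[ℝ] ℝ).smulRight c')) :
    HasDerivWithinAt (fun s ↦ extChartAt 𝓘(ℝ, E) p (c s)) (coordVec p (c t) c') J t := by
  have h1 := (mdifferentiableAt_extChartAt (I := 𝓘(ℝ, E)) ht).hasMFDerivAt.comp_hasMFDerivWithinAt
    t h
  have h2 := h1.hasFDerivWithinAt
  refine hasDerivWithinAt_iff_hasFDerivWithinAt.2 ?_
  refine h2.congr_fderiv (ContinuousLinearMap.ext fun (r : ℝ) ↦ ?_)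
  exact map_smul (mfderiv 𝓘(ℝ, E) 𝓘(ℝ, E) (extChartAt 𝓘(ℝ, E) p) (c t)) r c'

/-- The tangent map of the inverse chart carries the constant section u to this field. Pairing two
such fields yields the smoothness of the metric coefficients. -/
theorem contMDiffOn_ofCoord (p : M) (u : E) :
    ContMDiffOn 𝓘(ℝ, E) 𝓘(ℝ, E).tangent ∞
      (fun y ↦ (⟨(extChartAt 𝓘(ℝ, E) p).symm y, ofCoord p y u⟩ : TangentBundle 𝓘(ℝ, E) M))
      (extChartAt 𝓘(ℝ, E) p).target := by
  have h1 := (contMDiffOn_extChartAt_symm (I := 𝓘(ℝ, E)) (n := ∞) p).contMDiffOn_tangentMapWithin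
    (m := ∞) (by simp) (isOpen_target p).uniqueMDiffOn
  have h2 : ContMDiffOn 𝓘(ℝ, E) 𝓘(ℝ, E).tangent ∞
      (fun y ↦ (⟨y, u⟩ : TangentBundle 𝓘(ℝ, E) E)) (extChartAt 𝓘(ℝ, E) p).target := fun y _ ↦
    contMDiffWithinAt_vectorSpace_iff_contDiffWithinAt.2 contDiffWithinAt_const
  refine (h1.comp h2 (fun y hy ↦ hy)).congr fun y hy ↦ ?_
  simp only [Function.comp, tangentMapWithin]
  rw [mfderivWithin_of_isOpen (isOpen_target p) hy]
  rfl

theorem contMDiffOn_coordVec (p : M) :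
    ContMDiffOn 𝓘(ℝ, E).tangent 𝓘(ℝ, E) ∞
      (fun z : TangentBundle 𝓘(ℝ, E) M ↦ coordVec p z.1 z.2)
      (π E (TangentSpace 𝓘(ℝ, E)) ⁻¹' (chartAt E p).source) := by
  have h1 := (contMDiffOn_extChartAt (I := 𝓘(ℝ, E)) (n := ∞) (x := p)).contMDiffOn_tangentMapWithin
    (m := ∞) (by simp) (chartAt E p).open_source.uniqueMDiffOn
  refine ((contMDiff_snd_tangentBundle_modelSpace E 𝓘(ℝ, E)).comp_contMDiffOn h1).congr
    fun z hz ↦ ?_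
  simp only [Function.comp, tangentMapWithin]
  rw [mfderivWithin_of_isOpen (chartAt E p).open_source hz]
  rfl

/-- The components of a time-varying vector field in the preferred chart around `p`. -/
noncomputable def coordField (f : ℝ → ∀ x : M, TangentSpace 𝓘(ℝ, E) x) (p : M) (t : ℝ) (y : E) :
    E :=
  coordVec p ((extChartAt 𝓘(ℝ, E) p).symm y) (f t ((extChartAt 𝓘(ℝ, E) p).symm y))

theorem contDiffOn_coordField {f : ℝ → ∀ x : M, TangentSpace 𝓘(ℝ, E) x}
    (hf : ContMDiffOn (𝓘(ℝ, ℝ).prod 𝓘(ℝ, E)) (𝓘(ℝ, E).tangent) 1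
      (fun p : ℝ × M ↦ (⟨p.2, f p.1 p.2⟩ : TangentBundle 𝓘(ℝ, E) M)) (Ici 0 ×ˢ univ)) (p : M) :
    ContDiffOn ℝ 1 (fun z : ℝ × E ↦ coordField f p z.1 z.2)
      (Ici 0 ×ˢ (extChartAt 𝓘(ℝ, E) p).target) := by
  have h1 : ContMDiffOn (𝓘(ℝ, ℝ).prod 𝓘(ℝ, E)) (𝓘(ℝ, ℝ).prod 𝓘(ℝ, E)) 1
      (fun z : ℝ × E ↦ (z.1, (extChartAt 𝓘(ℝ, E) p).symm z.2))
      (Ici 0 ×ˢ (extChartAt 𝓘(ℝ, E) p).target) :=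
    contMDiffOn_fst.prodMk ((contMDiffOn_extChartAt_symm (I := 𝓘(ℝ, E)) (n := 1) p).comp
      contMDiffOn_snd fun z hz ↦ hz.2)
  have h2 := hf.comp h1 (fun z hz ↦ ⟨hz.1, mem_univ _⟩)
  have h3 := ((contMDiffOn_coordVec (E := E) p).of_le (m := 1) (by norm_num)).comp h2
    (fun z hz ↦ symm_mem_source hz.2)
  have h4 : ContMDiffOn 𝓘(ℝ, ℝ × E) 𝓘(ℝ, E) 1 (fun z : ℝ × E ↦ coordField f p z.1 z.2)
      (Ici 0 ×ˢ (extChartAt 𝓘(ℝ, E) p).target) := by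
    rw [modelWithCornersSelf_prod, ← chartedSpaceSelf_prod]
    exact h3
  exact contMDiffOn_iff_contDiffOn.1 h4

section Metric

variable [RiemannianBundle (fun x : M ↦ TangentSpace 𝓘(ℝ, E) x)]

theorem norm_sq_eq_chartMetric {p : M} {y : E} (hy : y ∈ (extChartAt 𝓘(ℝ, E) p).target)
    (v : TangentSpace 𝓘(ℝ, E) ((extChartAt 𝓘(ℝ, E) p).symm y)) :
    ‖v‖ ^ 2 = chartMetric p y (coordVec p _ v) (coordVec p _ v) := by
  have h := ofCoord_coordVec hy v
  unfold ofCoord at h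
  unfold chartMetric
  rw [h, real_inner_self_eq_norm_sq]

theorem norm_sq_eq_chartMetric' {p x : M} (hx : x ∈ (chartAt E p).source)
    (v : TangentSpace 𝓘(ℝ, E) x) :
    ‖v‖ ^ 2 = chartMetric p (extChartAt 𝓘(ℝ, E) p x) (coordVec p x v) (coordVec p x v) := by
  obtain ⟨y, hy, rfl⟩ := exists_eq_symm hx
  rw [ext_symm hy]
  exact norm_sq_eq_chartMetric hy v

theorem chartMetric_pos {p : M} {y : E} (hy : y ∈ (extChartAt 𝓘(ℝ, E) p).target) {u : E}
    (hu : u ≠ 0) : 0 < chartMetric p y u u := by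
  have h : ‖ofCoord p y u‖ ^ 2 = chartMetric p y u u := by
    rw [norm_sq_eq_chartMetric hy, coordVec_ofCoord hy]
  rw [← h]
  have : ofCoord p y u ≠ 0 := fun h0 ↦ hu <| by
    rw [← coordVec_ofCoord hy u, h0, coordVec_zero]
  positivity

theorem contDiffOn_chartMetric
    [IsContMDiffRiemannianBundle 𝓘(ℝ, E) ∞ E (fun x : M ↦ TangentSpace 𝓘(ℝ, E) x)]
    (p : M) (u v : E) :
    ContDiffOn ℝ ∞ (fun y ↦ chartMetric p y u v) (extChartAt 𝓘(ℝ, E) p).target :=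
  contMDiffOn_iff_contDiffOn.1
    (ContMDiffOn.inner_bundle (IB := 𝓘(ℝ, E)) (F := E) (E := fun x : M ↦ TangentSpace 𝓘(ℝ, E) x)
      (v := fun y ↦ ofCoord p y u) (w := fun y ↦ ofCoord p y v)
      (contMDiffOn_ofCoord p u) (contMDiffOn_ofCoord p v))

variable [FiniteDimensional ℝ E]

theorem contDiffOn_metricL
    [IsContMDiffRiemannianBundle 𝓘(ℝ, E) ∞ E (fun x : M ↦ TangentSpace 𝓘(ℝ, E) x)] (p : M) :
    ContDiffOn ℝ ∞ (metricL p) (extChartAt 𝓘(ℝ, E) p).target :=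
  contDiffOn_clm_apply.2 fun u ↦ contDiffOn_clm_apply.2 fun v ↦ contDiffOn_chartMetric p u v

end Metric

end ChartCalculus

/-! ### Geodesic and parallel transport equations in coordinates -/

section LocalMetric

variable {E : Type*} [NormedAddCommGroup E] [NormedSpace ℝ E]

/-- The Christoffel symbols of the first kind of a field `G` of bilinear forms. -/
noncomputable def christoffelOf (G : E → E →L[ℝ] E →L[ℝ] ℝ) (y u v w : E) : ℝ :=
  (fderiv ℝ G y u v w + fderiv ℝ G y v u w - fderiv ℝ G y w u v) / 2

/-- `G` is a smooth Riemannian metric on the open set `U`. -/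
structure IsMetricOn (G : E → E →L[ℝ] E →L[ℝ] ℝ) (U : Set E) : Prop where
  isOpen : IsOpen U
  smooth : ContDiffOn ℝ ∞ G U
  symm : ∀ y u v, G y u v = G y v u
  pos : ∀ y ∈ U, ∀ u, u ≠ 0 → 0 < G y u u

variable {G : E → E →L[ℝ] E →L[ℝ] ℝ} {U : Set E}

namespace IsMetricOn

theorem contDiffAt (h : IsMetricOn G U) {y : E} (hy : y ∈ U) : ContDiffAt ℝ ∞ G y :=
  h.smooth.contDiffAt (h.isOpen.mem_nhds hy)

theorem hasFDerivAt (h : IsMetricOn G U) {y : E} (hy : y ∈ U) :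
    HasFDerivAt G (fderiv ℝ G y) y :=
  ((h.contDiffAt hy).differentiableAt (by simp)).hasFDerivAt

theorem fderiv_symm (h : IsMetricOn G U) {y : E} (hy : y ∈ U) (a u v : E) :
    fderiv ℝ G y a u v = fderiv ℝ G y a v u := by
  have h1 : ∀ u v, HasFDerivAt (fun z ↦ G z u v) (((fderiv ℝ G y).flip u).flip v) y := fun u v ↦ by
    convert! ((h.hasFDerivAt hy).clm_apply (hasFDerivAt_const u y)).clm_apply
      (hasFDerivAt_const v y) using 1
    ext; simp
  have h2 := (h1 u v).unique ((h1 v u).congr_of_eventuallyEq (Eventually.of_forall fun z ↦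
    h.symm z u v))
  simpa using DFunLike.congr_fun h2 a

theorem nonneg (h : IsMetricOn G U) {y : E} (hy : y ∈ U) (u : E) : 0 ≤ G y u u := by
  rcases eq_or_ne u 0 with rfl | hu
  · simp
  · exact (h.pos y hy u hu).le

/-- Derivative of `G (x s) (v s) (w s)` along a curve. -/
theorem hasDerivWithinAt_apply (h : IsMetricOn G U) {x v w : ℝ → E} {x' v' w' : E} {J : Set ℝ}
    {s : ℝ} (hs : x s ∈ U) (hx : HasDerivWithinAt x x' J s) (hv : HasDerivWithinAt v v' J s)
    (hw : HasDerivWithinAt w w' J s) :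
    HasDerivWithinAt (fun s ↦ G (x s) (v s) (w s))
      (fderiv ℝ G (x s) x' (v s) (w s) + G (x s) v' (w s) + G (x s) (v s) w') J s := by
  have h1 : HasDerivWithinAt (fun s ↦ G (x s)) (fderiv ℝ G (x s) x') J s :=
    (h.hasFDerivAt hs).comp_hasDerivWithinAt s hx
  have h2 := (h1.clm_apply hv).clm_apply hw
  simpa using h2

/-- Positivity makes G_y injective into the dual, which has the same dimension. Equations given by
pairing with an arbitrary w can thus be solved for the acceleration. -/
theorem bijective [FiniteDimensional ℝ E] (h : IsMetricOn G U) {y : E} (hy : y ∈ U) :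
    ∃ e : E ≃L[ℝ] (E →L[ℝ] ℝ), (e : E →L[ℝ] (E →L[ℝ] ℝ)) = G y := by
  have hinj : Function.Injective (G y : E →ₗ[ℝ] (E →L[ℝ] ℝ)) := by
    rw [← LinearMap.ker_eq_bot, LinearMap.ker_eq_bot']
    intro u hu
    by_contra hne
    have := h.pos y hy u hne
    have h2 : G y u = 0 := hu
    rw [h2] at this
    simp at this
  have hfin : Module.finrank ℝ E = Module.finrank ℝ (E →L[ℝ] ℝ) := by
    rw [← (LinearMap.toContinuousLinearMap (𝕜 := ℝ) (E := E) (F' := ℝ)).finrank_eq]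
    exact (Subspace.dual_finrank_eq (K := ℝ) (V := E)).symm
  refine ⟨(LinearEquiv.ofInjectiveOfFinrankEq _ hinj hfin).toContinuousLinearEquiv, ?_⟩
  ext u v
  rfl

end IsMetricOn

/-- The covector `w ↦ christoffelOf G y u v w`. -/
noncomputable def christoffelL (G : E → E →L[ℝ] E →L[ℝ] ℝ) (y u v : E) : E →L[ℝ] ℝ :=
  (1 / 2 : ℝ) • (fderiv ℝ G y u v + fderiv ℝ G y v u - ((fderiv ℝ G y).flip u).flip v)

theorem christoffelL_apply (G : E → E →L[ℝ] E →L[ℝ] ℝ) (y u v w : E) :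
    christoffelL G y u v w = christoffelOf G y u v w := by
  simp [christoffelL, christoffelOf]; ring

/-- Existence of short geodesics with a parallel vector field along them. -/
theorem exists_geodesic_parallel [FiniteDimensional ℝ E] (h : IsMetricOn G U) {y₀ : E}
    (hy₀ : y₀ ∈ U) (v₀ W₀ : E) :
    ∃ a > 0, ∃ x v W A B : ℝ → E, x 0 = y₀ ∧ v 0 = v₀ ∧ W 0 = W₀ ∧ ∀ s ∈ Ioo (-a) a,
      x s ∈ U ∧ HasDerivAt x (v s) s ∧ HasDerivAt v (A s) s ∧ HasDerivAt W (B s) s ∧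
      (∀ w, G (x s) (A s) w = -christoffelOf G (x s) (v s) (v s) w) ∧
      ∀ w, G (x s) (B s) w = -christoffelOf G (x s) (v s) (W s) w := by
  have hopen : IsOpen (U ×ˢ (univ : Set (E × E))) := h.isOpen.prod isOpen_univ
  have hfst : ContDiffOn ℝ ∞ (fun z : E × E × E ↦ G z.1) (U ×ˢ univ) :=
    h.smooth.comp contDiffOn_fst fun z hz ↦ hz.1
  have hdG : ContDiffOn ℝ 1 (fun z : E × E × E ↦ fderiv ℝ G z.1) (U ×ˢ univ) :=
    ((h.smooth.fderiv_of_isOpen (m := ∞) h.isOpen (by simp)).of_le (by simp)).comp contDiffOn_fst fun z hz ↦ hz.1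
  have hchr : ∀ f g : E × E × E → E, ContDiffOn ℝ 1 f (U ×ˢ univ) → ContDiffOn ℝ 1 g (U ×ˢ univ) →
      ContDiffOn ℝ 1 (fun z ↦ christoffelL G z.1 (f z) (g z)) (U ×ˢ univ) := by
    intro f g hf hg
    refine contDiffOn_clm_apply.2 fun w ↦ ?_
    simp only [christoffelL_apply, christoffelOf]
    exact ((((hdG.clm_apply hf).clm_apply hg).clm_apply contDiffOn_const).add
      (((hdG.clm_apply hg).clm_apply hf).clm_apply contDiffOn_const)).sub
      (((hdG.clm_apply contDiffOn_const).clm_apply hf).clm_apply hg) |>.div_const 2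
  have hinv : ContDiffOn ℝ 1 (fun z : E × E × E ↦ (G z.1).inverse) (U ×ˢ univ) := by
    intro z hz
    obtain ⟨e, he⟩ := h.bijective hz.1
    have h1 : ContDiffAt ℝ 1 ContinuousLinearMap.inverse (G z.1) := he ▸ contDiffAt_map_inverse e
    exact h1.comp_contDiffWithinAt z ((hfst z hz).of_le (by simp))
  have hv : ContDiffOn ℝ 1 (fun z : E × E × E ↦ z.2.1) (U ×ˢ univ) := by fun_prop
  have hW : ContDiffOn ℝ 1 (fun z : E × E × E ↦ z.2.2) (U ×ˢ univ) := by fun_prop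
  -- The geodesic and transport equations form one autonomous first-order system in (x, v, W); the
  -- inverse of G raises the index of the Christoffel covector.
  let Z : E × E × E → E × E × E := fun z ↦
    (z.2.1, -(G z.1).inverse (christoffelL G z.1 z.2.1 z.2.1),
      -(G z.1).inverse (christoffelL G z.1 z.2.1 z.2.2))
  have hZ : ContDiffOn ℝ 1 Z (U ×ˢ univ) :=
    hv.prodMk ((hinv.clm_apply (hchr _ _ hv hv)).neg.prodMk (hinv.clm_apply (hchr _ _ hv hW)).neg)
  have hz₀ : (y₀, v₀, W₀) ∈ U ×ˢ (univ : Set (E × E)) := ⟨hy₀, mem_univ _⟩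
  obtain ⟨α, hα0, ε, hε, hα⟩ :=
    (hZ.contDiffAt (hopen.mem_nhds hz₀)).exists_forall_mem_closedBall_exists_eq_forall_mem_Ioo_hasDerivAt₀ 0
  simp only [zero_sub, zero_add] at hα
  have hcont : ContinuousAt α 0 := (hα 0 ⟨by linarith, hε⟩).continuousAt
  have hev : ∀ᶠ s in 𝓝 (0 : ℝ), (α s).1 ∈ U := by
    refine (continuous_fst.continuousAt.comp hcont).eventually_mem ?_
    simp only [Function.comp, hα0]
    exact h.isOpen.mem_nhds hy₀
  obtain ⟨b, hb, hbU⟩ := Metric.eventually_nhds_iff.1 hev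
  refine ⟨min ε b, lt_min hε hb, fun s ↦ (α s).1, fun s ↦ (α s).2.1, fun s ↦ (α s).2.2,
    fun s ↦ (Z (α s)).2.1, fun s ↦ (Z (α s)).2.2, by simp [hα0], by simp [hα0], by simp [hα0], ?_⟩
  intro s hs
  have hsε : s ∈ Ioo (-ε) ε := ⟨by linarith [hs.1, min_le_left ε b], hs.2.trans_le (min_le_left _ _)⟩
  have hsU : (α s).1 ∈ U := hbU (by
    rw [Real.dist_eq, sub_zero, abs_lt]
    exact ⟨by linarith [hs.1, min_le_right ε b], hs.2.trans_le (min_le_right _ _)⟩)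
  have hd := hα s hsε
  have hd1 : HasDerivAt (fun s ↦ (α s).1) (Z (α s)).1 s :=
    (hasFDerivAt_fst (𝕜 := ℝ) (E := E) (F := E × E)).comp_hasDerivAt s hd
  have hd2 : HasDerivAt (fun s ↦ (α s).2) (Z (α s)).2 s :=
    (hasFDerivAt_snd (𝕜 := ℝ) (E := E) (F := E × E)).comp_hasDerivAt s hd
  have hd3 : HasDerivAt (fun s ↦ (α s).2.1) (Z (α s)).2.1 s :=
    (hasFDerivAt_fst (𝕜 := ℝ) (E := E) (F := E)).comp_hasDerivAt s hd2
  have hd4 : HasDerivAt (fun s ↦ (α s).2.2) (Z (α s)).2.2 s :=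
    (hasFDerivAt_snd (𝕜 := ℝ) (E := E) (F := E)).comp_hasDerivAt s hd2
  obtain ⟨e, he⟩ := h.bijective hsU
  have hinv' : ∀ ξ : E →L[ℝ] ℝ, G (α s).1 ((G (α s).1).inverse ξ) = ξ := fun ξ ↦ by
    rw [← he]; simp
  refine ⟨hsU, hd1, hd3, hd4, fun w ↦ ?_, fun w ↦ ?_⟩
  · simp only [Z, map_neg, neg_apply, hinv', christoffelL_apply]
  · simp only [Z, map_neg, neg_apply, hinv', christoffelL_apply]

/-- Geodesics have constant speed. -/
theorem geodesic_speed_const (h : IsMetricOn G U) {x v A : ℝ → E} {a : ℝ}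
    (hx : ∀ s ∈ Ioo (-a) a, x s ∈ U ∧ HasDerivAt x (v s) s ∧ HasDerivAt v (A s) s ∧
      ∀ w, G (x s) (A s) w = -christoffelOf G (x s) (v s) (v s) w)
    {s t : ℝ} (hs : s ∈ Ioo (-a) a) (ht : t ∈ Ioo (-a) a) :
    G (x s) (v s) (v s) = G (x t) (v t) (v t) := by
  have hd : ∀ s ∈ Ioo (-a) a, HasDerivWithinAt (fun s ↦ G (x s) (v s) (v s)) 0 (Ioo (-a) a) s := by
    intro s hs
    obtain ⟨hU, h1, h2, h3⟩ := hx s hs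
    convert! h.hasDerivWithinAt_apply hU h1.hasDerivWithinAt h2.hasDerivWithinAt
      h2.hasDerivWithinAt using 1
    rw [h.symm (x s) (v s) (A s), h3]
    simp only [christoffelOf]
    ring
  exact (convex_Ioo (-a) a).is_const_of_fderivWithin_eq_zero
    (fun s hs ↦ (hd s hs).differentiableWithinAt)
    (fun s hs ↦ by
      rw [(hd s hs).hasFDerivWithinAt.fderivWithin (isOpen_Ioo.uniqueDiffWithinAt hs)]
      ext; simp) hs ht

end LocalMetric

/-! ### The calibration inequality -/

section Calibration

variable {E : Type*} [NormedAddCommGroup E] [NormedSpace ℝ E]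
  {G : E → E →L[ℝ] E →L[ℝ] ℝ} {U : Set E}

theorem IsMetricOn.exists_lower_bound [FiniteDimensional ℝ E] (h : IsMetricOn G U) {y₀ : E}
    (hy₀ : y₀ ∈ U) : ∃ m > 0, ∀ u, m * ‖u‖ ^ 2 ≤ G y₀ u u := by
  have hc : Continuous fun u ↦ G y₀ u u := by fun_prop
  -- The unit sphere is empty exactly when E is trivial; otherwise m is the minimum of the quadratic
  -- form on it.
  rcases (Metric.sphere (0 : E) 1).eq_empty_or_nonempty with he | hne
  · refine ⟨1, one_pos, fun u ↦ ?_⟩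
    rcases eq_or_ne u 0 with rfl | hu
    · simp
    · exfalso
      have : (‖u‖⁻¹ • u) ∈ Metric.sphere (0 : E) 1 := by
        simp [norm_smul, inv_mul_cancel₀ (norm_ne_zero_iff.2 hu)]
      rw [he] at this
      exact this
  · obtain ⟨z, hz, hmin⟩ := (isCompact_sphere (0 : E) 1).exists_isMinOn hne hc.continuousOn
    have hz1 : ‖z‖ = 1 := by simpa using hz
    refine ⟨G y₀ z z, h.pos _ hy₀ _ (by rintro rfl; simp at hz1), fun u ↦ ?_⟩
    rcases eq_or_ne u 0 with rfl | hu
    · simp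
    · have hn : ‖u‖ ≠ 0 := norm_ne_zero_iff.2 hu
      have hmem : (‖u‖⁻¹ • u) ∈ Metric.sphere (0 : E) 1 := by
        simp [norm_smul, inv_mul_cancel₀ hn]
      have h1 : G y₀ z z ≤ G y₀ (‖u‖⁻¹ • u) (‖u‖⁻¹ • u) := hmin hmem
      simp only [map_smul, smul_apply, smul_eq_mul] at h1
      calc G y₀ z z * ‖u‖ ^ 2 ≤ (‖u‖⁻¹ * (‖u‖⁻¹ * G y₀ u u)) * ‖u‖ ^ 2 := by gcongr
        _ = G y₀ u u := by field_simp

/-- Uniform estimates for a metric and its derivative near a point. -/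
theorem IsMetricOn.exists_local_bounds [FiniteDimensional ℝ E] (h : IsMetricOn G U) {y₀ : E}
    (hy₀ : y₀ ∈ U) : ∃ r > 0, Metric.ball y₀ r ⊆ U ∧ ∃ m > 0, ∃ M₁ ≥ 0, ∃ M₂ ≥ 0,
      (∀ y ∈ Metric.ball y₀ r, ∀ u, m * ‖u‖ ^ 2 ≤ G y u u) ∧
      (∀ y ∈ Metric.ball y₀ r, ∀ z ∈ Metric.ball y₀ r, ‖G y - G z‖ ≤ M₁ * ‖y - z‖) ∧
      ∀ y ∈ Metric.ball y₀ r, ∀ z ∈ Metric.ball y₀ r,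
        ‖G y - G z - fderiv ℝ G z (y - z)‖ ≤ M₂ * ‖y - z‖ ^ 2 := by
  obtain ⟨m, hm, hmb⟩ := h.exists_lower_bound hy₀
  have hG1 : ContDiffAt ℝ 1 G y₀ := (h.contDiffAt hy₀).of_le (by simp)
  have hG2 : ContDiffAt ℝ 1 (fderiv ℝ G) y₀ :=
    (((h.smooth.fderiv_of_isOpen (m := ∞) h.isOpen (by simp)).of_le (by simp)).contDiffAt
      (h.isOpen.mem_nhds hy₀))
  obtain ⟨K₁, t₁, ht₁, hK₁⟩ := hG1.exists_lipschitzOnWith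
  obtain ⟨K₂, t₂, ht₂, hK₂⟩ := hG2.exists_lipschitzOnWith
  have hclose : ∀ᶠ y in 𝓝 y₀, ‖G y - G y₀‖ < m / 2 := by
    have := hG1.continuousAt.eventually (Metric.ball_mem_nhds (G y₀) (half_pos hm))
    filter_upwards [this] with y hy
    rwa [← dist_eq_norm]
  obtain ⟨r, hr, hball⟩ := Metric.mem_nhds_iff.1
    (inter_mem (inter_mem ht₁ ht₂) (inter_mem hclose (h.isOpen.mem_nhds hy₀)))
  refine ⟨r, hr, fun y hy ↦ (hball hy).2.2, m / 2, half_pos hm, K₁, K₁.2, K₂, K₂.2,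
    fun y hy u ↦ ?_, fun y hy z hz ↦ ?_, fun y hy z hz ↦ ?_⟩
  · have h1 : ‖(G y - G y₀) u u‖ ≤ m / 2 * ‖u‖ * ‖u‖ :=
      ((G y - G y₀).le_opNorm₂ u u).trans (by gcongr; exact (hball hy).2.1.le)
    have h2 : (G y - G y₀) u u = G y u u - G y₀ u u := by simp
    rw [h2, Real.norm_eq_abs] at h1
    nlinarith [hmb u, neg_abs_le (G y u u - G y₀ u u)]
  · simpa [dist_eq_norm] using hK₁.dist_le_mul y (hball hy).1.1 z (hball hz).1.1
  -- The derivative of G is Lipschitz, so the mean value inequality on the segment leaves a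
  -- quadratic remainder.
  · have hseg : segment ℝ z y ⊆ Metric.ball y₀ r := (convex_ball y₀ r).segment_subset hz hy
    have hb : ∀ w ∈ segment ℝ z y, ‖fderiv ℝ G w - fderiv ℝ G z‖ ≤ K₂ * ‖y - z‖ := by
      intro w hw
      have h1 := hK₂.dist_le_mul w (hball (hseg hw)).1.2 z (hball hz).1.2
      rw [dist_eq_norm, dist_eq_norm] at h1
      refine h1.trans ?_
      gcongr
      have := norm_sub_le_of_mem_segment hw
      exact this
    have := (convex_segment z y).norm_image_sub_le_of_norm_hasFDerivWithin_le' (f := G)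
      (f' := fderiv ℝ G) (φ := fderiv ℝ G z)
      (fun w hw ↦ (h.hasFDerivAt (hball (hseg hw)).2.2).hasFDerivWithinAt) hb
      (left_mem_segment ℝ z y) (right_mem_segment ℝ z y)
    calc _ ≤ _ := this
      _ = _ := by ring

/-- Pointwise calibration inequality: near a short geodesic the energy density dominates the total
derivative of an explicit function. -/
theorem IsMetricOn.exists_calibration [FiniteDimensional ℝ E] (h : IsMetricOn G U) {y₀ : E}
    (hy₀ : y₀ ∈ U) : ∃ r > 0, Metric.ball y₀ r ⊆ U ∧ ∃ κ > 0, ∃ k : ℝ,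
      ∀ c ∈ Metric.ball y₀ r, ∀ y ∈ Metric.ball y₀ r, ∀ v A : E, ‖v‖ ≤ κ →
      (∀ w, G c A w = -christoffelOf G c v v w) → ∀ s ∈ Icc (0 : ℝ) 1, ∀ u,
      G c v v + 2 * (fderiv ℝ G c v v (y - c) + G c A (y - c) + G c v (u - v))
        - 2 * k * G y₀ (y - c) (y - c)
        + (-2 * k * (s - 1 / 2)) * (2 * G y₀ (y - c) (u - v)) ≤ G y u u := by
  obtain ⟨r, hr, hrU, m, hm, M₁, hM₁, M₂, hM₂, hlow, hlip, htay⟩ := h.exists_local_bounds hy₀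
  set M := ‖G y₀‖ + 1 with hM
  have hMpos : 0 < M := by positivity
  -- With k = q² the weight -2k(s - 1/2) is at most q² in absolute value on [0, 1]. The relation q²M
  -- = qm/2 then bounds the term carrying that weight by q m |y - c| |u - v|.
  set q := m / (2 * M) with hq
  have hqpos : 0 < q := by positivity
  have hqM : q ^ 2 * M = q * m / 2 := by rw [hq]; field_simp
  -- For |v| ≤ κ the Taylor error of G(v, v) is at most q² m |y - c|², and twice the error of G(v, u
  -- - v) is at most q m |y - c| |u - v|.
  obtain ⟨κ, hκ, hκ1, hκ2⟩ : ∃ κ > 0, M₁ * κ ≤ q * m / 2 ∧ M₂ * κ ^ 2 ≤ q ^ 2 * m := by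
    have hev : ∀ᶠ κ in 𝓝[>] (0 : ℝ), M₁ * κ < q * m / 2 ∧ M₂ * κ ^ 2 < q ^ 2 * m := by
      refine nhdsWithin_le_nhds (Filter.Eventually.and ?_ ?_)
      · refine ContinuousAt.eventually_lt (by fun_prop) continuousAt_const ?_
        simp only [mul_zero]; positivity
      · refine ContinuousAt.eventually_lt (by fun_prop) continuousAt_const ?_
        simp only [ne_eq, OfNat.ofNat_ne_zero, not_false_eq_true, zero_pow, mul_zero]; positivity
    obtain ⟨κ, hκ, hκ0⟩ := (hev.and self_mem_nhdsWithin).exists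
    exact ⟨κ, hκ0, hκ.1.le, hκ.2.le⟩
  refine ⟨r, hr, hrU, κ, hκ, q ^ 2, fun c hc y hy v A hv hA s hs u ↦ ?_⟩
  obtain ⟨e, rfl⟩ : ∃ e, u = v + e := ⟨u - v, by abel⟩
  obtain ⟨η, rfl⟩ : ∃ η, y = c + η := ⟨y - c, by abel⟩
  simp only [add_sub_cancel_left]
  have hlow' := hlow _ hy e
  have hlip' := hlip _ hy _ hc
  have htay' := htay _ hy _ hc
  simp only [add_sub_cancel_left] at hlip' htay'
  set N := ‖η‖
  set n := ‖e‖
  have hN : 0 ≤ N := norm_nonneg _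
  have hn : 0 ≤ n := norm_nonneg _
  have e1 : |G (c + η) v v - G c v v - fderiv ℝ G c η v v| ≤ q ^ 2 * m * N ^ 2 := by
    have h1 := (G (c + η) - G c - fderiv ℝ G c η).le_opNorm₂ v v
    simp only [sub_apply, Real.norm_eq_abs] at h1
    calc _ ≤ _ := h1
      _ ≤ M₂ * N ^ 2 * κ * κ := by gcongr
      _ = (M₂ * κ ^ 2) * N ^ 2 := by ring
      _ ≤ _ := by gcongr
  have e2 : |G (c + η) v e - G c v e| ≤ q * m / 2 * (N * n) := by
    have h1 := (G (c + η) - G c).le_opNorm₂ v e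
    simp only [sub_apply, Real.norm_eq_abs] at h1
    calc _ ≤ _ := h1
      _ ≤ M₁ * N * κ * n := by gcongr
      _ = (M₁ * κ) * (N * n) := by ring
      _ ≤ _ := by gcongr
  have e3 : |(-2 * q ^ 2 * (s - 1 / 2)) * (2 * G y₀ η e)| ≤ q * m * (N * n) := by
    have h1 := (G y₀).le_opNorm₂ η e
    rw [Real.norm_eq_abs] at h1
    have h2 : |G y₀ η e| ≤ M * N * n := h1.trans (by gcongr; rw [hM]; linarith)
    have h3 : |s - 1 / 2| ≤ 1 / 2 := by rw [abs_le]; constructor <;> linarith [hs.1, hs.2]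
    have h4 : |(-2 * q ^ 2 * (s - 1 / 2)) * (2 * G y₀ η e)|
        = 4 * q ^ 2 * |s - 1 / 2| * |G y₀ η e| := by
      rw [abs_mul, abs_mul, abs_mul, abs_mul, abs_neg]
      simp only [Nat.abs_ofNat, abs_pow, abs_of_pos hqpos]; ring
    rw [h4]
    calc _ ≤ 4 * q ^ 2 * (1 / 2) * (M * N * n) := by gcongr
      _ = 2 * (q ^ 2 * M) * (N * n) := by ring
      _ = _ := by rw [hqM]; ring
  have e4 : m * N ^ 2 ≤ G y₀ η η := hlow _ (Metric.mem_ball_self hr) η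
  -- By the geodesic equation 2(∂_v G(v, η) + G(A, η)) = ∂_η G(v, v), which is exactly the
  -- first-order Taylor term of G_{c+η}(v, v).
  have e5 : G c A η = -(fderiv ℝ G c v v η - fderiv ℝ G c η v v / 2) := by
    rw [hA]; simp only [christoffelOf]; ring
  have e6 : G (c + η) (v + e) (v + e)
      = G (c + η) v v + 2 * G (c + η) v e + G (c + η) e e := by
    simp only [map_add, add_apply]
    rw [h.symm (c + η) e v]; ring
  rw [e5, e6]
  -- The gains are m n² and 2q² m N², the errors cost at most q² m N² + 2q m N n; what remains is
  -- this square.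
  have e7 : 0 ≤ m * (n - q * N) ^ 2 := by positivity
  have e8 := abs_le.1 e1
  have e9 := abs_le.1 e2
  have e10 := abs_le.1 e3
  have e11 : q ^ 2 * (m * N ^ 2) ≤ q ^ 2 * G y₀ η η := by gcongr
  nlinarith [e8.1, e9.1, e10.2, e11, e7, hlow']

end Calibration

/-! ### Local minimality of geodesics -/

section Minimality

variable {E : Type*} [NormedAddCommGroup E] [NormedSpace ℝ E]
  {G : E → E →L[ℝ] E →L[ℝ] ℝ} {U : Set E}

/-- Short geodesics minimize the length among nearby curves with the same end points. -/
theorem IsMetricOn.exists_geodesic_minimizes [FiniteDimensional ℝ E] (h : IsMetricOn G U) {y₀ : E}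
    (hy₀ : y₀ ∈ U) : ∃ r > 0, Metric.ball y₀ r ⊆ U ∧ ∃ κ > 0, ∀ (C v A : ℝ → E) (S : ℝ), 0 ≤ S →
      (∀ s ∈ Icc (0 : ℝ) 1, C s ∈ Metric.ball y₀ r ∧ HasDerivAt C (v s) s ∧ HasDerivAt v (A s) s ∧
        (∀ w, G (C s) (A s) w = -christoffelOf G (C s) (v s) (v s) w) ∧ ‖v s‖ ≤ κ ∧
        G (C s) (v s) (v s) = S ^ 2) →
      ∀ (y u : ℝ → E) (n : ℝ → ℝ), Continuous n →
      (∀ t ∈ Icc (0 : ℝ) 1, 0 ≤ n t ∧ y t ∈ Metric.ball y₀ r ∧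
        HasDerivWithinAt y (u t) (Icc 0 1) t ∧ G (y t) (u t) (u t) = n t ^ 2) →
      y 0 = C 0 → y 1 = C 1 → S ≤ ∫ t in (0 : ℝ)..1, n t := by
  obtain ⟨r, hr, hrU, κ, hκ, k, hcal⟩ := h.exists_calibration hy₀
  refine ⟨r, hr, hrU, κ, hκ, fun C v A S hS hC y u n hn hy hy0 hy1 ↦ ?_⟩
  set ℓ := ∫ t in (0 : ℝ)..1, n t with hℓ
  have hℓ0 : 0 ≤ ℓ := intervalIntegral.integral_nonneg zero_le_one fun t ht ↦ (hy t ht).1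
  -- The shift e > 0 keeps the reparametrization by arc length regular where the speed n vanishes.
  have key : ∀ e > 0, S ^ 2 ≤ (ℓ + e) * ℓ := by
    intro e he
    set Λ := ℓ + e with hΛ
    have hΛ0 : 0 < Λ := by positivity
    have hcont : Continuous fun t ↦ n t + e := by fun_prop
    set σ : ℝ → ℝ := fun t ↦ (∫ τ in (0 : ℝ)..t, (n τ + e)) / Λ with hσ
    have hσd : ∀ t, HasDerivAt σ ((n t + e) / Λ) t := fun t ↦
      (hcont.integral_hasStrictDerivAt 0 t).hasDerivAt.div_const Λ
    have hσ0 : σ 0 = 0 := by simp [hσ]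
    have hσ1 : σ 1 = 1 := by
      simp only [hσ]
      rw [intervalIntegral.integral_add (hn.intervalIntegrable _ _) (by simp), ← hℓ]
      simp [← hΛ, hΛ0.ne']
    have hσmono : MonotoneOn σ (Icc 0 1) := by
      refine monotoneOn_of_deriv_nonneg (convex_Icc 0 1)
        (fun t _ ↦ (hσd t).continuousAt.continuousWithinAt)
        (fun t _ ↦ (hσd t).differentiableAt.differentiableWithinAt) fun t ht ↦ ?_
      rw [interior_Icc] at ht
      rw [(hσd t).deriv]
      have := (hy t (Ioo_subset_Icc_self ht)).1
      positivity
    have hσI : ∀ t ∈ Icc (0 : ℝ) 1, σ t ∈ Icc (0 : ℝ) 1 := fun t ht ↦ by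
      constructor
      · rw [← hσ0]; exact hσmono ⟨le_rfl, zero_le_one⟩ ht ht.1
      · rw [← hσ1]; exact hσmono ht ⟨zero_le_one, le_rfl⟩ ht.2
    -- The calibrating function along the pair (σ t, y t). Both corrections vanish at the ends,
    -- where y = C, so Φ 1 - Φ 0 = S².
    set Φ : ℝ → ℝ := fun t ↦ S ^ 2 * σ t + 2 * G (C (σ t)) (v (σ t)) (y t - C (σ t))
      + (-2 * k * (σ t - 1 / 2)) * G y₀ (y t - C (σ t)) (y t - C (σ t)) with hΦ
    have hΦd : ∀ t ∈ Icc (0 : ℝ) 1, ∃ Φ' ≤ Λ * n t, HasDerivWithinAt Φ Φ' (Icc 0 1) t := by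
      intro t ht
      obtain ⟨hCb, hCd, hvd, hgeo, hvκ, hsp⟩ := hC _ (hσI t ht)
      obtain ⟨hn0, hyb, hyd, hyn⟩ := hy t ht
      set ρ := (n t + e) / Λ with hρ
      have hρ0 : 0 < ρ := by positivity
      have hσt : HasDerivWithinAt σ ρ (Icc 0 1) t := (hσd t).hasDerivWithinAt
      have dC : HasDerivWithinAt (fun t ↦ C (σ t)) (ρ • v (σ t)) (Icc 0 1) t :=
        hCd.scomp_hasDerivWithinAt t hσt
      have dv : HasDerivWithinAt (fun t ↦ v (σ t)) (ρ • A (σ t)) (Icc 0 1) t :=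
        hvd.scomp_hasDerivWithinAt t hσt
      have dη : HasDerivWithinAt (fun t ↦ y t - C (σ t)) (u t - ρ • v (σ t)) (Icc 0 1) t :=
        hyd.sub dC
      have d1 := h.hasDerivWithinAt_apply (x := fun t ↦ C (σ t)) (hrU hCb) dC dv dη
      have d0 : HasDerivWithinAt (fun t ↦ G y₀ (y t - C (σ t)) (y t - C (σ t)))
          (G y₀ (u t - ρ • v (σ t)) (y t - C (σ t)) + G y₀ (y t - C (σ t)) (u t - ρ • v (σ t)))
          (Icc 0 1) t := by
        have e1 : HasDerivWithinAt (fun t ↦ G y₀ (y t - C (σ t))) (G y₀ (u t - ρ • v (σ t)))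
          (Icc 0 1) t := (G y₀).hasFDerivAt.comp_hasDerivWithinAt t dη
        simpa using e1.clm_apply dη
      have dθ : HasDerivWithinAt (fun t ↦ -2 * k * (σ t - 1 / 2)) (-2 * k * ρ) (Icc 0 1) t :=
        (hσt.sub_const _).const_mul _
      refine ⟨_, ?_, ((hσt.const_mul (S ^ 2)).add (d1.const_mul 2)).add (dθ.mul d0)⟩
      have hc := hcal _ hCb _ hyb _ _ hvκ hgeo _ (hσI t ht) (ρ⁻¹ • u t)
      have hu : u t = ρ • (ρ⁻¹ • u t) := by rw [smul_smul, mul_inv_cancel₀ hρ0.ne', one_smul]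
      have hgu : G (y t) (ρ⁻¹ • u t) (ρ⁻¹ • u t) = ρ⁻¹ * (ρ⁻¹ * n t ^ 2) := by
        rw [← hyn]; simp
      rw [hgu, hsp] at hc
      set z := ρ⁻¹ • u t with hz
      -- In the parameter σ the curve has velocity u/ρ, and its energy density contributes n²/ρ = Λ
      -- n²/(n + e) ≤ Λ n.
      have hb : ρ * (ρ⁻¹ * (ρ⁻¹ * n t ^ 2)) ≤ Λ * n t := by
        have : ρ * (ρ⁻¹ * (ρ⁻¹ * n t ^ 2)) = ρ⁻¹ * n t ^ 2 := by field_simp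
        rw [this, hρ, inv_div, div_mul_eq_mul_div, div_le_iff₀ (by positivity)]
        nlinarith [mul_nonneg (mul_nonneg hΛ0.le hn0) he.le]
      refine le_trans (le_of_eq ?_) ((mul_le_mul_of_nonneg_left hc hρ0.le).trans hb)
      rw [hu]
      simp only [map_smul, smul_apply, smul_eq_mul, ← smul_sub]
      rw [h.symm y₀ (z - v (σ t))]
      ring
    have hint : ∀ t, HasDerivAt (fun t ↦ ∫ τ in (0 : ℝ)..t, n τ) (n t) t := fun t ↦
      (hn.integral_hasStrictDerivAt 0 t).hasDerivAt
    choose! Φ' hΦ' hΦd' using hΦd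
    have hmain : Φ 1 ≤ Φ 0 + Λ * ∫ τ in (0 : ℝ)..1, n τ := by
      refine image_le_of_deriv_right_le_deriv_boundary (a := 0) (b := 1) (f := Φ) (f' := Φ')
        (B := fun t ↦ Φ 0 + Λ * ∫ τ in (0 : ℝ)..t, n τ) (B' := fun t ↦ Λ * n t)
        (fun t ht ↦ (hΦd' t ht).continuousWithinAt) (fun t ht ↦ ?_) (by simp)
        (fun t _ ↦ (((hint t).const_mul Λ).const_add _).continuousAt.continuousWithinAt)
        (fun t _ ↦ (((hint t).const_mul Λ).const_add _).hasDerivWithinAt)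
        (fun t ht ↦ hΦ' t (Ico_subset_Icc_self ht)) ⟨zero_le_one, le_rfl⟩
      exact (hΦd' t (Ico_subset_Icc_self ht)).mono_of_mem_nhdsWithin
        (Icc_mem_nhdsGE_of_mem ht)
    simpa [hΦ, hσ0, hσ1, hy0, hy1, ← hℓ] using hmain
  have hlim : S ^ 2 ≤ ℓ * ℓ := by
    refine ge_of_tendsto (x := 𝓝[>] (0 : ℝ)) (f := fun e ↦ (ℓ + e) * ℓ) ?_
      (eventually_mem_nhdsWithin.mono fun e he ↦ key e he)
    have : Tendsto (fun e : ℝ ↦ (ℓ + e) * ℓ) (𝓝 0) (𝓝 ((ℓ + 0) * ℓ)) :=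
      (Continuous.tendsto (by fun_prop) 0)
    simpa using this.mono_left nhdsWithin_le_nhds
  nlinarith

end Minimality

/-! ### Velocity and length of curves -/

section Velocity

variable {E : Type*} [NormedAddCommGroup E] [NormedSpace ℝ E]
  {M : Type*} [TopologicalSpace M] [ChartedSpace E M]

/-- The velocity of a curve in a manifold at a time in `Icc a b`. -/
theorem hasMFDerivWithinAt_velocity {γ : ℝ → M} {J : Set ℝ} {t : ℝ}
    (h : MDifferentiableWithinAt 𝓘(ℝ, ℝ) 𝓘(ℝ, E) γ J t) :
    HasMFDerivWithinAt 𝓘(ℝ, ℝ) 𝓘(ℝ, E) γ J t ((1 : ℝ →L[ℝ] ℝ).smulRight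
      (mfderivWithin 𝓘(ℝ, ℝ) 𝓘(ℝ, E) γ J t (1 : ℝ) : TangentSpace 𝓘(ℝ, E) (γ t))) := by
  refine h.hasMFDerivWithinAt.congr_mfderiv (ContinuousLinearMap.ext fun (r : ℝ) ↦ ?_)
  have := map_smul (mfderivWithin 𝓘(ℝ, ℝ) 𝓘(ℝ, E) γ J t) r (1 : ℝ)
  rw [smul_eq_mul, mul_one] at this
  exact this

end Velocity

section Lengths

variable {E : Type*} [NormedAddCommGroup E] [NormedSpace ℝ E]
  {M : Type*} [MetricSpace M] [ChartedSpace E M] [IsManifold 𝓘(ℝ, E) ∞ M]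
  [RiemannianBundle (fun x : M ↦ TangentSpace 𝓘(ℝ, E) x)]

theorem pathELength_symm_comp {p : M} {C u : ℝ → E}
    (hC : ∀ t ∈ Icc (0 : ℝ) 1, C t ∈ (extChartAt 𝓘(ℝ, E) p).target ∧
      HasDerivWithinAt C (u t) (Icc 0 1) t) :
    Manifold.pathELength 𝓘(ℝ, E) (fun t ↦ (extChartAt 𝓘(ℝ, E) p).symm (C t)) 0 1
      = ∫⁻ t in Icc (0 : ℝ) 1, ‖ofCoord p (C t) (u t)‖ₑ := by
  rw [Manifold.pathELength_eq_lintegral_mfderivWithin_Icc]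
  refine MeasureTheory.setLIntegral_congr_fun measurableSet_Icc fun t ht ↦ ?_
  have h1 := hasMFDerivWithinAt_symm_comp (hC t ht).1 (hC t ht).2
  have h2 := h1.mfderivWithin ((uniqueDiffOn_Icc zero_lt_one).uniqueMDiffOn t ht)
  rw [h2]
  congr 1
  exact one_smul ℝ _

variable [FiniteDimensional ℝ E]

theorem norm_ofCoord_sq {p : M} {y : E} (hy : y ∈ (extChartAt 𝓘(ℝ, E) p).target) (u : E) :
    ‖ofCoord p y u‖ ^ 2 = metricL p y u u := by
  rw [norm_sq_eq_chartMetric hy, coordVec_ofCoord hy, metricL_apply]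

variable [IsContMDiffRiemannianBundle 𝓘(ℝ, E) ∞ E (fun x : M ↦ TangentSpace 𝓘(ℝ, E) x)]

theorem isMetricOn_metricL (p : M) :
    IsMetricOn (metricL p) (extChartAt 𝓘(ℝ, E) p).target where
  isOpen := isOpen_target p
  smooth := contDiffOn_metricL p
  symm := chartMetric_comm p
  pos _ hy _ hu := chartMetric_pos hy hu

/-- Differentiating the coefficients one by one agrees with differentiating the form-valued map,
because the latter is differentiable on the chart target. This transfers the coordinate results to
the manifold. -/
theorem christoffel_eq {p : M} {y : E} (hy : y ∈ (extChartAt 𝓘(ℝ, E) p).target) (u v w : E) :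
    christoffel p y u v w = christoffelOf (metricL p) y u v w := by
  have h : ∀ u v, fderiv ℝ (fun z ↦ chartMetric p z u v) y
      = ((fderiv ℝ (metricL p) y).flip u).flip v := fun u v ↦ by
    have h1 := (((isMetricOn_metricL p).hasFDerivAt hy).clm_apply
      (hasFDerivAt_const u y)).clm_apply (hasFDerivAt_const v y)
    refine HasFDerivAt.fderiv (h1.congr_fderiv ?_)
    ext; simp
  simp only [christoffel, christoffelOf, h]
  rfl

omit [FiniteDimensional ℝ E] in
/-- The speed of a `C¹` curve is continuous, and its integral is the length. -/
theorem exists_speed {γ : ℝ → M} (hγ : ContMDiffOn 𝓘(ℝ, ℝ) 𝓘(ℝ, E) 1 γ (Icc 0 1)) :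
    ∃ (γ' : ∀ t, TangentSpace 𝓘(ℝ, E) (γ t)) (n : ℝ → ℝ), Continuous n ∧
      (∀ t ∈ Icc (0 : ℝ) 1, HasMFDerivWithinAt 𝓘(ℝ, ℝ) 𝓘(ℝ, E) γ (Icc 0 1) t
        ((1 : ℝ →L[ℝ] ℝ).smulRight (γ' t)) ∧ ‖γ' t‖ = n t) ∧ (∀ t, 0 ≤ n t) ∧
      Manifold.pathELength 𝓘(ℝ, E) γ 0 1 = ENNReal.ofReal (∫ t in (0 : ℝ)..1, n t) := by
  set γ' : ∀ t, TangentSpace 𝓘(ℝ, E) (γ t) := fun t ↦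
    mfderivWithin 𝓘(ℝ, ℝ) 𝓘(ℝ, E) γ (Icc 0 1) t (1 : ℝ) with hγ'
  have hsec : ContMDiffOn 𝓘(ℝ, ℝ) 𝓘(ℝ, E).tangent 0
      (fun t ↦ (⟨γ t, γ' t⟩ : TangentBundle 𝓘(ℝ, E) M)) (Icc 0 1) := by
    have h1 := hγ.contMDiffOn_tangentMapWithin (m := 0) (by simp)
      (uniqueDiffOn_Icc zero_lt_one).uniqueMDiffOn
    have h2 : ContMDiffOn 𝓘(ℝ, ℝ) 𝓘(ℝ, ℝ).tangent 0
        (fun t ↦ (⟨t, (1 : ℝ)⟩ : TangentBundle 𝓘(ℝ, ℝ) ℝ)) (Icc 0 1) := fun t _ ↦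
      contMDiffWithinAt_vectorSpace_iff_contDiffWithinAt.2 contDiffWithinAt_const
    exact h1.comp h2 (fun t ht ↦ ht)
  have : IsContMDiffRiemannianBundle 𝓘(ℝ, E) 0 E (fun x : M ↦ TangentSpace 𝓘(ℝ, E) x) :=
    IsContMDiffRiemannianBundle.of_le (n := ∞) (by simp)
  have hin : ContMDiffOn 𝓘(ℝ, ℝ) 𝓘(ℝ, ℝ) 0 (fun t ↦ inner ℝ (γ' t) (γ' t)) (Icc 0 1) :=
    ContMDiffOn.inner_bundle (IB := 𝓘(ℝ, E)) (F := E) (E := fun x : M ↦ TangentSpace 𝓘(ℝ, E) x)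
      (v := γ') (w := γ') hsec hsec
  have hnc : ContinuousOn (fun t ↦ ‖γ' t‖) (Icc 0 1) :=
    (hin.continuousOn.sqrt).congr fun t _ ↦ norm_eq_sqrt_real_inner _
  -- The speed is extended by constants outside [0, 1], so that its primitive is differentiable at
  -- every real time.
  have hex : ∀ t ∈ Icc (0 : ℝ) 1, IccExtend zero_le_one ((Icc (0 : ℝ) 1).domRestrict fun t ↦ ‖γ' t‖) t
      = ‖γ' t‖ := fun t ht ↦ by rw [IccExtend_of_mem _ _ ht]; rfl
  have hcont := (continuousOn_iff_continuous_domRestrict.1 hnc).Icc_extend' (h := zero_le_one)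
  refine ⟨γ', _, hcont, fun t ht ↦ ⟨?_, (hex t ht).symm⟩, fun t ↦ norm_nonneg _, ?_⟩
  · exact hasMFDerivWithinAt_velocity (hγ.mdifferentiableOn one_ne_zero t ht)
  · rw [Manifold.pathELength_eq_lintegral_mfderivWithin_Icc,
      intervalIntegral.integral_of_le zero_le_one, ← MeasureTheory.integral_Icc_eq_integral_Ioc,
      MeasureTheory.ofReal_integral_eq_lintegral_ofReal]
    · refine MeasureTheory.setLIntegral_congr_fun measurableSet_Icc fun t ht ↦ ?_
      rw [hex t ht, ofReal_norm]; rfl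
    · exact hcont.integrableOn_Icc
    · exact Eventually.of_forall fun t ↦ norm_nonneg _

end Lengths

/-! ### Short minimizing geodesics with parallel fields -/

section ShortGeodesics

variable {E : Type*} [NormedAddCommGroup E] [NormedSpace ℝ E] [FiniteDimensional ℝ E]
  {M : Type*} [MetricSpace M] [ChartedSpace E M] [IsManifold 𝓘(ℝ, E) ∞ M]
  [RiemannianBundle (fun x : M ↦ TangentSpace 𝓘(ℝ, E) x)]
  [IsContMDiffRiemannianBundle 𝓘(ℝ, E) ∞ E (fun x : M ↦ TangentSpace 𝓘(ℝ, E) x)]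

/-- The covariant derivative along a curve contained in a chart. -/
theorem hasCovariantDerivWithinAt_symm_comp {p : M} {C u W : ℝ → E} {W' : E} {J : Set ℝ} {t : ℝ}
    (hC : ∀ s ∈ J, C s ∈ (extChartAt 𝓘(ℝ, E) p).target) (ht : t ∈ J)
    (hu : HasDerivWithinAt C (u t) J t) (hW : HasDerivWithinAt W W' J t)
    (hpar : ∀ w, metricL p (C t) W' w = -christoffelOf (metricL p) (C t) (u t) (W t) w) :
    HasCovariantDerivWithinAt (fun s ↦ (extChartAt 𝓘(ℝ, E) p).symm (C s))
      (fun s ↦ ofCoord p (C s) (W s)) J t 0 := by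
  refine ⟨p, symm_mem_source (hC t ht), ofCoord p (C t) (u t),
    hasMFDerivWithinAt_symm_comp (hC t ht) hu, W', ?_, fun w ↦ ?_⟩
  · exact hW.congr (fun s hs ↦ coordVec_ofCoord (hC s hs) _) (coordVec_ofCoord (hC t ht) _)
  · rw [coordVec_zero, ext_symm (hC t ht), coordVec_ofCoord (hC t ht), coordVec_ofCoord (hC t ht),
      christoffel_eq (hC t ht)]
    have h0 : chartMetric p (C t) 0 w = 0 := by
      rw [← metricL_apply]; simp
    rw [h0, ← metricL_apply, hpar]; ring

variable [IsRiemannianManifold 𝓘(ℝ, E) M]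

/-- In every direction there are minimizing geodesics with parallel fields along them, given in a
chart by solutions of the geodesic and of the parallel transport equation. -/
theorem exists_minimizing_geodesic (p : M) {y₀ : E} (hy₀ : y₀ ∈ (extChartAt 𝓘(ℝ, E) p).target)
    (v₀ W₀ : E) : ∃ a > 0, ∃ (x W : ℝ → E) (B₀ : E), x 0 = y₀ ∧ W 0 = W₀ ∧
      HasDerivAt x v₀ 0 ∧ HasDerivAt W B₀ 0 ∧
      (∀ w, metricL p y₀ B₀ w = -christoffelOf (metricL p) y₀ v₀ W₀ w) ∧
      ∀ ε, 0 < ε → ε < a → (∀ s ∈ Icc (0 : ℝ) 1, x (ε * s) ∈ (extChartAt 𝓘(ℝ, E) p).target) ∧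
        IsMinimizingGeodesic E (fun s ↦ (extChartAt 𝓘(ℝ, E) p).symm (x (ε * s))) ∧
        dist ((extChartAt 𝓘(ℝ, E) p).symm (x (ε * 0))) ((extChartAt 𝓘(ℝ, E) p).symm (x (ε * 1)))
          = ε * Real.sqrt (metricL p y₀ v₀ v₀) ∧
        IsParallelOn (fun s ↦ (extChartAt 𝓘(ℝ, E) p).symm (x (ε * s)))
          (fun s ↦ ofCoord p (x (ε * s)) (W (ε * s))) (Icc 0 1) := by
  have hG := isMetricOn_metricL (E := E) p
  obtain ⟨a₀, ha₀, x, v, W, A, B, hx0, hv0, hW0, hode⟩ := exists_geodesic_parallel hG hy₀ v₀ W₀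
  obtain ⟨r, hr, hrU, κ, hκ, hmin⟩ := hG.exists_geodesic_minimizes hy₀
  have h00 : (0 : ℝ) ∈ Ioo (-a₀) a₀ := ⟨by linarith, ha₀⟩
  obtain ⟨-, hxd, hvd, hWd, -, hB⟩ := hode 0 h00
  rw [hx0, hv0, hW0] at hB
  rw [hv0] at hxd
  set S := Real.sqrt (metricL p y₀ v₀ v₀) with hS
  have hS2 : S ^ 2 = metricL p y₀ v₀ v₀ := Real.sq_sqrt (hG.nonneg hy₀ v₀)
  -- a metric ball of `M` contained in the coordinate ball
  obtain ⟨δ, hδ, hball⟩ : ∃ δ > 0, ∀ z : M, dist z ((extChartAt 𝓘(ℝ, E) p).symm y₀) < δ →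
      z ∈ (chartAt E p).source ∧ extChartAt 𝓘(ℝ, E) p z ∈ Metric.ball y₀ r := by
    have hsrc : (extChartAt 𝓘(ℝ, E) p).symm y₀ ∈ (chartAt E p).source := symm_mem_source hy₀
    have h1 : ∀ᶠ z in 𝓝 ((extChartAt 𝓘(ℝ, E) p).symm y₀), z ∈ (chartAt E p).source :=
      (chartAt E p).open_source.mem_nhds hsrc
    have h2 : ∀ᶠ z in 𝓝 ((extChartAt 𝓘(ℝ, E) p).symm y₀),
        extChartAt 𝓘(ℝ, E) p z ∈ Metric.ball y₀ r := by
      refine (continuousAt_extChartAt' (by rwa [extChartAt_source])).eventually_mem ?_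
      rw [ext_symm hy₀]
      exact Metric.ball_mem_nhds _ hr
    obtain ⟨δ, hδ, h⟩ := Metric.eventually_nhds_iff.1 (h1.and h2)
    exact ⟨δ, hδ, fun z hz ↦ h hz⟩
  -- the geodesic stays in the coordinate ball with bounded velocity for a short time
  obtain ⟨b, hb, hbx⟩ : ∃ b > 0, ∀ s, |s| < b → x s ∈ Metric.ball y₀ r ∧ ‖v s‖ < ‖v₀‖ + 1 := by
    have h1 : ∀ᶠ s in 𝓝 (0 : ℝ), x s ∈ Metric.ball y₀ r :=
      hxd.continuousAt.eventually_mem (by rw [hx0]; exact Metric.ball_mem_nhds _ hr)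
    have h2 : ∀ᶠ s in 𝓝 (0 : ℝ), ‖v s‖ < ‖v₀‖ + 1 :=
      hvd.continuousAt.norm.eventually_lt continuousAt_const (by rw [hv0]; linarith)
    obtain ⟨b, hb, h⟩ := Metric.eventually_nhds_iff.1 (h1.and h2)
    exact ⟨b, hb, fun s hs ↦ h (by rwa [Real.dist_eq, sub_zero])⟩
  -- The four bounds on ε: the solution exists; it stays in the coordinate ball with |v| < |v₀| + 1;
  -- the curve rescaled to [0, 1] has velocity at most κ; its length εS is less than δ.
  refine ⟨min (min a₀ b) (min (κ / (‖v₀‖ + 1)) (δ / (S + 1))), by positivity, x, W, B 0, hx0, hW0,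
    hxd, hWd, hB, fun ε hε hεa ↦ ?_⟩
  simp only [lt_min_iff] at hεa
  obtain ⟨⟨hεa₀, hεb⟩, hεκ, hεδ⟩ := hεa
  rw [lt_div_iff₀ (by positivity)] at hεκ hεδ
  have hIoo : ∀ s ∈ Icc (0 : ℝ) 1, ε * s ∈ Ioo (-a₀) a₀ := fun s hs ↦
    ⟨by nlinarith [hs.1], by nlinarith [hs.2]⟩
  have hsb : ∀ s ∈ Icc (0 : ℝ) 1, |ε * s| < b := fun s hs ↦ by
    rw [abs_of_nonneg (mul_nonneg hε.le hs.1)]; nlinarith [hs.2]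
  have hscale : ∀ s : ℝ, HasDerivAt (fun s ↦ ε * s) ε s := fun s ↦ by
    simpa using (hasDerivAt_id s).const_mul ε
  have hCd : ∀ s ∈ Icc (0 : ℝ) 1, HasDerivAt (fun s ↦ x (ε * s)) (ε • v (ε * s)) s := fun s hs ↦
    (hode _ (hIoo s hs)).2.1.scomp s (hscale s)
  have hvd' : ∀ s ∈ Icc (0 : ℝ) 1,
      HasDerivAt (fun s ↦ ε • v (ε * s)) (ε • ε • A (ε * s)) s := fun s hs ↦
    ((hode _ (hIoo s hs)).2.2.1.scomp s (hscale s)).const_smul ε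
  have hWd' : ∀ s ∈ Icc (0 : ℝ) 1, HasDerivAt (fun s ↦ W (ε * s)) (ε • B (ε * s)) s := fun s hs ↦
    (hode _ (hIoo s hs)).2.2.2.1.scomp s (hscale s)
  have hU : ∀ s ∈ Icc (0 : ℝ) 1, x (ε * s) ∈ (extChartAt 𝓘(ℝ, E) p).target := fun s hs ↦
    (hode _ (hIoo s hs)).1
  have hgeo : ∀ s ∈ Icc (0 : ℝ) 1, ∀ w, metricL p (x (ε * s)) (ε • ε • A (ε * s)) w
      = -christoffelOf (metricL p) (x (ε * s)) (ε • v (ε * s)) (ε • v (ε * s)) w := by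
    intro s hs w
    have := (hode _ (hIoo s hs)).2.2.2.2.1 w
    simp only [map_smul, smul_apply, smul_eq_mul, this, christoffelOf]
    ring
  have hpar : ∀ s ∈ Icc (0 : ℝ) 1, ∀ w, metricL p (x (ε * s)) (ε • B (ε * s)) w
      = -christoffelOf (metricL p) (x (ε * s)) (ε • v (ε * s)) (W (ε * s)) w := by
    intro s hs w
    have := (hode _ (hIoo s hs)).2.2.2.2.2 w
    simp only [map_smul, smul_apply, smul_eq_mul, this, christoffelOf]
    ring
  have hspeed : ∀ s ∈ Icc (0 : ℝ) 1,
      metricL p (x (ε * s)) (ε • v (ε * s)) (ε • v (ε * s)) = (ε * S) ^ 2 := by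
    intro s hs
    have := geodesic_speed_const hG (fun s hs ↦ ⟨(hode s hs).1, (hode s hs).2.1,
      (hode s hs).2.2.1, (hode s hs).2.2.2.2.1⟩) (hIoo s hs) h00
    simp only [map_smul, smul_apply, smul_eq_mul]
    rw [this, hx0, hv0, mul_pow, hS2]; ring
  set c : ℝ → M := fun s ↦ (extChartAt 𝓘(ℝ, E) p).symm (x (ε * s)) with hc
  have hεS : 0 ≤ ε * S := mul_nonneg hε.le (Real.sqrt_nonneg _)
  have hlen : Manifold.pathELength 𝓘(ℝ, E) c 0 1 = ENNReal.ofReal (ε * S) := by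
    rw [hc, pathELength_symm_comp fun t ht ↦ ⟨hU t ht, (hCd t ht).hasDerivWithinAt⟩]
    have : ∀ t ∈ Icc (0 : ℝ) 1, ‖ofCoord p (x (ε * t)) (ε • v (ε * t))‖ₑ
        = ENNReal.ofReal (ε * S) := fun t ht ↦ by
      rw [← ofReal_norm]
      congr 1
      have h1 := norm_ofCoord_sq (hU t ht) (ε • v (ε * t))
      rw [hspeed t ht] at h1
      exact (pow_left_inj₀ (norm_nonneg _) hεS two_ne_zero).1 h1
    rw [MeasureTheory.setLIntegral_congr_fun measurableSet_Icc this]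
    simp
  have hc1 : ContMDiffOn 𝓘(ℝ, ℝ) 𝓘(ℝ, E) 1 c (Icc 0 1) := by
    refine (contMDiffOn_extChartAt_symm (I := 𝓘(ℝ, E)) (n := 1) p).comp
      (contMDiffOn_iff_contDiffOn.2 ?_) hU
    rw [contDiffOn_one_iff_derivWithin (uniqueDiffOn_Icc zero_lt_one)]
    refine ⟨fun t ht ↦ (hCd t ht).differentiableAt.differentiableWithinAt, ?_⟩
    refine ContinuousOn.congr (f := fun s ↦ ε • v (ε * s))
      (fun t ht ↦ (hvd' t ht).continuousAt.continuousWithinAt) fun t ht ↦ ?_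
    exact (hCd t ht).hasDerivWithinAt.derivWithin (uniqueDiffOn_Icc zero_lt_one t ht)
  have hedist : edist (c 0) (c 1) = ENNReal.ofReal (ε * S) := by
    rw [IsRiemannianManifold.out (I := 𝓘(ℝ, E))]
    refine le_antisymm (hlen ▸ Manifold.riemannianEDist_le_pathELength hc1 rfl rfl zero_le_one) ?_
    -- A strictly shorter curve has length below δ, so it never leaves the metric ball inside the
    -- chart and local minimality applies to it.
    by_contra hlt
    rw [not_le] at hlt
    obtain ⟨γ, hγ0, hγ1, hγs, hγl⟩ := Manifold.exists_lt_of_riemannianEDist_lt hlt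
    obtain ⟨γ', n, hn, hγd, hn0, hγn⟩ := exists_speed hγs
    have hc0 : c 0 = (extChartAt 𝓘(ℝ, E) p).symm y₀ := by simp [hc, hx0]
    have hγin : ∀ t ∈ Icc (0 : ℝ) 1, γ t ∈ (chartAt E p).source ∧
        extChartAt 𝓘(ℝ, E) p (γ t) ∈ Metric.ball y₀ r := by
      intro t ht
      refine hball _ ?_
      rw [← hc0, dist_comm, ← edist_lt_ofReal, IsRiemannianManifold.out (I := 𝓘(ℝ, E))]
      calc _ ≤ Manifold.pathELength 𝓘(ℝ, E) γ 0 t :=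
            Manifold.riemannianEDist_le_pathELength (hγs.mono (Icc_subset_Icc le_rfl ht.2))
              hγ0 rfl ht.1
        _ ≤ Manifold.pathELength 𝓘(ℝ, E) γ 0 1 := Manifold.pathELength_mono le_rfl ht.2
        _ < _ := hγl
        _ ≤ ENNReal.ofReal δ := ENNReal.ofReal_le_ofReal (by nlinarith)
    have hle := hmin (fun s ↦ x (ε * s)) (fun s ↦ ε • v (ε * s)) (fun s ↦ ε • ε • A (ε * s)) (ε * S)
      hεS (fun s hs ↦ ⟨(hbx _ (hsb s hs)).1, hCd s hs, hvd' s hs, hgeo s hs, ?_, hspeed s hs⟩)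
      (fun t ↦ extChartAt 𝓘(ℝ, E) p (γ t)) (fun t ↦ coordVec p (γ t) (γ' t)) n hn
      (fun t ht ↦ ⟨hn0 t, (hγin t ht).2,
        hasDerivWithinAt_ext_comp (hγin t ht).1 (hγd t ht).1, ?_⟩) ?_ ?_
    · rw [hγn] at hγl
      exact absurd hγl (not_lt.2 (ENNReal.ofReal_le_ofReal hle))
    · rw [norm_smul, Real.norm_of_nonneg hε.le]
      nlinarith [(hbx _ (hsb s hs)).2]
    · rw [metricL_apply, ← norm_sq_eq_chartMetric' (hγin t ht).1, (hγd t ht).2]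
    · simp only [hγ0]
      exact ext_symm (hU 0 ⟨le_rfl, zero_le_one⟩)
    · simp only [hγ1]
      exact ext_symm (hU 1 ⟨zero_le_one, le_rfl⟩)
  refine ⟨hU, ⟨⟨fun s ↦ ofCoord p (x (ε * s)) (ε • v (ε * s)), fun s hs ↦
    hasMFDerivWithinAt_symm_comp (hU s hs) (hCd s hs).hasDerivWithinAt, fun s hs ↦ ?_⟩, ?_⟩, ?_,
    fun s hs ↦ ?_⟩
  · exact hasCovariantDerivWithinAt_symm_comp (C := fun s ↦ x (ε * s))
      (u := fun s ↦ ε • v (ε * s)) (W := fun s ↦ ε • v (ε * s)) hU hs (hCd s hs).hasDerivWithinAt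
      (hvd' s hs).hasDerivWithinAt (hgeo s hs)
  · rw [hlen, hedist]
  · have h1 := edist_dist (c 0) (c 1)
    rw [hedist] at h1
    exact ((ENNReal.ofReal_eq_ofReal_iff hεS dist_nonneg).1 h1).symm
  · exact hasCovariantDerivWithinAt_symm_comp (C := fun s ↦ x (ε * s))
      (u := fun s ↦ ε • v (ε * s)) (W := fun s ↦ W (ε * s)) hU hs (hCd s hs).hasDerivWithinAt
      (hWd' s hs).hasDerivWithinAt (hpar s hs)

end ShortGeodesics

/-! ### From parallel transport to the bound on ∇f -/

section CovariantBound

variable {E : Type*} [NormedAddCommGroup E] [NormedSpace ℝ E] [FiniteDimensional ℝ E]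
  {M : Type*} [MetricSpace M] [ChartedSpace E M] [IsManifold 𝓘(ℝ, E) ∞ M]
  [RiemannianBundle (fun x : M ↦ TangentSpace 𝓘(ℝ, E) x)]

theorem abs_metricL_le {p : M} {y : E} (hy : y ∈ (extChartAt 𝓘(ℝ, E) p).target) (u w : E) :
    |metricL p y u w| ≤ Real.sqrt (metricL p y u u) * Real.sqrt (metricL p y w w) := by
  rw [← norm_ofCoord_sq hy, ← norm_ofCoord_sq hy, Real.sqrt_sq (norm_nonneg _),
    Real.sqrt_sq (norm_nonneg _)]
  exact abs_real_inner_le_norm (ofCoord p y u) (ofCoord p y w)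

variable [IsContMDiffRiemannianBundle 𝓘(ℝ, E) ∞ E (fun x : M ↦ TangentSpace 𝓘(ℝ, E) x)]
  [IsRiemannianManifold 𝓘(ℝ, E) M]
  {f : ℝ → ∀ x : M, TangentSpace 𝓘(ℝ, E) x} {L t : ℝ}

/-- A field which is Lipschitz in the sense of parallel transport has covariant derivative of norm
at most `L`. -/
theorem IsLipschitzField.abs_covariant_le (hLip : IsLipschitzField (f t) L) (hL : 0 ≤ L) {p : M}
    {y₀ : E} (hy₀ : y₀ ∈ (extChartAt 𝓘(ℝ, E) p).target) {D : E →L[ℝ] E}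
    (hD : HasFDerivAt (coordField f p t) D y₀) (v w : E) :
    |metricL p y₀ (D v) w + christoffelOf (metricL p) y₀ v (coordField f p t y₀) w|
      ≤ L * Real.sqrt (metricL p y₀ v v) * Real.sqrt (metricL p y₀ w w) := by
  obtain ⟨a, ha, x, W, B₀, hx0, hW0, hxd, hWd, hB, hmin⟩ :=
    exists_minimizing_geodesic p hy₀ v (coordField f p t y₀)
  set S := Real.sqrt (metricL p y₀ v v) with hS
  -- The transported vector minus the field, in coordinates. Its derivative at 0 is B₀ - D v, which
  -- by the transport equation represents -∇_v f.
  set Δ : ℝ → E := fun s ↦ W s - coordField f p t (x s) with hΔ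
  have hΔd : HasDerivAt Δ (B₀ - D v) 0 := by
    have h1 : HasDerivAt (fun s ↦ coordField f p t (x s)) (D v) 0 := by
      have h0 : HasFDerivAt (coordField f p t) D (x 0) := by rwa [hx0]
      exact h0.comp_hasDerivAt 0 hxd
    exact hWd.sub h1
  have hΔ0 : Δ 0 = 0 := by simp [hΔ, hx0, hW0]
  have hbound : ∀ ε, 0 < ε → ε < a → metricL p (x ε) (Δ ε) (Δ ε) ≤ (L * (ε * S)) ^ 2 := by
    intro ε hε hεa
    obtain ⟨hU, hgeo, hdist, hpar⟩ := hmin ε hε hεa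
    have h0 := hU 0 ⟨le_rfl, zero_le_one⟩
    have h1 := hU 1 ⟨zero_le_one, le_rfl⟩
    have hle := hLip _ hgeo (ofCoord p (x (ε * 1)) (W (ε * 1))) ⟨_, hpar, ?_, rfl⟩
    · rw [hdist] at hle
      have h2 := norm_sq_eq_chartMetric h1 (ofCoord p (x (ε * 1)) (W (ε * 1)) -
        f t ((extChartAt 𝓘(ℝ, E) p).symm (x (ε * 1))))
      rw [coordVec_sub, coordVec_ofCoord h1, ← metricL_apply] at h2
      have h3 := pow_le_pow_left₀ (norm_nonneg _) hle 2
      rw [h2] at h3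
      change metricL p (x (ε * 1)) (W (ε * 1) - coordField f p t (x (ε * 1)))
        (W (ε * 1) - coordField f p t (x (ε * 1))) ≤ _ at h3
      simpa only [mul_one] using h3
    · have h4 : W (ε * 0) = coordField f p t (x (ε * 0)) := by simp [hx0, hW0]
      rw [h4]
      exact ofCoord_coordVec h0 _
  have hG := isMetricOn_metricL (E := E) p
  -- Divide the bound by ε² and let ε tend to 0 from the right; as Δ 0 = 0, Δ ε / ε tends to B₀ - D
  -- v.
  have hlim : metricL p y₀ (B₀ - D v) (B₀ - D v) ≤ (L * S) ^ 2 := by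
    have ht1 : Tendsto (fun ε : ℝ ↦ ε⁻¹ • Δ ε) (𝓝[>] 0) (𝓝 (B₀ - D v)) := by
      have := (hasDerivAt_iff_tendsto_slope_zero.1 hΔd).mono_left
        (nhdsWithin_mono 0 (s := Ioi 0) fun z hz ↦ ne_of_gt hz)
      simpa [hΔ0] using this
    have ht2 : Tendsto (fun ε ↦ metricL p (x ε)) (𝓝[>] 0) (𝓝 (metricL p y₀)) := by
      have h1 : ContinuousAt (metricL p) (x 0) := by
        rw [hx0]; exact (hG.contDiffAt hy₀).continuousAt
      have h2 : ContinuousAt (fun ε ↦ metricL p (x ε)) 0 := h1.comp hxd.continuousAt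
      have h3 := h2.tendsto.mono_left (nhdsWithin_le_nhds (s := Ioi 0))
      rwa [hx0] at h3
    have hev : Continuous fun z : (E →L[ℝ] E →L[ℝ] ℝ) × E ↦ z.1 z.2 z.2 := by fun_prop
    have ht3 := (hev.tendsto (_, _)).comp (ht2.prodMk_nhds ht1)
    refine le_of_tendsto ht3 ?_
    filter_upwards [Ioo_mem_nhdsGT ha] with ε hε
    have h1 := hbound ε hε.1 hε.2
    have h2 : metricL p (x ε) (ε⁻¹ • Δ ε) (ε⁻¹ • Δ ε)
        = ε⁻¹ ^ 2 * metricL p (x ε) (Δ ε) (Δ ε) := by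
      simp only [map_smul, smul_apply, smul_eq_mul]; ring
    simp only [Function.comp, h2]
    calc _ ≤ ε⁻¹ ^ 2 * (L * (ε * S)) ^ 2 := by gcongr
      _ = (L * S) ^ 2 := by have := hε.1.ne'; field_simp
  have hS0 : 0 ≤ S := Real.sqrt_nonneg _
  have h1 : metricL p y₀ (D v) w + christoffelOf (metricL p) y₀ v (coordField f p t y₀) w
      = -metricL p y₀ (B₀ - D v) w := by
    rw [map_sub, sub_apply, hB]; ring
  rw [h1, abs_neg]
  refine (abs_metricL_le hy₀ _ _).trans ?_
  gcongr
  exact (Real.sqrt_le_left (by positivity)).2 hlim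

/-- The Lie derivative of the metric along a Lipschitz field is bounded. -/
theorem IsLipschitzField.abs_lie_metric_le (hLip : IsLipschitzField (f t) L) (hL : 0 ≤ L) {p : M}
    {y₀ : E} (hy₀ : y₀ ∈ (extChartAt 𝓘(ℝ, E) p).target) {D : E →L[ℝ] E}
    (hD : HasFDerivAt (coordField f p t) D y₀) (v : E) :
    |fderiv ℝ (metricL p) y₀ (coordField f p t y₀) v v + 2 * metricL p y₀ (D v) v|
      ≤ 2 * L * metricL p y₀ v v := by
  have h := hLip.abs_covariant_le hL hy₀ hD v v
  have hG := isMetricOn_metricL (E := E) p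
  rw [mul_assoc, Real.mul_self_sqrt (hG.nonneg hy₀ v)] at h
  -- This is the identity (L_f g)(v, v) = 2 g(∇_v f, v): by symmetry two derivatives cancel in the
  -- Christoffel symbol with first and last entries v, leaving half of ∂_f g(v, v).
  have h2 : fderiv ℝ (metricL p) y₀ (coordField f p t y₀) v v + 2 * metricL p y₀ (D v) v
      = 2 * (metricL p y₀ (D v) v +
        christoffelOf (metricL p) y₀ v (coordField f p t y₀) v) := by
    simp only [christoffelOf]
    rw [hG.fderiv_symm hy₀ v v (coordField f p t y₀)]; ring
  rw [h2, abs_mul, abs_two]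
  linarith

/-- Along a curve the norm of a Lipschitz field changes at rate at most `L` times the speed. -/
theorem IsLipschitzField.exists_deriv_norm_sq (hLip : IsLipschitzField (f t) L) (hL : 0 ≤ L)
    (hdiff : ∀ p : M, ∀ y ∈ (extChartAt 𝓘(ℝ, E) p).target,
      DifferentiableAt ℝ (coordField f p t) y)
    {γ : ℝ → M} {J : Set ℝ} {s : ℝ} {γ' : TangentSpace 𝓘(ℝ, E) (γ s)}
    (hγ : HasMFDerivWithinAt 𝓘(ℝ, ℝ) 𝓘(ℝ, E) γ J s ((1 : ℝ →L[ℝ] ℝ).smulRight γ')) :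
    ∃ q' ≤ 2 * L * ‖γ'‖ * ‖f t (γ s)‖, HasDerivWithinAt (fun s ↦ ‖f t (γ s)‖ ^ 2) q' J s := by
  obtain ⟨p, hp⟩ : ∃ p, p = γ s := ⟨_, rfl⟩
  have hsrc : γ s ∈ (chartAt E p).source := hp ▸ mem_chart_source E (γ s)
  have hG := isMetricOn_metricL (E := E) p
  have hd := hasDerivWithinAt_ext_comp (p := p) hsrc hγ
  set c : ℝ → E := fun s ↦ extChartAt 𝓘(ℝ, E) p (γ s) with hc
  have hct : c s ∈ (extChartAt 𝓘(ℝ, E) p).target := ext_mem_target hsrc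
  have hF := (hdiff p _ hct).hasFDerivAt
  have hFd : HasDerivWithinAt (fun s ↦ coordField f p t (c s))
      (fderiv ℝ (coordField f p t) (c s) (coordVec p (γ s) γ')) J s :=
    hF.comp_hasDerivWithinAt s hd
  have hq := hG.hasDerivWithinAt_apply hct hd hFd hFd
  have hnorm : ∀ z, γ z ∈ (chartAt E p).source → ‖f t (γ z)‖ ^ 2 =
      metricL p (c z) (coordField f p t (c z)) (coordField f p t (c z)) := by
    intro z hz
    rw [norm_sq_eq_chartMetric' hz, metricL_apply]
    have : coordField f p t (c z) = coordVec p (γ z) (f t (γ z)) := by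
      simp only [coordField]
      rw [symm_ext hz]
    rw [this]
  refine ⟨_, ?_, hq.congr_of_eventuallyEq ?_ (hnorm s hsrc)⟩
  · have hb := hLip.abs_covariant_le hL hct hF (coordVec p (γ s) γ') (coordField f p t (c s))
    have h1 : Real.sqrt (metricL p (c s) (coordField f p t (c s)) (coordField f p t (c s)))
        = ‖f t (γ s)‖ := by rw [← hnorm s hsrc, Real.sqrt_sq (norm_nonneg _)]
    have h2 : Real.sqrt (metricL p (c s) (coordVec p (γ s) γ') (coordVec p (γ s) γ')) = ‖γ'‖ := by
      rw [metricL_apply, ← norm_sq_eq_chartMetric' hsrc, Real.sqrt_sq (norm_nonneg _)]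
    rw [h1, h2] at hb
    have h3 := (abs_le.1 hb).2
    rw [hG.symm (c s) (coordField f p t (c s))]
    simp only [christoffelOf] at h3
    rw [hG.fderiv_symm hct (coordField f p t (c s)) (coordVec p (γ s) γ')
      (coordField f p t (c s))] at h3
    linarith
  · filter_upwards [hγ.continuousWithinAt.eventually_mem
      ((chartAt E p).open_source.mem_nhds hsrc)] with z hz
    exact hnorm z hz

/-- A Lipschitz field with a zero at `xs` has norm at most `L d(·, xs)`. -/
theorem IsLipschitzField.norm_le (hLip : IsLipschitzField (f t) L) (hL : 0 ≤ L)
    (hdiff : ∀ p : M, ∀ y ∈ (extChartAt 𝓘(ℝ, E) p).target,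
      DifferentiableAt ℝ (coordField f p t) y)
    {xs : M} (hxs : f t xs = 0) (x : M) : ‖f t x‖ ≤ L * dist x xs := by
  refine le_of_forall_pos_le_add fun e he ↦ ?_
  -- The number b serves twice: as the excess length of a curve from xs to x, and in √(|f|² + b²),
  -- which stays differentiable at zeros of f. The total error is b + Lb = e.
  set b := e / (L + 1) with hb
  have hb0 : 0 < b := by positivity
  have hlt : Manifold.riemannianEDist 𝓘(ℝ, E) xs x < ENNReal.ofReal (dist x xs + b) := by
    rw [← IsRiemannianManifold.out (I := 𝓘(ℝ, E)), edist_lt_ofReal, dist_comm]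
    linarith
  obtain ⟨γ, hγ0, hγ1, hγs, hγl⟩ := Manifold.exists_lt_of_riemannianEDist_lt hlt
  obtain ⟨γ', n, hn, hγd, hn0, hγn⟩ := exists_speed hγs
  rw [hγn, ENNReal.ofReal_lt_ofReal_iff (by positivity)] at hγl
  have hd : ∀ s ∈ Icc (0 : ℝ) 1, ∃ g' ≤ L * n s,
      HasDerivWithinAt (fun s ↦ Real.sqrt (‖f t (γ s)‖ ^ 2 + b ^ 2)) g' (Icc 0 1) s := by
    intro s hs
    obtain ⟨q', hq', hqd⟩ := hLip.exists_deriv_norm_sq hL hdiff (hγd s hs).1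
    have hpos : 0 < ‖f t (γ s)‖ ^ 2 + b ^ 2 := by positivity
    refine ⟨_, ?_, (hqd.add_const (b ^ 2)).sqrt hpos.ne'⟩
    have hle : ‖f t (γ s)‖ ≤ Real.sqrt (‖f t (γ s)‖ ^ 2 + b ^ 2) :=
      Real.le_sqrt_of_sq_le (by nlinarith)
    rw [(hγd s hs).2] at hq'
    rw [div_le_iff₀ (by positivity)]
    calc q' ≤ _ := hq'
      _ = (L * n s) * (2 * ‖f t (γ s)‖) := by ring
      _ ≤ _ := mul_le_mul_of_nonneg_left (by linarith) (mul_nonneg hL (hn0 s))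
  choose! g' hg' hgd using hd
  have hint : ∀ t, HasDerivAt (fun t ↦ ∫ τ in (0 : ℝ)..t, n τ) (n t) t := fun t ↦
    (hn.integral_hasStrictDerivAt 0 t).hasDerivAt
  have hz : ‖f t (γ 0)‖ = 0 := by rw [hγ0, hxs, norm_zero]
  have hmain := image_le_of_deriv_right_le_deriv_boundary (a := 0) (b := 1)
    (f := fun s ↦ Real.sqrt (‖f t (γ s)‖ ^ 2 + b ^ 2)) (f' := g')
    (B := fun s ↦ b + L * ∫ τ in (0 : ℝ)..s, n τ) (B' := fun s ↦ L * n s)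
    (fun s hs ↦ (hgd s hs).continuousWithinAt)
    (fun s hs ↦ (hgd s (Ico_subset_Icc_self hs)).mono_of_mem_nhdsWithin (Icc_mem_nhdsGE_of_mem hs))
    (by simp [hz, Real.sqrt_sq hb0.le])
    (fun t _ ↦ (((hint t).const_mul L).const_add _).continuousAt.continuousWithinAt)
    (fun t _ ↦ (((hint t).const_mul L).const_add _).hasDerivWithinAt)
    (fun t ht ↦ hg' t (Ico_subset_Icc_self ht)) (x := 1) ⟨zero_le_one, le_rfl⟩
  have hle : ‖f t (γ 1)‖ ≤ Real.sqrt (‖f t (γ 1)‖ ^ 2 + b ^ 2) :=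
      Real.le_sqrt_of_sq_le (by nlinarith)
  have hfin : ‖f t (γ 1)‖ ≤ b + L * (dist x xs + b) :=
    hle.trans (hmain.trans (by gcongr))
  have hbe : b * (L + 1) = e := by rw [hb]; field_simp
  have : ‖f t (γ 1)‖ = ‖f t x‖ := by rw [hγ1]
  rw [this] at hfin
  linarith

end CovariantBound

/-! ### Flow boxes and the linearized equation -/

section LocalFlow

open scoped NNReal

variable {E : Type*} [NormedAddCommGroup E] [NormedSpace ℝ E]
  {F : ℝ → E → E} {U : Set E}

/-- Time is one-sided at 0, so the joint derivative exists only within the domain; the slice of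
fixed t is the open set U, and there the partial derivative is a full one. -/
theorem hasFDerivAt_of_contDiffOn_prod (hU : IsOpen U)
    (hF : ContDiffOn ℝ 1 (fun z : ℝ × E ↦ F z.1 z.2) (Ici 0 ×ˢ U)) {t : ℝ} (ht : 0 ≤ t) {y : E}
    (hy : y ∈ U) : HasFDerivAt (F t)
      ((fderivWithin ℝ (fun z : ℝ × E ↦ F z.1 z.2) (Ici 0 ×ˢ U) (t, y)).comp
        (ContinuousLinearMap.inr ℝ ℝ E)) y := by
  have h1 := (hF.differentiableOn one_ne_zero (t, y) ⟨ht, hy⟩).hasFDerivWithinAt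
  have h2 : HasFDerivWithinAt (fun z : E ↦ (t, z)) (ContinuousLinearMap.inr ℝ ℝ E) U y :=
    (hasFDerivAt_prodMk_right t y).hasFDerivWithinAt
  exact (HasFDerivWithinAt.comp y h1 h2 fun z hz ↦ ⟨ht, hz⟩).hasFDerivAt (hU.mem_nhds hy)

theorem continuousOn_fderiv_of_contDiffOn_prod (hU : IsOpen U)
    (hF : ContDiffOn ℝ 1 (fun z : ℝ × E ↦ F z.1 z.2) (Ici 0 ×ˢ U)) :
    ContinuousOn (fun z : ℝ × E ↦ fderiv ℝ (F z.1) z.2) (Ici 0 ×ˢ U) := by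
  have h1 := hF.continuousOn_fderivWithin ((uniqueDiffOn_Ici 0).prod hU.uniqueDiffOn) le_rfl
  refine ContinuousOn.congr (f := fun z ↦
    (fderivWithin ℝ (fun z : ℝ × E ↦ F z.1 z.2) (Ici 0 ×ˢ U) z).comp
      (ContinuousLinearMap.inr ℝ ℝ E)) (h1.clm_comp continuousOn_const) fun z hz ↦ ?_
  exact (hasFDerivAt_of_contDiffOn_prod hU hF hz.1 hz.2).fderiv

/-- A box on which a time-varying field is bounded and Lipschitz, and which is short enough for
solutions starting in the inner ball not to leave it. -/
structure IsFlowBox (F : ℝ → E → E) (y₀ : E) (r : ℝ) (I : Set ℝ) (K : ℝ≥0) (B : ℝ) : Prop where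
  radius_pos : 0 < r
  const_pos : 0 < K
  diff : ∀ t ∈ I, ∀ y ∈ Metric.closedBall y₀ (2 * r), HasFDerivAt (F t) (fderiv ℝ (F t) y) y
  cont : ContinuousOn (fun z : ℝ × E ↦ F z.1 z.2) (I ×ˢ Metric.closedBall y₀ (2 * r))
  cont_fderiv : ContinuousOn (fun z : ℝ × E ↦ fderiv ℝ (F z.1) z.2)
    (I ×ˢ Metric.closedBall y₀ (2 * r))
  fderiv_le : ∀ t ∈ I, ∀ y ∈ Metric.closedBall y₀ (2 * r), ‖fderiv ℝ (F t) y‖ ≤ K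
  norm_le : ∀ t ∈ I, ∀ y ∈ Metric.closedBall y₀ (2 * r), ‖F t y‖ ≤ B
  short : ∀ s ∈ I, ∀ t ∈ I, B * |s - t| ≤ r ∧ 2 * K * |s - t| ≤ 1

/-- The bounds come from compactness of a closed ball times an interval; halving the radius and
shortening the time keep solutions inside. -/
theorem exists_flowBox [FiniteDimensional ℝ E] (hU : IsOpen U)
    (hF : ContDiffOn ℝ 1 (fun z : ℝ × E ↦ F z.1 z.2) (Ici 0 ×ˢ U)) {t₀ : ℝ} {y₀ : E}
    (hy₀ : y₀ ∈ U) : ∃ r h K B, 0 < h ∧ Metric.closedBall y₀ (2 * r) ⊆ U ∧ 0 ≤ B ∧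
      IsFlowBox F y₀ r (Icc (max 0 (t₀ - h)) (t₀ + h)) K B := by
  obtain ⟨R, hR, hRU⟩ := Metric.nhds_basis_closedBall.mem_iff.1 (hU.mem_nhds hy₀)
  set I₁ := Icc (max 0 (t₀ - 1)) (t₀ + 1)
  have hcomp : IsCompact (I₁ ×ˢ Metric.closedBall y₀ R) :=
    isCompact_Icc.prod (isCompact_closedBall y₀ R)
  have hsub : I₁ ×ˢ Metric.closedBall y₀ R ⊆ Ici 0 ×ˢ U :=
    prod_mono (fun t ht ↦ (le_max_left _ _).trans ht.1) hRU
  obtain ⟨B, hB⟩ := hcomp.exists_bound_of_continuousOn (hF.continuousOn.mono hsub)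
  obtain ⟨K, hK⟩ := hcomp.exists_bound_of_continuousOn
    ((continuousOn_fderiv_of_contDiffOn_prod hU hF).mono hsub)
  set B' := max B 0 + 1 with hB'
  obtain ⟨K', hK'⟩ : ∃ K' : ℝ≥0, (K' : ℝ) = max K 0 + 1 :=
    ⟨Real.toNNReal (max K 0 + 1), Real.coe_toNNReal _ (by positivity)⟩
  have hB'0 : 0 < B' := by positivity
  have hK'0 : 0 < K' := by rw [← NNReal.coe_pos, hK']; positivity
  have hK'r : (0 : ℝ) < K' := hK'0
  -- Two times of the box differ by at most 2h, whence B'|s - t| ≤ R/2 and 2K'|s - t| ≤ 1.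
  set h := min 1 (min (R / 2 / (2 * B')) (1 / (4 * (K' : ℝ)))) with hh
  have hhpos : 0 < h := by positivity
  have hI : Icc (max 0 (t₀ - h)) (t₀ + h) ⊆ I₁ :=
    Icc_subset_Icc (max_le_max le_rfl (by linarith [min_le_left 1 (min (R / 2 / (2 * B')) (1 / (4 * (K' : ℝ))))]))
      (by linarith [min_le_left 1 (min (R / 2 / (2 * B')) (1 / (4 * (K' : ℝ))))])
  have h2R : 2 * (R / 2) = R := by ring
  have hsub' : Icc (max 0 (t₀ - h)) (t₀ + h) ×ˢ Metric.closedBall y₀ (2 * (R / 2)) ⊆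
      I₁ ×ˢ Metric.closedBall y₀ R := by rw [h2R]; exact prod_mono hI subset_rfl
  refine ⟨R / 2, h, K', B', hhpos, by rwa [h2R], hB'0.le, by positivity, hK'0, fun t ht y hy ↦ ?_,
    hF.continuousOn.mono (hsub'.trans hsub),
    (continuousOn_fderiv_of_contDiffOn_prod hU hF).mono (hsub'.trans hsub),
    fun t ht y hy ↦ ?_, fun t ht y hy ↦ ?_, fun s hs t ht ↦ ?_⟩
  · have hmem := hsub (hsub' (mk_mem_prod ht hy))
    exact (hasFDerivAt_of_contDiffOn_prod hU hF hmem.1 hmem.2).differentiableAt.hasFDerivAt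
  · refine (hK _ (hsub' (mk_mem_prod ht hy))).trans ?_
    rw [hK']
    linarith [le_max_left K 0]
  · refine (hB _ (hsub' (mk_mem_prod ht hy))).trans ?_
    linarith [le_max_left B 0]
  · have hst : |s - t| ≤ 2 * h := by
      have h1 := (le_max_right _ _).trans hs.1
      have h2 := (le_max_right _ _).trans ht.1
      rw [abs_le]; constructor <;> linarith [hs.2, ht.2]
    have h1 : h ≤ R / 2 / (2 * B') := (min_le_right _ _).trans (min_le_left _ _)
    have h2 : h ≤ 1 / (4 * (K' : ℝ)) := (min_le_right _ _).trans (min_le_right _ _)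
    rw [le_div_iff₀ (by positivity)] at h1 h2
    constructor
    · nlinarith
    · nlinarith

namespace IsFlowBox

variable {y₀ : E} {r : ℝ} {I : Set ℝ} {K : ℝ≥0} {B : ℝ}

theorem mono {J : Set ℝ} (h : IsFlowBox F y₀ r I K B) (hJ : J ⊆ I) : IsFlowBox F y₀ r J K B where
  radius_pos := h.radius_pos
  const_pos := h.const_pos
  diff t ht := h.diff t (hJ ht)
  cont := h.cont.mono (prod_mono hJ subset_rfl)
  cont_fderiv := h.cont_fderiv.mono (prod_mono hJ subset_rfl)
  fderiv_le t ht := h.fderiv_le t (hJ ht)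
  norm_le t ht := h.norm_le t (hJ ht)
  short s hs t ht := h.short s (hJ hs) t (hJ ht)

theorem lipschitzOnWith (h : IsFlowBox F y₀ r I K B) {t : ℝ} (ht : t ∈ I) :
    LipschitzOnWith K (F t) (Metric.closedBall y₀ (2 * r)) :=
  (convex_closedBall y₀ (2 * r)).lipschitzOnWith_of_nnnorm_hasFDerivWithin_le
    (fun y hy ↦ (h.diff t ht y hy).hasFDerivWithinAt) fun y hy ↦ h.fderiv_le t ht y hy

/-- Solutions starting in the inner ball exist on the whole time interval. -/
theorem exists_solution [CompleteSpace E] {a b : ℝ} (h : IsFlowBox F y₀ r (Icc a b) K B)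
    (hB : 0 ≤ B) {t₁ : ℝ}
    (ht₁ : t₁ ∈ Icc a b) {y : E} (hy : y ∈ Metric.closedBall y₀ r) :
    ∃ α : ℝ → E, α t₁ = y ∧ ∀ t ∈ Icc a b, α t ∈ Metric.closedBall y₀ (2 * r) ∧
      HasDerivWithinAt α (F t (α t)) (Icc a b) t := by
  have hr := h.radius_pos
  have hab : a ≤ b := ht₁.1.trans ht₁.2
  lift B to ℝ≥0 using hB
  lift r to ℝ≥0 using hr.le
  have h2r : ((2 * r : ℝ≥0) : ℝ) = 2 * r := by push_cast; rfl
  have hpl : IsPicardLindelof F (⟨t₁, ht₁⟩ : Icc a b) y₀ (2 * r) r B K :=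
    { lipschitzOnWith := fun t ht ↦ by rw [h2r]; exact h.lipschitzOnWith ht
      continuousOn := fun x hx ↦ h.cont.comp (f := fun t ↦ (t, x)) (by fun_prop)
        fun t ht ↦ ⟨ht, by rwa [h2r] at hx⟩
      norm_le := fun t ht x hx ↦ h.norm_le t ht x (by rwa [h2r] at hx)
      mul_max_le := by
        have h1 := (h.short b ⟨hab, le_rfl⟩ t₁ ht₁).1
        have h2 := (h.short t₁ ht₁ a ⟨le_rfl, hab⟩).1
        rw [abs_of_nonneg (by linarith [ht₁.2])] at h1
        rw [abs_of_nonneg (by linarith [ht₁.1])] at h2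
        change (B : ℝ) * max (b - t₁) (t₁ - a) ≤ ((2 * r : ℝ≥0) : ℝ) - r
        rw [h2r]
        rcases max_choice (b - t₁) (t₁ - a) with e | e <;> rw [e] <;> linarith }
  -- The Picard fixed point is used directly, because it also records that the solution stays in the
  -- ball of radius 2r.
  obtain ⟨α, hα⟩ := ODE.FunSpace.exists_isFixedPt_next hpl hy
  refine ⟨α.compProj, by
    change α.compProj ((⟨t₁, ht₁⟩ : Icc a b) : ℝ) = y
    rw [ODE.FunSpace.compProj_val, ← hα, ODE.FunSpace.next_apply₀],
    fun t ht ↦ ⟨h2r ▸ α.compProj_mem_closedBall hpl.mul_max_le, ?_⟩⟩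
  apply ODE.hasDerivWithinAt_picard_Icc ht₁ hpl.continuousOn_uncurry
    α.continuous_compProj.continuousOn (fun _ ht' ↦ α.compProj_mem_closedBall hpl.mul_max_le)
    y ht |>.congr_of_mem _ ht
  intro t' ht'
  nth_rw 1 [← hα]
  rw [ODE.FunSpace.compProj_of_mem ht', ODE.FunSpace.next_apply]

theorem dist_solutions_le {a b : ℝ} (h : IsFlowBox F y₀ r (Icc a b) K B) {α β : ℝ → E}
    (hα : ∀ t ∈ Icc a b, α t ∈ Metric.closedBall y₀ (2 * r) ∧
      HasDerivWithinAt α (F t (α t)) (Icc a b) t)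
    (hβ : ∀ t ∈ Icc a b, β t ∈ Metric.closedBall y₀ (2 * r) ∧
      HasDerivWithinAt β (F t (β t)) (Icc a b) t) :
    ∀ t ∈ Icc a b, dist (α t) (β t) ≤ dist (α a) (β a) * Real.exp (K * (t - a)) :=
  dist_le_of_trajectories_ODE_of_mem (v := F) (s := fun _ ↦ Metric.closedBall y₀ (2 * r))
    (fun _ ht ↦ h.lipschitzOnWith (Ico_subset_Icc_self ht))
    (fun t ht ↦ (hα t ht).2.continuousWithinAt)
    (fun t ht ↦ (hα t (Ico_subset_Icc_self ht)).2.mono_of_mem_nhdsWithin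
      (Icc_mem_nhdsGE_of_mem ht))
    (fun t ht ↦ (hα t (Ico_subset_Icc_self ht)).1)
    (fun t ht ↦ (hβ t ht).2.continuousWithinAt)
    (fun t ht ↦ (hβ t (Ico_subset_Icc_self ht)).2.mono_of_mem_nhdsWithin
      (Icc_mem_nhdsGE_of_mem ht))
    (fun t ht ↦ (hβ t (Ico_subset_Icc_self ht)).1) le_rfl

/-- Existence of the solution of the linearized equation. -/
theorem exists_linearized [CompleteSpace E] {a b : ℝ} (hab : a ≤ b)
    (h : IsFlowBox F y₀ r (Icc a b) K B) {α : ℝ → E}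
    (hα : ∀ t ∈ Icc a b, α t ∈ Metric.closedBall y₀ (2 * r) ∧
      HasDerivWithinAt α (F t (α t)) (Icc a b) t) :
    ∃ Z : ℝ → E →L[ℝ] E, Z a = ContinuousLinearMap.id ℝ E ∧ ∀ t ∈ Icc a b,
      HasDerivWithinAt Z ((fderiv ℝ (F t) (α t)).comp (Z t)) (Icc a b) t := by
  have hA : ContinuousOn (fun t ↦ fderiv ℝ (F t) (α t)) (Icc a b) :=
    h.cont_fderiv.comp (f := fun t ↦ (t, α t))
      (continuousOn_id.prodMk fun t ht ↦ (hα t ht).2.continuousWithinAt)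
      fun t ht ↦ ⟨ht, (hα t ht).1⟩
  have hKb : ∀ t ∈ Icc a b, ‖fderiv ℝ (F t) (α t)‖ ≤ K := fun t ht ↦
    h.fderiv_le t ht _ (hα t ht).1
  -- Picard iteration in the unit ball around the identity: there ‖Z‖ ≤ 2, so the linear field is
  -- bounded by 2K, and 2K(b - a) ≤ 1 is part of the flow box.
  have hpl : IsPicardLindelof (fun t (Z : E →L[ℝ] E) ↦ (fderiv ℝ (F t) (α t)).comp Z)
      (⟨a, le_rfl, hab⟩ : Icc a b) (ContinuousLinearMap.id ℝ E) 1 0 (2 * K) K :=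
    { lipschitzOnWith := fun t ht ↦ LipschitzOnWith.of_dist_le_mul fun Z _ Z' _ ↦ by
        rw [dist_eq_norm, dist_eq_norm, ← ContinuousLinearMap.comp_sub]
        exact (ContinuousLinearMap.opNorm_comp_le _ _).trans (by gcongr; exact hKb t ht)
      continuousOn := fun Z _ ↦ hA.clm_comp continuousOn_const
      norm_le := fun t ht Z hZ ↦ by
        have h1 : ‖Z‖ ≤ 2 := by
          have h2 : ‖Z - ContinuousLinearMap.id ℝ E‖ ≤ 1 := by
            simpa [dist_eq_norm] using hZ
          have h3 := norm_le_norm_add_norm_sub' Z (ContinuousLinearMap.id ℝ E)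
          have h4 := ContinuousLinearMap.norm_id_le (𝕜 := ℝ) (E := E)
          linarith
        calc _ ≤ ‖fderiv ℝ (F t) (α t)‖ * ‖Z‖ := ContinuousLinearMap.opNorm_comp_le _ _
          _ ≤ K * 2 := by gcongr; exact hKb t ht
          _ = _ := by push_cast; ring
      mul_max_le := by
        have h1 := (h.short b ⟨hab, le_rfl⟩ a ⟨le_rfl, hab⟩).2
        rw [abs_of_nonneg (by linarith)] at h1
        simp only [sub_self, max_eq_left (sub_nonneg.2 hab)]
        push_cast
        linarith }
  exact hpl.exists_eq_forall_mem_Icc_hasDerivWithinAt₀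

/-- The time-`b` map is differentiable, with derivative given by the linearized equation. -/
theorem hasFDerivAt_solution [FiniteDimensional ℝ E] {a b : ℝ} (hab : a ≤ b)
    (h : IsFlowBox F y₀ r (Icc a b) K B) {α : E → ℝ → E}
    (hα : ∀ y ∈ Metric.closedBall y₀ r, α y a = y ∧ ∀ t ∈ Icc a b,
      α y t ∈ Metric.closedBall y₀ (2 * r) ∧
      HasDerivWithinAt (α y) (F t (α y t)) (Icc a b) t)
    {x : E} (hx : x ∈ Metric.ball y₀ r) {Z : ℝ → E →L[ℝ] E}
    (hZ0 : Z a = ContinuousLinearMap.id ℝ E)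
    (hZ : ∀ t ∈ Icc a b,
      HasDerivWithinAt Z ((fderiv ℝ (F t) (α x t)).comp (Z t)) (Icc a b) t) :
    HasFDerivAt (fun y ↦ α y b) (Z b) x := by
  have hK : (0 : ℝ) < K := h.const_pos
  have hxc := Metric.ball_subset_closedBall hx
  set Q := Real.exp (K * (b - a)) with hQ
  have hQ0 : 0 < Q := Real.exp_pos _
  rw [hasFDerivAt_iff_isLittleO, Asymptotics.isLittleO_iff]
  intro c hc
  -- The error of the linearization is driven by a term of size at most ε Q ‖y - x‖, and Grönwall
  -- multiplies it by at most Q / K; the result is c ‖y - x‖.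
  set ε := c * K / (Q * Q) with hε
  have hε0 : 0 < ε := by positivity
  have huc := (isCompact_Icc.prod (isCompact_closedBall y₀ (2 * r))).uniformContinuousOn_of_continuous
    h.cont_fderiv
  obtain ⟨ρ, hρ, huc⟩ := Metric.uniformContinuousOn_iff.1 huc ε hε0
  have hev : ∀ᶠ y in 𝓝 x, y ∈ Metric.ball y₀ r ∧ ‖y - x‖ * Q < ρ := by
    refine Filter.Eventually.and (Metric.isOpen_ball.mem_nhds hx) ?_
    refine ContinuousAt.eventually_lt (by fun_prop) continuousAt_const ?_
    simpa using hρ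
  filter_upwards [hev] with y hy
  obtain ⟨hyb, hyρ⟩ := hy
  obtain ⟨hx0, hxs⟩ := hα x hxc
  obtain ⟨hy0, hys⟩ := hα y (Metric.ball_subset_closedBall hyb)
  have hw : ∀ t ∈ Icc a b, ‖α y t - α x t‖ ≤ ‖y - x‖ * Q := by
    intro t ht
    have h1 := h.dist_solutions_le hys hxs t ht
    rw [hx0, hy0, dist_eq_norm, dist_eq_norm] at h1
    refine h1.trans ?_
    rw [hQ]
    gcongr
    exact ht.2
  have htay : ∀ t ∈ Icc a b, ‖F t (α y t) - F t (α x t) - fderiv ℝ (F t) (α x t) (α y t - α x t)‖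
      ≤ ε * ‖α y t - α x t‖ := by
    intro t ht
    have hseg : segment ℝ (α x t) (α y t) ⊆ Metric.closedBall y₀ (2 * r) :=
      (convex_closedBall _ _).segment_subset (hxs t ht).1 (hys t ht).1
    refine (convex_segment (α x t) (α y t)).norm_image_sub_le_of_norm_hasFDerivWithin_le'
      (f' := fderiv ℝ (F t)) (fun z hz ↦ (h.diff t ht z (hseg hz)).hasFDerivWithinAt)
      (fun z hz ↦ ?_) (left_mem_segment ℝ _ _) (right_mem_segment ℝ _ _)
    have h1 := huc (t, z) ⟨ht, hseg hz⟩ (t, α x t) ⟨ht, (hxs t ht).1⟩ (by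
      rw [Prod.dist_eq, dist_self, max_eq_right dist_nonneg, dist_eq_norm]
      exact ((norm_sub_le_of_mem_segment hz).trans (hw t ht)).trans_lt hyρ)
    rw [dist_eq_norm] at h1
    exact h1.le
  have hzd : ∀ t ∈ Icc a b, HasDerivWithinAt (fun t ↦ α y t - α x t - Z t (y - x))
      (F t (α y t) - F t (α x t) - fderiv ℝ (F t) (α x t) (Z t (y - x))) (Icc a b) t := by
    intro t ht
    have h1 := (hZ t ht).clm_apply (hasDerivWithinAt_const t (Icc a b) (y - x))
    simp only [ContinuousLinearMap.comp_apply, map_zero, add_zero] at h1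
    exact ((hys t ht).2.sub (hxs t ht).2).sub h1
  have hgr := norm_le_gronwallBound_of_norm_deriv_right_le (δ := 0) (K := K)
    (ε := ε * (‖y - x‖ * Q)) (fun t ht ↦ (hzd t ht).continuousWithinAt)
    (fun t ht ↦ (hzd t (Ico_subset_Icc_self ht)).mono_of_mem_nhdsWithin (Icc_mem_nhdsGE_of_mem ht))
    (by simp [hx0, hy0, hZ0]) (fun t ht ↦ ?_) b ⟨hab, le_rfl⟩
  · refine hgr.trans ?_
    rw [gronwallBound_of_K_ne_0 hK.ne']
    simp only [zero_mul, zero_add]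
    rw [← hQ]
    calc ε * (‖y - x‖ * Q) / K * (Q - 1) ≤ ε * (‖y - x‖ * Q) / K * Q := by gcongr; linarith
      _ = c * ‖y - x‖ := by rw [hε]; field_simp
  · have ht' := Ico_subset_Icc_self ht
    -- The error solves the linearized equation up to the Taylor remainder of F.
    have h1 : F t (α y t) - F t (α x t) - fderiv ℝ (F t) (α x t) (Z t (y - x))
        = fderiv ℝ (F t) (α x t) (α y t - α x t - Z t (y - x)) +
          (F t (α y t) - F t (α x t) - fderiv ℝ (F t) (α x t) (α y t - α x t)) := by
      rw [map_sub _ (α y t - α x t)]; abel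
    rw [h1]
    refine (norm_add_le _ _).trans (add_le_add ?_ ?_)
    · exact ((fderiv ℝ (F t) (α x t)).le_opNorm _).trans
        (by gcongr; exact h.fderiv_le t ht' _ (hxs t ht').1)
    · exact (htay t ht').trans (by gcongr; exact hw t ht')

end IsFlowBox

end LocalFlow

namespace IsFlowBox

open scoped NNReal

variable {E : Type*} [NormedAddCommGroup E] [NormedSpace ℝ E]
  {F : ℝ → E → E} {y₀ : E} {r : ℝ} {K : ℝ≥0} {B : ℝ}

/-- The common point may be interior, so uniqueness is applied separately forward and backward in
time. -/
theorem eqOn_solutions {a b : ℝ} (h : IsFlowBox F y₀ r (Icc a b) K B) {α β : ℝ → E}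
    (hα : ∀ t ∈ Icc a b, α t ∈ Metric.closedBall y₀ (2 * r) ∧
      HasDerivWithinAt α (F t (α t)) (Icc a b) t)
    (hβ : ∀ t ∈ Icc a b, β t ∈ Metric.closedBall y₀ (2 * r) ∧
      HasDerivWithinAt β (F t (β t)) (Icc a b) t)
    {t₁ : ℝ} (ht₁ : t₁ ∈ Icc a b) (he : α t₁ = β t₁) : EqOn α β (Icc a b) := by
  have hr : Icc t₁ b ⊆ Icc a b := Icc_subset_Icc_left ht₁.1
  have hl : Icc a t₁ ⊆ Icc a b := Icc_subset_Icc_right ht₁.2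
  have key : ∀ {γ : ℝ → E}, (∀ t ∈ Icc a b, γ t ∈ Metric.closedBall y₀ (2 * r) ∧
      HasDerivWithinAt γ (F t (γ t)) (Icc a b) t) → ContinuousOn γ (Icc a b) := fun hγ t ht ↦
    (hγ t ht).2.continuousWithinAt
  intro t ht
  rcases le_total t₁ t with hle | hle
  · refine ODE_solution_unique_of_mem_Icc_right (v := F) (K := K)
      (s := fun _ ↦ Metric.closedBall y₀ (2 * r))
      (fun s hs ↦ h.lipschitzOnWith (hr (Ico_subset_Icc_self hs)))
      ((key hα).mono hr) (fun s hs ↦ ?_) (fun s hs ↦ (hα s (hr (Ico_subset_Icc_self hs))).1)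
      ((key hβ).mono hr) (fun s hs ↦ ?_) (fun s hs ↦ (hβ s (hr (Ico_subset_Icc_self hs))).1)
      he ⟨hle, ht.2⟩
    · exact (hα s (hr (Ico_subset_Icc_self hs))).2.mono_of_mem_nhdsWithin
        (Icc_mem_nhdsGE_of_mem ⟨ht₁.1.trans hs.1, hs.2⟩)
    · exact (hβ s (hr (Ico_subset_Icc_self hs))).2.mono_of_mem_nhdsWithin
        (Icc_mem_nhdsGE_of_mem ⟨ht₁.1.trans hs.1, hs.2⟩)
  · refine ODE_solution_unique_of_mem_Icc_left (v := F) (K := K)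
      (s := fun _ ↦ Metric.closedBall y₀ (2 * r))
      (fun s hs ↦ h.lipschitzOnWith (hl (Ioc_subset_Icc_self hs)))
      ((key hα).mono hl) (fun s hs ↦ ?_) (fun s hs ↦ (hα s (hl (Ioc_subset_Icc_self hs))).1)
      ((key hβ).mono hl) (fun s hs ↦ ?_) (fun s hs ↦ (hβ s (hl (Ioc_subset_Icc_self hs))).1)
      he ⟨ht.1, hle⟩
    · exact (hα s (hl (Ioc_subset_Icc_self hs))).2.mono_of_mem_nhdsWithin
        (Icc_mem_nhdsLE_of_mem ⟨hs.1, hs.2.trans ht₁.2⟩)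
    · exact (hβ s (hl (Ioc_subset_Icc_self hs))).2.mono_of_mem_nhdsWithin
        (Icc_mem_nhdsLE_of_mem ⟨hs.1, hs.2.trans ht₁.2⟩)

end IsFlowBox

/-! ### Uniqueness of solutions and the flow on the manifold -/

section Solutions

variable {E : Type*} [NormedAddCommGroup E] [NormedSpace ℝ E]
  {M : Type*} [MetricSpace M] [ChartedSpace E M] [IsManifold 𝓘(ℝ, E) ∞ M]
  {f : ℝ → ∀ x : M, TangentSpace 𝓘(ℝ, E) x} {c c₁ c₂ : ℝ → M} {J : Set ℝ}

omit [IsManifold 𝓘(ℝ, E) ∞ M] in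
theorem IsSolutionOn.mono {J' : Set ℝ} (hc : IsSolutionOn f c J) (hJ : J' ⊆ J) :
    IsSolutionOn f c J' := fun s hs ↦ (hc s (hJ hs)).mono hJ

omit [IsManifold 𝓘(ℝ, E) ∞ M] in
theorem coordField_ext {p x : M} (hx : x ∈ (chartAt E p).source) (t : ℝ) :
    coordField f p t (extChartAt 𝓘(ℝ, E) p x) = coordVec p x (f t x) := by
  simp only [coordField]
  rw [symm_ext hx]

theorem ofCoord_coordField {p : M} {y : E} (hy : y ∈ (extChartAt 𝓘(ℝ, E) p).target) (t : ℝ) :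
    ofCoord p y (coordField f p t y) = f t ((extChartAt 𝓘(ℝ, E) p).symm y) :=
  ofCoord_coordVec hy _

theorem IsSolutionOn.hasDerivWithinAt_ext {p : M} {t : ℝ} (hc : IsSolutionOn f c J) (ht : t ∈ J)
    (hct : c t ∈ (chartAt E p).source) :
    HasDerivWithinAt (fun s ↦ extChartAt 𝓘(ℝ, E) p (c s))
      (coordField f p t (extChartAt 𝓘(ℝ, E) p (c t))) J t := by
  rw [coordField_ext hct]
  exact hasDerivWithinAt_ext_comp hct (hc t ht)

theorem isSolutionOn_symm_comp {p : M} {α : ℝ → E}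
    (hα : ∀ t ∈ J, α t ∈ (extChartAt 𝓘(ℝ, E) p).target ∧
      HasDerivWithinAt α (coordField f p t (α t)) J t) :
    IsSolutionOn f (fun t ↦ (extChartAt 𝓘(ℝ, E) p).symm (α t)) J := by
  intro t ht
  have h := hasMFDerivWithinAt_symm_comp (hα t ht).1 (hα t ht).2
  rwa [ofCoord_coordField (hα t ht).1] at h

variable [FiniteDimensional ℝ E]

/-- Near the common point both curves lie in one chart and solve the same Lipschitz equation in a
flow box. The neighbourhood is relative to the interval, which covers its end points. -/
theorem IsSolutionOn.eventually_eq (hf : IsC1TimeVaryingField f) {a b : ℝ} (ha : 0 ≤ a)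
    (h₁ : IsSolutionOn f c₁ (Icc a b)) (h₂ : IsSolutionOn f c₂ (Icc a b)) {t : ℝ}
    (ht : t ∈ Icc a b) (he : c₁ t = c₂ t) : ∀ᶠ s in 𝓝[Icc a b] t, c₁ s = c₂ s := by
  set p := c₁ t with hp
  obtain ⟨r, h, K, B, hh, hball, -, hbox⟩ := exists_flowBox (isOpen_target p)
    (contDiffOn_coordField hf p) (t₀ := t)
    (ext_mem_target (E := E) (mem_chart_source E p))
  set y₀ := extChartAt 𝓘(ℝ, E) p p with hy₀
  have hN : ∀ᶠ x in 𝓝 p, x ∈ (chartAt E p).source ∧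
      extChartAt 𝓘(ℝ, E) p x ∈ Metric.closedBall y₀ (2 * r) :=
    Filter.Eventually.and ((chartAt E p).open_source.mem_nhds (mem_chart_source E p))
      ((continuousAt_extChartAt p).eventually_mem
        (Metric.closedBall_mem_nhds _ (by linarith [hbox.radius_pos])))
  have hev : ∀ᶠ s in 𝓝[Icc a b] t, (c₁ s ∈ (chartAt E p).source ∧
      extChartAt 𝓘(ℝ, E) p (c₁ s) ∈ Metric.closedBall y₀ (2 * r)) ∧
      (c₂ s ∈ (chartAt E p).source ∧
      extChartAt 𝓘(ℝ, E) p (c₂ s) ∈ Metric.closedBall y₀ (2 * r)) := by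
    have hN' : ∀ᶠ x in 𝓝 (c₂ t), x ∈ (chartAt E p).source ∧
        extChartAt 𝓘(ℝ, E) p x ∈ Metric.closedBall y₀ (2 * r) := by
      have e : 𝓝 (c₂ t) = 𝓝 p := by rw [he]
      rw [e]; exact hN
    exact ((h₁ t ht).continuousWithinAt.eventually hN).and
      ((h₂ t ht).continuousWithinAt.eventually hN')
  obtain ⟨ε, hε, hev⟩ := Metric.mem_nhdsWithin_iff.1 hev
  set η := min h (ε / 2) with hη
  have hη0 : 0 < η := by positivity
  set a' := max a (t - η)
  set b' := min b (t + η)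
  have hsub : Icc a' b' ⊆ Icc a b := Icc_subset_Icc (le_max_left _ _) (min_le_left _ _)
  have hsub' : Icc a' b' ⊆ Icc (max 0 (t - h)) (t + h) :=
    Icc_subset_Icc (max_le_max ha (by linarith [min_le_left h (ε / 2)]))
      ((min_le_right _ _).trans (by linarith [min_le_left h (ε / 2)]))
  have hin : ∀ s ∈ Icc a' b', s ∈ Metric.ball t ε ∩ Icc a b := fun s hs ↦ by
    refine ⟨?_, hsub hs⟩
    have h1 := (le_max_right _ _).trans hs.1
    have h2 := hs.2.trans (min_le_right _ _)
    have h3 := min_le_right h (ε / 2)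
    rw [Metric.mem_ball, Real.dist_eq, abs_lt]
    constructor <;> linarith
  have htm : t ∈ Icc a' b' := ⟨max_le ht.1 (by linarith), le_min ht.2 (by linarith)⟩
  have hEq := (hbox.mono hsub').eqOn_solutions
    (α := fun s ↦ extChartAt 𝓘(ℝ, E) p (c₁ s)) (β := fun s ↦ extChartAt 𝓘(ℝ, E) p (c₂ s))
    (fun s hs ↦ ⟨(hev (hin s hs)).1.2,
      (h₁.mono hsub).hasDerivWithinAt_ext hs (hev (hin s hs)).1.1⟩)
    (fun s hs ↦ ⟨(hev (hin s hs)).2.2,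
      (h₂.mono hsub).hasDerivWithinAt_ext hs (hev (hin s hs)).2.1⟩) htm (by rw [← hp, he])
  have hmem : Icc (t - η) (t + η) ∈ 𝓝 t := Icc_mem_nhds (by linarith) (by linarith)
  filter_upwards [mem_nhdsWithin_of_mem_nhds hmem, self_mem_nhdsWithin] with s hs hs'
  have hs'' : s ∈ Icc a' b' := ⟨max_le hs'.1 hs.1, le_min hs'.2 hs.2⟩
  have h1 := hEq hs''
  have h2 := (hev (hin s hs''))
  rw [← symm_ext h2.1.1, ← symm_ext h2.2.1]
  exact congrArg _ h1

/-- Connectedness of the interval: coincidence is a relatively open condition by local uniqueness,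
and non-coincidence is one because M is Hausdorff. -/
theorem IsSolutionOn.eqOn (hf : IsC1TimeVaryingField f) {a b : ℝ} (ha : 0 ≤ a)
    (h₁ : IsSolutionOn f c₁ (Icc a b)) (h₂ : IsSolutionOn f c₂ (Icc a b)) {t₁ : ℝ}
    (ht₁ : t₁ ∈ Icc a b) (he : c₁ t₁ = c₂ t₁) : EqOn c₁ c₂ (Icc a b) := by
  intro t ht
  refine (isPreconnected_Icc.induction₂ (fun x y ↦ (c₁ x = c₂ x ↔ c₁ y = c₂ y)) (fun x hx ↦ ?_)
    (fun x y z _ _ _ h h' ↦ h.trans h') (fun x y _ _ h ↦ h.symm) ht₁ ht).1 he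
  by_cases hxe : c₁ x = c₂ x
  · filter_upwards [h₁.eventually_eq hf ha h₂ hx hxe] with y hy
    exact iff_of_true hxe hy
  · filter_upwards [(h₁ x hx).continuousWithinAt.prodMk (h₂ x hx).continuousWithinAt |>.eventually
      (isClosed_diagonal.isOpen_compl.mem_nhds hxe)] with y hy
    exact iff_of_false hxe hy

/-- The flow is given by any solution. -/
theorem flow_eq (hf : IsC1TimeVaryingField f) {t t₀ : ℝ} (ht : 0 ≤ t) (ht₀ : 0 ≤ t₀)
    (hc : IsSolutionOn f c (uIcc t₀ t)) : flow f t t₀ (c t₀) = c t := by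
  have h : FlowDefined f t t₀ (c t₀) := ⟨c, rfl, hc⟩
  rw [flow, dif_pos h]
  exact h.choose_spec.2.eqOn hf (le_min ht₀ ht) hc left_mem_uIcc h.choose_spec.1 right_mem_uIcc

omit [IsManifold 𝓘(ℝ, E) ∞ M] [FiniteDimensional ℝ E] in
theorem flow_self (t : ℝ) (x : M) : flow f t t x = x := by
  by_cases h : FlowDefined f t t x
  · rw [flow, dif_pos h]
    exact h.choose_spec.1
  · rw [flow, dif_neg h]

/-- Forward completeness. -/
def IsForwardComplete (f : ℝ → ∀ x : M, TangentSpace 𝓘(ℝ, E) x) : Prop :=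
  ∀ t₀ ≥ 0, ∀ t ≥ t₀, ∀ x₀ : M, FlowDefined f t t₀ x₀

omit [IsManifold 𝓘(ℝ, E) ∞ M] [FiniteDimensional ℝ E] in
theorem IsUGES.isForwardComplete {xs : M} (h : IsUGES f xs) : IsForwardComplete f := by
  obtain ⟨-, K, -, lam, -, h⟩ := h
  exact fun t₀ ht₀ t ht x₀ ↦ (h t₀ ht₀ t ht x₀).1

namespace IsForwardComplete

variable (hc : IsForwardComplete f) (hf : IsC1TimeVaryingField f)
include hc hf

/-- The definition of `flow` chooses a solution anew for each final time; uniqueness makes these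
choices pieces of a single curve. -/
theorem isSolutionOn_flow {t₀ : ℝ} (ht₀ : 0 ≤ t₀) (T : ℝ) (x : M) :
    IsSolutionOn f (fun t ↦ flow f t t₀ x) (Icc t₀ T) := by
  rcases lt_or_ge T t₀ with hT | hT
  · rw [Icc_eq_empty hT.not_ge]; exact fun s hs ↦ hs.elim
  obtain ⟨c, rfl, hcs⟩ := hc t₀ ht₀ T hT x
  rw [uIcc_of_le hT] at hcs
  have heq : EqOn (fun t ↦ flow f t t₀ (c t₀)) c (Icc t₀ T) := fun t ht ↦
    flow_eq hf (ht₀.trans ht.1) ht₀ (hcs.mono (by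
      rw [uIcc_of_le ht.1]; exact Icc_subset_Icc_right ht.2))
  intro s hs
  have h := (hcs s hs).congr_of_eventuallyEq
    (eventually_of_mem self_mem_nhdsWithin heq) (heq hs)
  have e : flow f s t₀ (c t₀) = c s := heq hs
  rw [← e] at h
  exact h

theorem flow_flow {t₁ t₂ t₃ : ℝ} (ht₁ : 0 ≤ t₁) (h₁₂ : t₁ ≤ t₂) (h₂₃ : t₂ ≤ t₃) (x : M) :
    flow f t₃ t₂ (flow f t₂ t₁ x) = flow f t₃ t₁ x := by
  have h := flow_eq hf (ht₁.trans (h₁₂.trans h₂₃)) (ht₁.trans h₁₂)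
    ((hc.isSolutionOn_flow hf ht₁ t₃ x).mono
      (by rw [uIcc_of_le h₂₃]; exact Icc_subset_Icc_left h₁₂) : IsSolutionOn f _ (uIcc t₂ t₃))
  exact h

end IsForwardComplete

end Solutions

/-! ### Distance along a differentiable curve -/

section Displacement

variable {E : Type*} [NormedAddCommGroup E] [NormedSpace ℝ E] [FiniteDimensional ℝ E]
  {M : Type*} [MetricSpace M] [ChartedSpace E M] [IsManifold 𝓘(ℝ, E) ∞ M]
  [RiemannianBundle (fun x : M ↦ TangentSpace 𝓘(ℝ, E) x)]
  [IsContMDiffRiemannianBundle 𝓘(ℝ, E) ∞ E (fun x : M ↦ TangentSpace 𝓘(ℝ, E) x)]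
  [IsRiemannianManifold 𝓘(ℝ, E) M]

/-- Near a point, the distance is at most the length of a chart segment. -/
theorem eventually_dist_symm_le {p : M} {y₀ : E} (hy₀ : y₀ ∈ (extChartAt 𝓘(ℝ, E) p).target)
    {ε : ℝ} (hε : 0 < ε) :
    ∀ᶠ y in 𝓝 y₀, dist ((extChartAt 𝓘(ℝ, E) p).symm y) ((extChartAt 𝓘(ℝ, E) p).symm y₀) ≤
      Real.sqrt (metricL p y₀ (y - y₀) (y - y₀) + ε * ‖y - y₀‖ ^ 2) := by
  have hG := isMetricOn_metricL (E := E) p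
  have hev : ∀ᶠ y in 𝓝 y₀, y ∈ (extChartAt 𝓘(ℝ, E) p).target ∧
      ‖metricL p y - metricL p y₀‖ < ε := by
    refine Filter.Eventually.and (hG.isOpen.mem_nhds hy₀) ?_
    have h1 := (hG.contDiffAt hy₀).continuousAt
    simpa [dist_eq_norm] using Metric.tendsto_nhds.1 h1 ε hε
  obtain ⟨ρ, hρ, hball⟩ := Metric.mem_nhds_iff.1 hev
  filter_upwards [Metric.ball_mem_nhds y₀ hρ] with y hy
  set w := y - y₀ with hw
  set C : ℝ → E := fun t ↦ y₀ + t • w with hC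
  set D := Real.sqrt (metricL p y₀ w w + ε * ‖w‖ ^ 2) with hD
  have hCm : ∀ t ∈ Icc (0 : ℝ) 1, C t ∈ Metric.ball y₀ ρ := by
    intro t ht
    rw [mem_ball_iff_norm, hC]
    simp only [add_sub_cancel_left]
    rw [norm_smul, Real.norm_of_nonneg ht.1]
    have : ‖w‖ < ρ := mem_ball_iff_norm.1 hy
    nlinarith [norm_nonneg w, ht.2]
  have hCd : ∀ t, HasDerivAt C w t := fun t ↦ by
    simpa only [one_smul, id] using ((hasDerivAt_id t).smul_const w).const_add y₀
  have hlen := pathELength_symm_comp (p := p) (C := C) (u := fun _ ↦ w)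
    (fun t ht ↦ ⟨(hball (hCm t ht)).1, (hCd t).hasDerivWithinAt⟩)
  have hsm : ContMDiffOn 𝓘(ℝ, ℝ) 𝓘(ℝ, E) 1
      (fun t ↦ (extChartAt 𝓘(ℝ, E) p).symm (C t)) (Icc 0 1) := by
    refine ContMDiffOn.comp (t := (extChartAt 𝓘(ℝ, E) p).target)
      (contMDiffOn_extChartAt_symm (I := 𝓘(ℝ, E)) (n := 1) p) ?_
      fun t ht ↦ (hball (hCm t ht)).1
    have : ContDiff ℝ 1 C := by fun_prop
    exact this.contDiffOn.contMDiffOn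
  have hle : edist ((extChartAt 𝓘(ℝ, E) p).symm y₀) ((extChartAt 𝓘(ℝ, E) p).symm y)
      ≤ ENNReal.ofReal D := by
    rw [IsRiemannianManifold.out (I := 𝓘(ℝ, E))]
    refine (Manifold.riemannianEDist_le_pathELength hsm (by simp [hC])
      (by simp [hC, hw]) zero_le_one).trans ?_
    rw [hlen]
    calc _ ≤ ∫⁻ t in Icc (0 : ℝ) 1, ENNReal.ofReal D := by
          refine MeasureTheory.setLIntegral_mono' measurableSet_Icc fun t ht ↦ ?_
          rw [← ofReal_norm]
          refine ENNReal.ofReal_le_ofReal (Real.le_sqrt_of_sq_le ?_)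
          rw [norm_ofCoord_sq (hball (hCm t ht)).1]
          have h1 := (hball (hCm t ht)).2.le
          have h2 : (metricL p (C t) - metricL p y₀) w w ≤ ε * ‖w‖ ^ 2 := by
            refine (le_abs_self _).trans ?_
            rw [← Real.norm_eq_abs]
            refine (ContinuousLinearMap.le_opNorm₂ _ _ _).trans ?_
            nlinarith [mul_le_mul_of_nonneg_right h1 (sq_nonneg ‖w‖)]
          simp only [sub_apply] at h2
          linarith
      _ = _ := by simp
  rw [dist_comm, ← ENNReal.ofReal_le_ofReal_iff (Real.sqrt_nonneg _), ← edist_dist]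
  exact hle

/-- A curve with velocity of norm less than `r` moves at speed at most `r`. -/
theorem eventually_dist_le {q : ℝ → M} {J : Set ℝ} {s : ℝ} {q' : TangentSpace 𝓘(ℝ, E) (q s)}
    (hq : HasMFDerivWithinAt 𝓘(ℝ, ℝ) 𝓘(ℝ, E) q J s ((1 : ℝ →L[ℝ] ℝ).smulRight q')) {r : ℝ}
    (hr : ‖q'‖ < r) : ∀ᶠ z in 𝓝[J] s, dist (q z) (q s) ≤ r * |z - s| := by
  obtain ⟨p, hp⟩ : ∃ p, p = q s := ⟨_, rfl⟩
  have hsrc : q s ∈ (chartAt E p).source := hp ▸ mem_chart_source E (q s)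
  have hr0 : 0 < r := (norm_nonneg _).trans_lt hr
  have hd := hasDerivWithinAt_ext_comp (p := p) hsrc hq
  set V := coordVec p (q s) q'
  set y₀ := extChartAt 𝓘(ℝ, E) p (q s)
  have hnorm : metricL p y₀ V V < r ^ 2 := by
    rw [metricL_apply, ← norm_sq_eq_chartMetric' hsrc]
    exact pow_lt_pow_left₀ hr (norm_nonneg _) two_ne_zero
  obtain ⟨ε, hε, hlt⟩ : ∃ ε > 0, metricL p y₀ V V + ε * ‖V‖ ^ 2 < r ^ 2 := by
    refine ⟨(r ^ 2 - metricL p y₀ V V) / (2 * (‖V‖ ^ 2 + 1)),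
      div_pos (by linarith) (by positivity), ?_⟩
    have : (r ^ 2 - metricL p y₀ V V) / (2 * (‖V‖ ^ 2 + 1)) * ‖V‖ ^ 2
        ≤ (r ^ 2 - metricL p y₀ V V) / 2 := by
      rw [div_mul_eq_mul_div, div_le_div_iff₀ (by positivity) two_pos]
      nlinarith [sq_nonneg ‖V‖]
    linarith
  have h1 := hd.continuousWithinAt.eventually
    (eventually_dist_symm_le (ext_mem_target hsrc) hε)
  have h2 : ∀ᶠ z in 𝓝[J] s, q z ∈ (chartAt E p).source :=
    hq.continuousWithinAt.eventually_mem ((chartAt E p).open_source.mem_nhds hsrc)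
  have hev : Continuous fun w : E ↦ metricL p y₀ w w + ε * ‖w‖ ^ 2 := by fun_prop
  have h3 := (hev.tendsto V).comp (hasDerivWithinAt_iff_tendsto_slope.1 hd)
  have h4 := eventually_nhdsWithin_iff.1 (h3.eventually_lt_const hlt)
  have h5 : ∀ᶠ z in 𝓝[J] s, z ∈ J := self_mem_nhdsWithin
  filter_upwards [h1, h2, h5, mem_nhdsWithin_of_mem_nhds h4] with z hz1 hz2 hzJ hz4
  by_cases hzs : z = s
  · simp [hzs]
  have hz5 := hz4 ⟨hzJ, hzs⟩
  rw [symm_ext hz2, symm_ext hsrc] at hz1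
  refine hz1.trans (Real.sqrt_le_iff.2 ⟨by positivity, ?_⟩)
  simp only [Function.comp, slope, vsub_eq_sub, map_smul, smul_apply, smul_eq_mul, norm_smul] at hz5
  have h6 : 0 < (z - s) ^ 2 := by have := sub_ne_zero.2 hzs; positivity
  have h7 := mul_lt_mul_of_pos_left hz5 h6
  have hne := sub_ne_zero.2 hzs
  have h8 : ‖(z - s)⁻¹‖ ^ 2 = ((z - s) ^ 2)⁻¹ := by
    rw [Real.norm_eq_abs, sq_abs, inv_pow]
  rw [mul_pow, sq_abs]
  refine le_of_eq_of_le ?_ (h7.le.trans_eq (mul_comm _ _))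
  rw [mul_pow, h8]
  field_simp
  ring

/-- Lower Dini derivative estimate for the distance to a point. -/
theorem eventually_abs_dist_sub_lt {q : ℝ → M} {s : ℝ} {J : Set ℝ} {q' : TangentSpace 𝓘(ℝ, E) (q s)}
    (hq : HasMFDerivWithinAt 𝓘(ℝ, ℝ) 𝓘(ℝ, E) q J s ((1 : ℝ →L[ℝ] ℝ).smulRight q'))
    (hJ : J ∈ 𝓝[>] s) (x₀ : M) {r : ℝ} (hr : ‖q'‖ < r) :
    ∀ᶠ z in 𝓝[>] s, (z - s)⁻¹ * |dist (q z) x₀ - dist (q s) x₀| < r := by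
  obtain ⟨r', hr1, hr2⟩ := exists_between hr
  have h1 := (eventually_dist_le hq hr1).filter_mono (nhdsWithin_le_of_mem hJ)
  filter_upwards [h1, self_mem_nhdsWithin] with z hz hzs
  have hpos : 0 < z - s := sub_pos.2 hzs
  rw [abs_of_pos hpos] at hz
  rw [inv_mul_lt_iff₀ hpos, mul_comm]
  exact (abs_dist_sub_le _ _ _).trans_lt (hz.trans_lt (by nlinarith))

/-- A curve is at most as long as the integral of a bound of its speed. -/
theorem dist_le_of_norm_velocity_le {q : ℝ → M} {a b : ℝ} (hab : a ≤ b)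
    {q' : ∀ s, TangentSpace 𝓘(ℝ, E) (q s)}
    (hq : ∀ s ∈ Icc a b,
      HasMFDerivWithinAt 𝓘(ℝ, ℝ) 𝓘(ℝ, E) q (Icc a b) s ((1 : ℝ →L[ℝ] ℝ).smulRight (q' s)))
    {B B' : ℝ → ℝ} (hB : ∀ s, HasDerivAt B (B' s) s) (hle : ∀ s ∈ Icc a b, ‖q' s‖ ≤ B' s) :
    dist (q b) (q a) ≤ B b - B a := by
  -- The velocity is not assumed continuous, so the distance from the starting point is compared
  -- with B through Dini derivatives instead of a length integral.
  have h := image_le_of_liminf_slope_right_le_deriv_boundary (f := fun s ↦ dist (q s) (q a))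
    (a := a) (b := b) (B := fun s ↦ B s - B a) (B' := B')
    (fun s hs ↦ (hq s hs).continuousWithinAt.dist continuousWithinAt_const) (by simp)
    (fun s _ ↦ ((hB s).sub_const _).continuousAt.continuousWithinAt)
    (fun s _ ↦ ((hB s).sub_const _).hasDerivWithinAt) (fun s hs r hr ↦ ?_)
  · exact h ⟨hab, le_rfl⟩
  · refine Filter.Eventually.frequently ?_
    filter_upwards [eventually_abs_dist_sub_lt (hq s (Ico_subset_Icc_self hs))
      (Icc_mem_nhdsGT_of_mem hs) (q a) ((hle s (Ico_subset_Icc_self hs)).trans_lt hr),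
      self_mem_nhdsWithin] with z hz hzs
    refine lt_of_le_of_lt ?_ hz
    rw [slope_def_field, div_eq_inv_mul]
    have hpos : 0 < z - s := sub_pos.2 hzs
    gcongr
    exact le_abs_self _

end Displacement

theorem le_mul_exp_of_deriv_le {g g' : ℝ → ℝ} {a b k : ℝ} (hab : a ≤ b)
    (hd : ∀ t ∈ Icc a b, HasDerivWithinAt g (g' t) (Icc a b) t)
    (hle : ∀ t ∈ Icc a b, g' t ≤ k * g t) : g b ≤ g a * Real.exp (k * (b - a)) := by
  have h := le_gronwallBound_of_liminf_deriv_right_le (f := g) (f' := g') (δ := g a) (K := k)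
    (ε := 0) (fun t ht ↦ (hd t ht).continuousWithinAt) (fun t ht r hr ↦ ?_) le_rfl
    (fun t ht ↦ by simpa using hle t (Ico_subset_Icc_self ht)) b ⟨hab, le_rfl⟩
  · rwa [gronwallBound_ε0] at h
  · have h1 : HasDerivWithinAt g (g' t) (Ici t) t :=
      (hd t (Ico_subset_Icc_self ht)).mono_of_mem_nhdsWithin (Icc_mem_nhdsGE_of_mem ht)
    exact h1.liminf_right_slope_le hr

/-! ### The differential of the flow -/

section FlowDifferential

variable {E : Type*} [NormedAddCommGroup E] [NormedSpace ℝ E] [FiniteDimensional ℝ E]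
  {M : Type*} [MetricSpace M] [ChartedSpace E M] [IsManifold 𝓘(ℝ, E) ∞ M]
  [RiemannianBundle (fun x : M ↦ TangentSpace 𝓘(ℝ, E) x)]
  {f : ℝ → ∀ x : M, TangentSpace 𝓘(ℝ, E) x} {L : ℝ}

/-- `φ(t₂; t₁, ·)` is differentiable at `x`, with differential of norm at most
`exp (L (t₂ - t₁))`. -/
def FlowDiffBound (f : ℝ → ∀ x : M, TangentSpace 𝓘(ℝ, E) x) (L t₁ t₂ : ℝ) (x : M) : Prop :=
  MDifferentiableAt 𝓘(ℝ, E) 𝓘(ℝ, E) (flow f t₂ t₁) x ∧ ∀ v : TangentSpace 𝓘(ℝ, E) x,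
    ‖mfderiv 𝓘(ℝ, E) 𝓘(ℝ, E) (flow f t₂ t₁) x v‖ ≤ Real.exp (L * (t₂ - t₁)) * ‖v‖

/-- Chain rule for the semigroup property; the exponents add up. -/
theorem FlowDiffBound.trans (hf : IsC1TimeVaryingField f) (hc : IsForwardComplete f)
    {t₁ t₂ t₃ : ℝ} (ht₁ : 0 ≤ t₁) (h₁₂ : t₁ ≤ t₂) (h₂₃ : t₂ ≤ t₃) {x : M}
    (h₁ : FlowDiffBound f L t₁ t₂ x) (h₂ : FlowDiffBound f L t₂ t₃ (flow f t₂ t₁ x)) :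
    FlowDiffBound f L t₁ t₃ x := by
  have e : flow f t₃ t₁ = flow f t₃ t₂ ∘ flow f t₂ t₁ :=
    funext fun y ↦ (hc.flow_flow hf ht₁ h₁₂ h₂₃ y).symm
  rw [FlowDiffBound, e]
  refine ⟨h₂.1.comp x h₁.1, fun v ↦ ?_⟩
  rw [mfderiv_comp x h₂.1 h₁.1]
  refine (h₂.2 _).trans ?_
  calc _ ≤ Real.exp (L * (t₃ - t₂)) * (Real.exp (L * (t₂ - t₁)) * ‖v‖) := by
        gcongr; exact h₁.2 v
    _ = _ := by rw [← mul_assoc, ← Real.exp_add]; ring_nf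

variable [IsContMDiffRiemannianBundle 𝓘(ℝ, E) ∞ E (fun x : M ↦ TangentSpace 𝓘(ℝ, E) x)]
  [IsRiemannianManifold 𝓘(ℝ, E) M]

/-- In a flow box the differential is the solution Z of the linearized equation. The derivative of
g(Zw, Zw) in time is the Lie derivative of g along f, at most 2L g(Zw, Zw), so Grönwall gives the
factor exp(2L(t₂ - t₁)) for the squared norm. -/
theorem exists_flowDiffBound_local (hf : IsC1TimeVaryingField f)
    (hL : 0 ≤ L) (hLip : ∀ t ≥ 0, IsLipschitzField (f t) L) (t₀ : ℝ) (p : M) :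
    ∃ h > 0, ∃ N ∈ 𝓝 p, ∀ t₁ ≥ 0, t₀ - h ≤ t₁ → ∀ t₂ ≤ t₀ + h, t₁ ≤ t₂ → ∀ x ∈ N,
      FlowDiffBound f L t₁ t₂ x := by
  obtain ⟨r, h, K, B, hh, hball, hB, hbox⟩ := exists_flowBox (isOpen_target p)
    (contDiffOn_coordField hf p) (t₀ := t₀)
    (ext_mem_target (E := E) (mem_chart_source E p))
  set y₀ := extChartAt 𝓘(ℝ, E) p p with hy₀
  have hr := hbox.radius_pos
  have hG := isMetricOn_metricL (E := E) p
  refine ⟨h, hh, {x | x ∈ (chartAt E p).source ∧ extChartAt 𝓘(ℝ, E) p x ∈ Metric.ball y₀ r},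
    Filter.Eventually.and ((chartAt E p).open_source.mem_nhds (mem_chart_source E p))
      ((continuousAt_extChartAt p).eventually_mem (Metric.ball_mem_nhds _ hr)),
    fun t₁ ht₁0 ht₁ t₂ ht₂ h₁₂ x hx ↦ ?_⟩
  have hI : Icc t₁ t₂ ⊆ Icc (max 0 (t₀ - h)) (t₀ + h) := Icc_subset_Icc (max_le ht₁0 ht₁) ht₂
  have hbox' := hbox.mono hI
  have hex : ∀ y ∈ Metric.closedBall y₀ r, ∃ α : ℝ → E, α t₁ = y ∧ ∀ t ∈ Icc t₁ t₂,
      α t ∈ Metric.closedBall y₀ (2 * r) ∧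
      HasDerivWithinAt α (coordField f p t (α t)) (Icc t₁ t₂) t := fun y hy ↦
    hbox'.exists_solution hB ⟨le_rfl, h₁₂⟩ hy
  choose! α hα0 hα using hex
  set xh := extChartAt 𝓘(ℝ, E) p x with hxh
  have hxc : xh ∈ Metric.closedBall y₀ r := Metric.ball_subset_closedBall hx.2
  obtain ⟨Z, hZ0, hZ⟩ := hbox'.exists_linearized h₁₂ (hα xh hxc)
  have hD : HasFDerivAt (fun y ↦ α y t₂) (Z t₂) xh :=
    hbox'.hasFDerivAt_solution h₁₂ (fun y hy ↦ ⟨hα0 y hy, hα y hy⟩) hx.2 hZ0 hZ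
  have hmem₂ : t₂ ∈ Icc t₁ t₂ := ⟨h₁₂, le_rfl⟩
  have hflow : ∀ z, z ∈ (chartAt E p).source → extChartAt 𝓘(ℝ, E) p z ∈ Metric.ball y₀ r →
      flow f t₂ t₁ z = (extChartAt 𝓘(ℝ, E) p).symm (α (extChartAt 𝓘(ℝ, E) p z) t₂) := by
    intro z hz hzb
    have hzc := Metric.ball_subset_closedBall hzb
    have h1 := flow_eq hf (ht₁0.trans h₁₂) ht₁0 (t := t₂) (t₀ := t₁)
      (c := fun t ↦ (extChartAt 𝓘(ℝ, E) p).symm (α (extChartAt 𝓘(ℝ, E) p z) t)) (by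
        rw [uIcc_of_le h₁₂]
        exact isSolutionOn_symm_comp fun t ht ↦ ⟨hball (hα _ hzc t ht).1, (hα _ hzc t ht).2⟩)
    simp only [hα0 _ hzc, symm_ext hz] at h1
    exact h1
  have hnear : ∀ᶠ z in 𝓝 x, z ∈ (chartAt E p).source ∧
      extChartAt 𝓘(ℝ, E) p z ∈ Metric.ball y₀ r :=
    Filter.Eventually.and ((chartAt E p).open_source.mem_nhds hx.1)
      ((continuousAt_extChartAt' (by rw [extChartAt_source]; exact hx.1)).eventually_mem
        (Metric.isOpen_ball.mem_nhds hx.2))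
  have hext : HasMFDerivAt 𝓘(ℝ, E) 𝓘(ℝ, E) (fun z ↦ α (extChartAt 𝓘(ℝ, E) p z) t₂) x
      ((Z t₂).comp (mfderiv 𝓘(ℝ, E) 𝓘(ℝ, E) (extChartAt 𝓘(ℝ, E) p) x)) :=
    hD.hasMFDerivAt.comp x (mdifferentiableAt_extChartAt (I := 𝓘(ℝ, E)) hx.1).hasMFDerivAt
  have htgt : α xh t₂ ∈ (extChartAt 𝓘(ℝ, E) p).target := hball (hα _ hxc t₂ hmem₂).1
  have hmd : MDifferentiableAt 𝓘(ℝ, E) 𝓘(ℝ, E) (flow f t₂ t₁) x := by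
    have h1 := ((hasMFDerivAt_symm htgt).comp x hext).mdifferentiableAt
    refine h1.congr_of_eventuallyEq ?_
    filter_upwards [hnear] with z hz
    exact hflow z hz.1 hz.2
  refine ⟨hmd, fun v ↦ ?_⟩
  have hfx := hflow x hx.1 hx.2
  have hfsrc : flow f t₂ t₁ x ∈ (chartAt E p).source := by rw [hfx]; exact symm_mem_source htgt
  have hfe : extChartAt 𝓘(ℝ, E) p (flow f t₂ t₁ x) = α xh t₂ := by rw [hfx]; exact ext_symm htgt
  have hcoord : coordVec p (flow f t₂ t₁ x) (mfderiv 𝓘(ℝ, E) 𝓘(ℝ, E) (flow f t₂ t₁) x v)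
      = Z t₂ (coordVec p x v) := by
    have h1 := (mdifferentiableAt_extChartAt (I := 𝓘(ℝ, E)) hfsrc).hasMFDerivAt.comp x
      hmd.hasMFDerivAt
    have h2 := hext.congr_of_eventuallyEq (f₁ := extChartAt 𝓘(ℝ, E) p ∘ flow f t₂ t₁) (by
      filter_upwards [hnear] with z hz
      simp only [Function.comp]
      rw [hflow z hz.1 hz.2]
      exact ext_symm (hball (hα _ (Metric.ball_subset_closedBall hz.2) t₂ hmem₂).1))
    exact DFunLike.congr_fun (hasMFDerivAt_unique h1 h2) v
  set w := coordVec p x v with hw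
  have hdiff : ∀ t ∈ Icc t₁ t₂, HasDerivWithinAt
      (fun t ↦ metricL p (α xh t) (Z t w) (Z t w))
      (fderiv ℝ (metricL p) (α xh t) (coordField f p t (α xh t)) (Z t w) (Z t w)
        + 2 * metricL p (α xh t) (fderiv ℝ (coordField f p t) (α xh t) (Z t w)) (Z t w))
      (Icc t₁ t₂) t := by
    intro t ht
    have h1 := (hZ t ht).clm_apply (hasDerivWithinAt_const t (Icc t₁ t₂) w)
    simp only [ContinuousLinearMap.comp_apply, map_zero, add_zero] at h1
    have h2 := hG.hasDerivWithinAt_apply (hball (hα _ hxc t ht).1) (hα _ hxc t ht).2 h1 h1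
    refine h2.congr_deriv ?_
    rw [hG.symm _ (Z t w)]
    ring
  have hgr := le_mul_exp_of_deriv_le h₁₂ hdiff (k := 2 * L) fun t ht ↦
    (le_abs_self _).trans ((hLip t (ht₁0.trans ht.1)).abs_lie_metric_le hL
      (hball (hα _ hxc t ht).1) (hbox'.diff t ht _ (hα _ hxc t ht).1) (Z t w))
  refine abs_le_of_sq_le_sq' ?_ (by positivity) |>.2
  rw [norm_sq_eq_chartMetric' hfsrc, hcoord, hfe, mul_pow, norm_sq_eq_chartMetric' hx.1,
    ← Real.exp_nat_mul]
  rw [hZ0, hα0 _ hxc] at hgr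
  simp only [metricL_apply, ContinuousLinearMap.id_apply] at hgr
  refine hgr.trans_eq ?_
  rw [mul_comm]
  congr 2
  push_cast; ring

/-- The orbit over [t₁, t₂] is compact: a finite subdivision puts each piece in one local
neighbourhood, and the pieces compose without loss in the constant. -/
theorem IsForwardComplete.flowDiffBound (hc : IsForwardComplete f) (hf : IsC1TimeVaryingField f)
    (hL : 0 ≤ L) (hLip : ∀ t ≥ 0, IsLipschitzField (f t) L) {t₁ t₂ : ℝ} (ht₁ : 0 ≤ t₁)
    (h₁₂ : t₁ ≤ t₂) (x : M) : FlowDiffBound f L t₁ t₂ x := by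
  set c : ℝ → M := fun t ↦ flow f t t₁ x with hcdef
  have hcont : ContinuousOn c (Icc t₁ t₂) := fun t ht ↦
    (hc.isSolutionOn_flow hf ht₁ t₂ x t ht).continuousWithinAt
  have hloc : ∀ s : Icc t₁ t₂, ∃ U : Set (Icc t₁ t₂), IsOpen U ∧ s ∈ U ∧ ∀ a ∈ U, ∀ b ∈ U,
      a ≤ b → FlowDiffBound f L a b (c a) := by
    intro s
    obtain ⟨h, hh, N, hN, hloc⟩ := exists_flowDiffBound_local hf hL hLip s (c s)
    have h1 : ∀ᶠ a : Icc t₁ t₂ in 𝓝 s, c a ∈ N :=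
      (continuousOn_iff_continuous_domRestrict.1 hcont).continuousAt.eventually_mem hN
    have h2 : ∀ᶠ a : Icc t₁ t₂ in 𝓝 s, (a : ℝ) ∈ Icc (s - h) (s + h) :=
      continuous_subtype_val.continuousAt.eventually_mem
        (Icc_mem_nhds (by linarith) (by linarith))
    obtain ⟨U, hU, hUo, hsU⟩ := eventually_nhds_iff.1 (h1.and h2)
    exact ⟨U, hUo, hsU, fun a ha b hb hab ↦ hloc a (ht₁.trans a.2.1) (hU a ha).2.1 b
      (hU b hb).2.2 hab _ (hU a ha).1⟩
  choose U hUo hUs hU using hloc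
  obtain ⟨t, ht0, hmono, ⟨m, hm⟩, hcov⟩ := exists_monotone_Icc_subset_open_cover_Icc h₁₂ hUo
    fun s _ ↦ mem_iUnion.2 ⟨s, hUs s⟩
  have hind : ∀ n, FlowDiffBound f L t₁ (t n) x := by
    intro n
    induction n with
    | zero =>
      rw [ht0]
      have e : flow f t₁ t₁ = (id : M → M) := funext fun y ↦ flow_self t₁ y
      rw [FlowDiffBound, e]
      refine ⟨mdifferentiableAt_id, fun v ↦ ?_⟩
      rw [mfderiv_id]
      simp
    | succ n ih =>
      have hle := hmono (Nat.le_succ n)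
      obtain ⟨i, hi⟩ := hcov n
      exact ih.trans hf hc ht₁ (t n).2.1 hle
        (hU i _ (hi ⟨le_rfl, hle⟩) _ (hi ⟨hle, le_rfl⟩) hle)
  have := hind m
  rwa [hm m le_rfl] at this

/-- The flow is Lipschitz. -/
theorem IsForwardComplete.dist_flow_le (hc : IsForwardComplete f) (hf : IsC1TimeVaryingField f)
    (hL : 0 ≤ L) (hLip : ∀ t ≥ 0, IsLipschitzField (f t) L) {t₁ t₂ : ℝ} (ht₁ : 0 ≤ t₁)
    (h₁₂ : t₁ ≤ t₂) (x y : M) :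
    dist (flow f t₂ t₁ x) (flow f t₂ t₁ y) ≤ Real.exp (L * (t₂ - t₁)) * dist x y := by
  set Q := Real.exp (L * (t₂ - t₁)) with hQ
  have hQ0 : 0 < Q := Real.exp_pos _
  refine le_of_forall_pos_le_add fun e he ↦ ?_
  have hlt : Manifold.riemannianEDist 𝓘(ℝ, E) y x < ENNReal.ofReal (dist x y + e / Q) := by
    rw [← IsRiemannianManifold.out (I := 𝓘(ℝ, E)), edist_lt_ofReal, dist_comm]
    linarith [div_pos he hQ0]
  obtain ⟨γ, hγ0, hγ1, hγs, hγl⟩ := Manifold.exists_lt_of_riemannianEDist_lt hlt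
  obtain ⟨γ', n, hn, hγd, hn0, hγn⟩ := exists_speed hγs
  rw [hγn, ENNReal.ofReal_lt_ofReal_iff (by positivity)] at hγl
  have hint : ∀ t, HasDerivAt (fun t ↦ ∫ τ in (0 : ℝ)..t, n τ) (n t) t := fun t ↦
    (hn.integral_hasStrictDerivAt 0 t).hasDerivAt
  have hb := fun z ↦ hc.flowDiffBound hf hL hLip ht₁ h₁₂ z
  have hmain := dist_le_of_norm_velocity_le (q := fun s ↦ flow f t₂ t₁ (γ s)) zero_le_one
    (q' := fun s ↦ mfderiv 𝓘(ℝ, E) 𝓘(ℝ, E) (flow f t₂ t₁) (γ s) (γ' s))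
    (B := fun s ↦ Q * ∫ τ in (0 : ℝ)..s, n τ) (B' := fun s ↦ Q * n s)
    (fun s hs ↦ ?_) (fun s ↦ (hint s).const_mul Q) (fun s hs ↦ ?_)
  · simp only [hγ0, hγ1, intervalIntegral.integral_same, mul_zero, sub_zero] at hmain
    refine hmain.trans ?_
    calc Q * ∫ τ in (0 : ℝ)..1, n τ ≤ Q * (dist x y + e / Q) := by gcongr
      _ = _ := by field_simp
  · have h1 := (hb (γ s)).1.hasMFDerivAt.comp_hasMFDerivWithinAt s (hγd s hs).1
    refine h1.congr_mfderiv (ContinuousLinearMap.ext fun (r : ℝ) ↦ ?_)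
    exact map_smul (mfderiv 𝓘(ℝ, E) 𝓘(ℝ, E) (flow f t₂ t₁) (γ s)) r (γ' s)
  · rw [← (hγd s hs).2]
    exact (hb (γ s)).2 (γ' s)

end FlowDifferential

/-- Each directional derivative is an almost everywhere limit of measurable difference quotients,
and finitely many directions determine the differential. -/
theorem aestronglyMeasurable_of_hasFDerivAt {α E : Type*} [MeasurableSpace α]
    {μ : MeasureTheory.Measure α} [NormedAddCommGroup E] [NormedSpace ℝ E] [FiniteDimensional ℝ E]
    {Φ : α → E → ℝ} {Φ' : α → E →L[ℝ] ℝ} {y₀ : E}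
    (hm : ∀ y, MeasureTheory.AEStronglyMeasurable (fun a ↦ Φ a y) μ)
    (hd : ∀ᵐ a ∂μ, HasFDerivAt (Φ a) (Φ' a) y₀) : MeasureTheory.AEStronglyMeasurable Φ' μ := by
  have hv : ∀ v : E, MeasureTheory.AEStronglyMeasurable (fun a ↦ Φ' a v) μ := by
    intro v
    have hc : Tendsto (fun n : ℕ ↦ ‖(n : ℝ)‖) atTop atTop :=
      tendsto_norm_atTop_atTop.comp tendsto_natCast_atTop_atTop
    refine aestronglyMeasurable_of_tendsto_ae atTop
      (f := fun (n : ℕ) a ↦ (n : ℝ) • (Φ a (y₀ + (n : ℝ)⁻¹ • v) - Φ a y₀))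
      (fun n ↦ ((hm _).sub (hm _)).const_smul (n : ℝ)) ?_
    filter_upwards [hd] with a ha
    exact ha.lim v hc
  set b := Module.finBasis ℝ E
  have he : Φ' = fun a ↦ ∑ i, Φ' a (b i) • LinearMap.toContinuousLinearMap (b.coord i) := by
    funext a
    ext v
    have h := congrArg (Φ' a) (b.sum_repr v)
    rw [map_sum] at h
    rw [← h]
    simp only [map_smul, smul_eq_mul]
    simp [mul_comm]
  rw [he]
  exact Finset.aestronglyMeasurable_fun_sum _ fun i _ ↦ (hv (b i)).smul_const _

/-! ### Norm of a differential and slowest possible decay bounds -/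

section Consequences

variable {E : Type*} [NormedAddCommGroup E] [NormedSpace ℝ E] [FiniteDimensional ℝ E]
  {M : Type*} [MetricSpace M] [ChartedSpace E M] [IsManifold 𝓘(ℝ, E) ∞ M]
  [RiemannianBundle (fun x : M ↦ TangentSpace 𝓘(ℝ, E) x)]
  [IsContMDiffRiemannianBundle 𝓘(ℝ, E) ∞ E (fun x : M ↦ TangentSpace 𝓘(ℝ, E) x)]
  [IsRiemannianManifold 𝓘(ℝ, E) M]

/-- The inverse of a chart is Lipschitz at each point of its domain. -/
theorem exists_dist_symm_le {p : M} {y₀ : E} (hy₀ : y₀ ∈ (extChartAt 𝓘(ℝ, E) p).target) :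
    ∃ C ≥ 0, ∀ᶠ y in 𝓝 y₀, dist ((extChartAt 𝓘(ℝ, E) p).symm y) ((extChartAt 𝓘(ℝ, E) p).symm y₀)
      ≤ C * ‖y - y₀‖ := by
  refine ⟨Real.sqrt (‖metricL p y₀‖ + 1), Real.sqrt_nonneg _, ?_⟩
  filter_upwards [eventually_dist_symm_le hy₀ one_pos] with y hy
  refine hy.trans (Real.sqrt_le_iff.2 ⟨by positivity, ?_⟩)
  rw [mul_pow, Real.sq_sqrt (by positivity)]
  have h := (le_abs_self _).trans
    ((Real.norm_eq_abs _).symm.trans_le ((metricL p y₀).le_opNorm₂ (y - y₀) (y - y₀)))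
  nlinarith

/-- The differential of a function which is `C`-Lipschitz at `x` has norm at most `C`. -/
theorem norm_mvfderiv_le {g : M → ℝ} {x : M} {C : ℝ} (hC : 0 ≤ C)
    (hg : MDifferentiableAt 𝓘(ℝ, E) 𝓘(ℝ, ℝ) g x) (h : ∀ y, |g y - g x| ≤ C * dist y x) :
    ‖mvfderiv 𝓘(ℝ, E) g x‖ ≤ C := by
  refine ContinuousLinearMap.opNorm_le_bound _ hC fun v ↦ ?_
  have hx := mem_chart_source E x
  set y₀ := extChartAt 𝓘(ℝ, E) x x with hy₀
  have hy₀t : y₀ ∈ (extChartAt 𝓘(ℝ, E) x).target := ext_mem_target hx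
  have hsx : (extChartAt 𝓘(ℝ, E) x).symm y₀ = x := symm_ext hx
  set gh : E → ℝ := fun y ↦ g ((extChartAt 𝓘(ℝ, E) x).symm y) with hgh
  have hgd : DifferentiableAt ℝ gh y₀ := by
    rw [← mdifferentiableAt_iff_differentiableAt]
    have hg' : MDifferentiableAt 𝓘(ℝ, E) 𝓘(ℝ, ℝ) g ((extChartAt 𝓘(ℝ, E) x).symm y₀) := by
      rwa [hsx]
    exact hg'.comp y₀ (hasMFDerivAt_symm hy₀t).mdifferentiableAt
  set w := coordVec x x v with hw
  have hval : mvfderiv 𝓘(ℝ, E) g x v = fderiv ℝ gh y₀ w := by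
    have h1 := hgd.hasFDerivAt.hasMFDerivAt.comp x
      (mdifferentiableAt_extChartAt (I := 𝓘(ℝ, E)) hx).hasMFDerivAt
    have h2 := h1.congr_of_eventuallyEq (f₁ := g) (by
      filter_upwards [(chartAt E x).open_source.mem_nhds hx] with z hz
      change g z = g ((extChartAt 𝓘(ℝ, E) x).symm (extChartAt 𝓘(ℝ, E) x z))
      rw [symm_ext hz])
    exact DFunLike.congr_fun (hasMFDerivAt_unique hg.hasMFDerivAt h2) v
  have hnorm : ‖v‖ ^ 2 = metricL x y₀ w w := by
    rw [metricL_apply]; exact norm_sq_eq_chartMetric' hx v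
  -- Difference quotients along y₀ + w/n: near y₀ the distance exceeds the norm at y₀ only by the
  -- ε-term, which is removed at the end.
  have hε : ∀ ε > 0, |fderiv ℝ gh y₀ w| ≤ C * Real.sqrt (metricL x y₀ w w + ε * ‖w‖ ^ 2) := by
    intro ε hε
    have hc : Tendsto (fun n : ℕ ↦ ‖(n : ℝ)‖) atTop atTop :=
      tendsto_norm_atTop_atTop.comp tendsto_natCast_atTop_atTop
    have hlim := (hgd.hasFDerivAt.lim w hc).abs
    refine le_of_tendsto hlim ?_
    have hseq : Tendsto (fun n : ℕ ↦ y₀ + (n : ℝ)⁻¹ • w) atTop (𝓝 y₀) := by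
      simpa using (tendsto_inv_atTop_nhds_zero_nat (𝕜 := ℝ)).smul_const w |>.const_add y₀
    filter_upwards [hseq.eventually (eventually_dist_symm_le hy₀t hε),
      eventually_gt_atTop 0] with n hn hn0
    have hn' : (0 : ℝ) < n := by exact_mod_cast hn0
    rw [smul_eq_mul, abs_mul, abs_of_pos hn']
    have h1 := h ((extChartAt 𝓘(ℝ, E) x).symm (y₀ + (n : ℝ)⁻¹ • w))
    rw [hsx] at hn
    have h2 : metricL x y₀ (y₀ + (n : ℝ)⁻¹ • w - y₀) (y₀ + (n : ℝ)⁻¹ • w - y₀)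
        + ε * ‖y₀ + (n : ℝ)⁻¹ • w - y₀‖ ^ 2
        = ((n : ℝ)⁻¹) ^ 2 * (metricL x y₀ w w + ε * ‖w‖ ^ 2) := by
      simp only [add_sub_cancel_left, map_smul, smul_apply, smul_eq_mul, norm_smul, norm_inv,
        RCLike.norm_natCast]
      ring
    rw [h2, Real.sqrt_mul (by positivity), Real.sqrt_sq (by positivity)] at hn
    simp only [hgh, hsx]
    calc _ ≤ (n : ℝ) * (C * ((n : ℝ)⁻¹ * Real.sqrt (metricL x y₀ w w + ε * ‖w‖ ^ 2))) := by
          gcongr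
          exact h1.trans (by gcongr)
      _ = _ := by field_simp
  have hlim : Tendsto (fun ε : ℝ ↦ C * Real.sqrt (metricL x y₀ w w + ε * ‖w‖ ^ 2)) (𝓝[>] 0)
      (𝓝 (C * Real.sqrt (metricL x y₀ w w + 0 * ‖w‖ ^ 2))) := by
    refine Tendsto.mono_left (Continuous.tendsto ?_ 0) nhdsWithin_le_nhds
    fun_prop
  rw [hval, Real.norm_eq_abs]
  refine (ge_of_tendsto hlim (eventually_nhdsWithin_of_forall hε)).trans_eq ?_
  rw [zero_mul, add_zero, ← hnorm, Real.sqrt_sq (norm_nonneg _)]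

variable {f : ℝ → ∀ x : M, TangentSpace 𝓘(ℝ, E) x} {L : ℝ} {xs : M}

omit [RiemannianBundle (fun x : M ↦ TangentSpace 𝓘(ℝ, E) x)]
  [IsContMDiffRiemannianBundle 𝓘(ℝ, E) ∞ E (fun x : M ↦ TangentSpace 𝓘(ℝ, E) x)]
  [IsRiemannianManifold 𝓘(ℝ, E) M] in
-- The orbit of xs is constant, and the derivative of a constant curve is zero.
theorem IsUGES.field_eq_zero (h : IsUGES f xs) (hf : IsC1TimeVaryingField f) {t : ℝ} (ht : 0 ≤ t) :
    f t xs = 0 := by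
  have h1 := h.isForwardComplete.isSolutionOn_flow hf ht (t + 1) xs t ⟨le_rfl, by linarith⟩
  have he : EqOn (fun _ ↦ xs) (fun s ↦ flow f s t xs) (Icc t (t + 1)) := fun s hs ↦
    (h.1 t ht s hs.1).2.symm
  have hmem : t ∈ Icc t (t + 1) := ⟨le_rfl, by linarith⟩
  have h2 := h1.congr_of_eventuallyEq (eventually_of_mem self_mem_nhdsWithin he) (he hmem)
  have h3 : HasMFDerivWithinAt 𝓘(ℝ, ℝ) 𝓘(ℝ, E) (fun _ : ℝ ↦ xs) (Icc t (t + 1)) t 0 :=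
    (hasMFDerivAt_const xs t).hasMFDerivWithinAt
  have h4 := UniqueMDiffWithinAt.eq
    ((uniqueDiffOn_Icc (by linarith : t < t + 1)).uniqueMDiffOn t hmem) h2 h3
  have h5 := DFunLike.congr_fun h4 (1 : ℝ)
  have h6 : f t (flow f t t xs) = (0 : TangentSpace 𝓘(ℝ, E) (flow f t t xs)) :=
    (one_smul ℝ _).symm.trans h5
  rwa [flow_self] at h6

/-- A solution cannot approach the equilibrium faster than `exp (-L t)`. -/
theorem IsUGES.le_dist_flow (h : IsUGES f xs) (hf : IsC1TimeVaryingField f)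
    (hL : 0 ≤ L) (hLip : ∀ t ≥ 0, IsLipschitzField (f t) L) {t₁ t₂ : ℝ} (ht₁ : 0 ≤ t₁)
    (h₁₂ : t₁ ≤ t₂) (x : M) :
    Real.exp (-(L * (t₂ - t₁))) * dist x xs ≤ dist (flow f t₂ t₁ x) xs := by
  have hsol := h.isForwardComplete.isSolutionOn_flow hf ht₁ t₂ x
  have hnorm : ∀ s ∈ Icc t₁ t₂, ‖f s (flow f s t₁ x)‖ ≤ L * dist (flow f s t₁ x) xs :=
    fun s hs ↦ (hLip s (ht₁.trans hs.1)).norm_le hL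
      (fun p y hy ↦ (hasFDerivAt_of_contDiffOn_prod (isOpen_target p) (contDiffOn_coordField hf p)
        (ht₁.trans hs.1) hy).differentiableAt) (h.field_eq_zero hf (ht₁.trans hs.1)) _
  -- A lower bound on the distance d is an upper bound on -d: its right Dini derivative is at most L
  -- d = (-L)(-d), so Grönwall is run with constant -L.
  have hgr := le_gronwallBound_of_liminf_deriv_right_le (a := t₁) (b := t₂)
    (f := fun s ↦ -dist (flow f s t₁ x) xs) (f' := fun s ↦ L * dist (flow f s t₁ x) xs)
    (δ := -dist (flow f t₁ t₁ x) xs) (K := -L) (ε := 0)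
    (fun s hs ↦ ((hsol s hs).continuousWithinAt.dist continuousWithinAt_const).neg)
    (fun s hs r hr ↦ ?_) le_rfl (fun s _ ↦ by simp) t₂ ⟨h₁₂, le_rfl⟩
  · rw [gronwallBound_ε0, flow_self] at hgr
    rw [neg_mul, neg_mul, neg_le_neg_iff, mul_comm] at hgr
    exact hgr
  · refine Filter.Eventually.frequently ?_
    filter_upwards [eventually_abs_dist_sub_lt (hsol s (Ico_subset_Icc_self hs))
      (Icc_mem_nhdsGT_of_mem hs) xs ((hnorm s (Ico_subset_Icc_self hs)).trans_lt hr),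
      self_mem_nhdsWithin] with z hz hzs
    refine lt_of_le_of_lt ?_ hz
    have hpos : 0 < z - s := sub_pos.2 hzs
    gcongr
    rw [neg_sub_neg, abs_sub_comm]
    exact le_abs_self _

end Consequences

/-! ### The Lyapunov function -/

section LyapunovFunction

variable {E : Type*} [NormedAddCommGroup E] [NormedSpace ℝ E] [FiniteDimensional ℝ E]
  {M : Type*} [MetricSpace M] [ChartedSpace E M] [IsManifold 𝓘(ℝ, E) ∞ M]
  {f : ℝ → ∀ x : M, TangentSpace 𝓘(ℝ, E) x} {L δ t : ℝ} {xs : M}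

theorem IsForwardComplete.continuousOn_dist_flow (hc : IsForwardComplete f)
    (hf : IsC1TimeVaryingField f) (ht : 0 ≤ t) (x : M) :
    ContinuousOn (fun τ ↦ dist (flow f τ t x) xs) (Ici t) := by
  intro τ hτ
  have h1 := (hc.isSolutionOn_flow hf ht (τ + 1) x τ ⟨hτ, by linarith⟩).continuousWithinAt
  have h2 : ContinuousWithinAt (fun τ ↦ flow f τ t x) (Ici t) τ := by
    refine h1.mono_of_mem_nhdsWithin ?_
    rw [← Ici_inter_Iic]
    exact inter_mem_nhdsWithin _ (Iic_mem_nhds (by linarith))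
  exact h2.dist continuousWithinAt_const

theorem IsForwardComplete.intervalIntegrable_dist_flow (hc : IsForwardComplete f)
    (hf : IsC1TimeVaryingField f) (hδ : 0 ≤ δ) (ht : 0 ≤ t) (x : M) :
    IntervalIntegrable (fun τ ↦ dist (flow f τ t x) xs) MeasureTheory.volume t (t + δ) :=
  ((hc.continuousOn_dist_flow hf ht x).mono (by
    rw [uIcc_of_le (by linarith)]; exact Icc_subset_Ici_self)).intervalIntegrable

omit [FiniteDimensional ℝ E] [IsManifold 𝓘(ℝ, E) ∞ M] in
theorem lyapunovFun_nonneg (hδ : 0 ≤ δ) (x : M) : 0 ≤ lyapunovFun f xs δ t x :=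
  intervalIntegral.integral_nonneg (by linarith) fun _ _ ↦ dist_nonneg

theorem IsForwardComplete.lyapunovFun_le (hc : IsForwardComplete f) (hf : IsC1TimeVaryingField f)
    (hδ : 0 ≤ δ) (ht : 0 ≤ t) {x : M} {C : ℝ} (h : ∀ τ ∈ Icc t (t + δ),
      dist (flow f τ t x) xs ≤ C) : lyapunovFun f xs δ t x ≤ δ * C := by
  have h1 := intervalIntegral.integral_mono_on (by linarith)
    (hc.intervalIntegrable_dist_flow (xs := xs) hf hδ ht x)
    (intervalIntegrable_const (μ := MeasureTheory.volume) (c := C)) h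
  simpa [lyapunovFun] using h1

theorem IsForwardComplete.le_lyapunovFun (hc : IsForwardComplete f) (hf : IsC1TimeVaryingField f)
    (hδ : 0 ≤ δ) (ht : 0 ≤ t) {x : M} {C : ℝ} (h : ∀ τ ∈ Icc t (t + δ),
      C ≤ dist (flow f τ t x) xs) : δ * C ≤ lyapunovFun f xs δ t x := by
  have h1 := intervalIntegral.integral_mono_on (by linarith)
    (intervalIntegrable_const (μ := MeasureTheory.volume) (c := C))
    (hc.intervalIntegrable_dist_flow (xs := xs) hf hδ ht x) h
  simpa [lyapunovFun] using h1

/-- Every state at time `t` is reached from a slightly earlier time. -/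
theorem exists_flow_eq (hf : IsC1TimeVaryingField f) (ht : 0 ≤ t) (x : M) :
    ∃ a, 0 ≤ a ∧ a ≤ t ∧ Ici a ∈ 𝓝[Ici 0] t ∧ ∃ y, flow f t a y = x := by
  obtain ⟨r, h, K, B, hh, hball, hB, hbox⟩ := exists_flowBox (isOpen_target x)
    (contDiffOn_coordField hf x) (t₀ := t)
    (ext_mem_target (E := E) (mem_chart_source E x))
  have hta : max 0 (t - h) ≤ t := max_le ht (by linarith)
  obtain ⟨α, hαt, hα⟩ := hbox.exists_solution hB (t₁ := t) ⟨hta, by linarith⟩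
    (Metric.mem_closedBall_self hbox.radius_pos.le)
  have hsol : IsSolutionOn f (fun t ↦ (extChartAt 𝓘(ℝ, E) x).symm (α t))
      (Icc (max 0 (t - h)) (t + h)) :=
    isSolutionOn_symm_comp fun s hs ↦ ⟨hball (hα s hs).1, (hα s hs).2⟩
  refine ⟨max 0 (t - h), le_max_left _ _, hta, ?_,
    (extChartAt 𝓘(ℝ, E) x).symm (α (max 0 (t - h))), ?_⟩
  · filter_upwards [self_mem_nhdsWithin, mem_nhdsWithin_of_mem_nhds
      (Ici_mem_nhds (by linarith : t - h < t))] with s hs0 hs1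
    exact max_le (mem_Ici.1 hs0) (mem_Ici.1 hs1)
  · have h1 := flow_eq hf ht (le_max_left 0 (t - h)) (hsol.mono (by
      rw [uIcc_of_le hta]; exact Icc_subset_Icc_right (by linarith)))
    refine h1.trans ?_
    simp only [hαt]
    exact symm_ext (mem_chart_source E x)

/-- By the semigroup property V along the orbit is the integral of a fixed function over the window
[s, s + δ]. Starting the orbit slightly before t makes the derivative two-sided when t > 0. -/
theorem IsForwardComplete.hasTimedLieDerivAt (hc : IsForwardComplete f)
    (hf : IsC1TimeVaryingField f) (hδ : 0 ≤ δ) (ht : 0 ≤ t) (x : M) :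
    HasTimedLieDerivAt f (lyapunovFun f xs δ) (dist (flow f (t + δ) t x) xs - dist x xs) t x := by
  obtain ⟨a, ha, hat, hnhds, y, rfl⟩ := exists_flow_eq hf ht x
  -- Clamping the time at a makes g continuous on the whole line.
  set g : ℝ → ℝ := fun τ ↦ dist (flow f (max a τ) a y) xs with hg
  have hgc : Continuous g := by
    have h1 := hc.continuousOn_dist_flow (xs := xs) hf ha y
    exact h1.comp_continuous (by fun_prop) fun τ ↦ le_max_left a τ
  -- For s < t the flow runs backward from the state at t; uniqueness identifies it with the orbit
  -- issued from y.
  have hflow : ∀ s ∈ Ici a, flow f s t (flow f t a y) = flow f s a y := by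
    intro s hs
    rcases le_total t s with hts | hst
    · exact hc.flow_flow hf ha hat hts y
    · exact flow_eq hf (ha.trans hs) ht ((hc.isSolutionOn_flow hf ha t y).mono
        (by rw [uIcc_of_ge hst]; exact Icc_subset_Icc_left hs) :
          IsSolutionOn f (fun s ↦ flow f s a y) (uIcc t s))
  have hV : ∀ s ∈ Ici a, lyapunovFun f xs δ s (flow f s t (flow f t a y))
      = ∫ τ in s..(s + δ), g τ := by
    intro s hs
    rw [hflow s hs, lyapunovFun]
    refine intervalIntegral.integral_congr fun τ hτ ↦ ?_
    rw [uIcc_of_le (by linarith)] at hτ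
    simp only [hg]
    rw [hc.flow_flow hf ha hs hτ.1, max_eq_right (le_trans hs hτ.1)]
  have hI : ∀ s, HasDerivAt (fun s ↦ ∫ τ in (0 : ℝ)..s, g τ) (g s) s := fun s ↦
    (hgc.integral_hasStrictDerivAt 0 s).hasDerivAt
  have hH : HasDerivAt (fun s ↦ ∫ τ in s..(s + δ), g τ) (g (t + δ) - g t) t := by
    have h1 := ((hI (t + δ)).comp_add_const t δ).sub (hI t)
    refine h1.congr_of_eventuallyEq (Eventually.of_forall fun s ↦ ?_)
    exact (intervalIntegral.integral_interval_sub_left (hgc.intervalIntegrable _ _)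
      (hgc.intervalIntegrable _ _)).symm
  have e1 : g (t + δ) = dist (flow f (t + δ) t (flow f t a y)) xs := by
    simp only [hg]
    rw [hflow (t + δ) (show a ≤ t + δ by linarith), max_eq_right (by linarith)]
  have e2 : g t = dist (flow f t a y) xs := by simp only [hg]; rw [max_eq_right hat]
  rw [HasTimedLieDerivAt, ← e1, ← e2]
  exact hH.hasDerivWithinAt.congr_of_eventuallyEq (eventually_of_mem hnhds hV) (hV t hat)

variable [RiemannianBundle (fun x : M ↦ TangentSpace 𝓘(ℝ, E) x)]
  [IsContMDiffRiemannianBundle 𝓘(ℝ, E) ∞ E (fun x : M ↦ TangentSpace 𝓘(ℝ, E) x)]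
  [IsRiemannianManifold 𝓘(ℝ, E) M]

theorem IsForwardComplete.dist_flow_le' (hc : IsForwardComplete f)
    (hf : IsC1TimeVaryingField f) (hL : 0 ≤ L) (hLip : ∀ s ≥ 0, IsLipschitzField (f s) L)
    (ht : 0 ≤ t) {τ : ℝ} (hτ : τ ∈ Icc t (t + δ)) (x y : M) :
    |dist (flow f τ t x) xs - dist (flow f τ t y) xs| ≤ Real.exp (L * δ) * dist x y := by
  refine (abs_dist_sub_le _ _ _).trans ((hc.dist_flow_le hf hL hLip ht hτ.1 x y).trans ?_)
  gcongr
  linarith [hτ.2]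

theorem IsForwardComplete.abs_lyapunovFun_sub_le (hc : IsForwardComplete f)
    (hf : IsC1TimeVaryingField f) (hL : 0 ≤ L) (hLip : ∀ s ≥ 0, IsLipschitzField (f s) L)
    (hδ : 0 ≤ δ) (ht : 0 ≤ t) (x y : M) :
    |lyapunovFun f xs δ t x - lyapunovFun f xs δ t y| ≤ δ * Real.exp (L * δ) * dist x y := by
  have h1 := intervalIntegral.norm_integral_le_of_norm_le_const (a := t) (b := t + δ)
    (C := Real.exp (L * δ) * dist x y)
    (f := fun τ ↦ dist (flow f τ t x) xs - dist (flow f τ t y) xs) (fun τ hτ ↦ by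
      rw [uIoc_of_le (by linarith)] at hτ
      exact hc.dist_flow_le' hf hL hLip ht (Ioc_subset_Icc_self hτ) x y)
  rw [intervalIntegral.integral_sub (hc.intervalIntegrable_dist_flow hf hδ ht x)
    (hc.intervalIntegrable_dist_flow hf hδ ht y), add_sub_cancel_left, abs_of_nonneg hδ] at h1
  rw [lyapunovFun, lyapunovFun]
  exact h1.trans_eq (by ring)

/-- Differentiation under the integral in a chart. The integrand is differentiable at x by the chain
rule, and the uniform Lipschitz bound of the flow over the window dominates its increments. -/
theorem IsForwardComplete.mdifferentiableAt_lyapunovFun (hc : IsForwardComplete f)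
    (hf : IsC1TimeVaryingField f) (hL : 0 ≤ L) (hLip : ∀ s ≥ 0, IsLipschitzField (f s) L)
    (hδ : 0 ≤ δ) (ht : 0 ≤ t) {x : M} (hd : ∀ τ ∈ Icc t (t + δ),
      MDifferentiableAt 𝓘(ℝ, E) 𝓘(ℝ, ℝ) (fun z ↦ dist z xs) (flow f τ t x)) :
    MDifferentiableAt 𝓘(ℝ, E) 𝓘(ℝ, ℝ) (lyapunovFun f xs δ t) x := by
  have hx := mem_chart_source E x
  set y₀ := extChartAt 𝓘(ℝ, E) x x with hy₀
  have hy₀t : y₀ ∈ (extChartAt 𝓘(ℝ, E) x).target := ext_mem_target hx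
  have hsx : (extChartAt 𝓘(ℝ, E) x).symm y₀ = x := symm_ext hx
  set μ := MeasureTheory.volume.restrict (Ioc t (t + δ)) with hμ
  set Φ : ℝ → E → ℝ := fun τ y ↦ dist (flow f τ t ((extChartAt 𝓘(ℝ, E) x).symm y)) xs with hΦ
  have hΦd : ∀ τ ∈ Ioc t (t + δ), HasFDerivAt (Φ τ) (fderiv ℝ (Φ τ) y₀) y₀ := by
    intro τ hτ
    refine DifferentiableAt.hasFDerivAt ?_
    rw [← mdifferentiableAt_iff_differentiableAt]
    have h1 : MDifferentiableAt 𝓘(ℝ, E) 𝓘(ℝ, ℝ) (fun z ↦ dist (flow f τ t z) xs)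
        ((extChartAt 𝓘(ℝ, E) x).symm y₀) := by
      rw [hsx]
      exact (hd τ (Ioc_subset_Icc_self hτ)).comp x (hc.flowDiffBound hf hL hLip ht hτ.1.le x).1
    exact h1.comp y₀ (hasMFDerivAt_symm hy₀t).mdifferentiableAt
  have hint : ∀ y, MeasureTheory.Integrable (fun τ ↦ Φ τ y) μ := fun y ↦
    (hc.intervalIntegrable_dist_flow hf hδ ht _).1
  have hae : ∀ᵐ τ ∂μ, τ ∈ Ioc t (t + δ) :=
    MeasureTheory.ae_restrict_mem measurableSet_Ioc
  -- C converts the Riemannian distance into the coordinate norm, so exp(Lδ) C bounds the difference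
  -- quotients at y₀.
  obtain ⟨C, hC, hCs⟩ := exists_dist_symm_le (E := E) hy₀t
  have hderiv := (hasFDerivAt_integral_of_dominated_loc_of_lip' (μ := μ)
    (F := fun y τ ↦ Φ τ y) (F' := fun τ ↦ fderiv ℝ (Φ τ) y₀)
    (bound := fun _ ↦ Real.exp (L * δ) * C) hCs (fun y _ ↦ (hint y).aestronglyMeasurable)
    (hint y₀)
    (aestronglyMeasurable_of_hasFDerivAt (fun y ↦ (hint y).aestronglyMeasurable)
      (hae.mono hΦd)) (hae.mono fun τ hτ y hy ↦ ?_) (MeasureTheory.integrable_const _)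
    (hae.mono hΦd)).2
  · have hVe : ∀ z, lyapunovFun f xs δ t z = ∫ τ, dist (flow f τ t z) xs ∂μ := fun z ↦
      intervalIntegral.integral_of_le (by linarith)
    have h1 := hderiv.hasMFDerivAt.mdifferentiableAt.comp x
      (mdifferentiableAt_extChartAt (I := 𝓘(ℝ, E)) hx)
    refine h1.congr_of_eventuallyEq ?_
    filter_upwards [(chartAt E x).open_source.mem_nhds hx] with z hz
    rw [hVe]
    change _ = ∫ τ, dist (flow f τ t
      ((extChartAt 𝓘(ℝ, E) x).symm (extChartAt 𝓘(ℝ, E) x z))) xs ∂μ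
    rw [symm_ext hz]
  · refine (hc.dist_flow_le' hf hL hLip ht (Ioc_subset_Icc_self hτ) _ _).trans ?_
    rw [mul_assoc]
    gcongr
    exact hy

end LyapunovFunction

end RiemLyap

/-! ### The main theorem -/

theorem mainTheorem1
    {E : Type*} [NormedAddCommGroup E] [NormedSpace ℝ E] [FiniteDimensional ℝ E]
    {M : Type*} [MetricSpace M] [CompleteSpace M] [ChartedSpace E M] [IsManifold 𝓘(ℝ, E) ∞ M]
    [RiemannianBundle (fun x : M ↦ TangentSpace 𝓘(ℝ, E) x)]
    [IsContMDiffRiemannianBundle 𝓘(ℝ, E) ∞ E (fun x : M ↦ TangentSpace 𝓘(ℝ, E) x)]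
    [IsRiemannianManifold 𝓘(ℝ, E) M]
    (f : ℝ → ∀ x : M, TangentSpace 𝓘(ℝ, E) x) (hf : RiemLyap.IsC1TimeVaryingField f)
    (L : ℝ) (hL : 0 < L) (hLip : ∀ t ≥ 0, RiemLyap.IsLipschitzField (f t) L)
    (xs : M) (hxs : RiemLyap.IsUGES f xs) :
    ∃ δ₀ > 0, ∀ δ ≥ δ₀,
      RiemLyap.IsLyapunovCandidate (RiemLyap.lyapunovFun f xs δ) xs ∧
      (∃ c₁ > 0, ∃ c₂ > 0, ∀ t ≥ 0, ∀ x : M,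
        c₁ * dist x xs ≤ RiemLyap.lyapunovFun f xs δ t x ∧
        RiemLyap.lyapunovFun f xs δ t x ≤ c₂ * dist x xs) ∧
      (∃ c₃ > 0, ∀ t ≥ 0, ∀ x : M, ∃ l : ℝ,
        RiemLyap.HasTimedLieDerivAt f (RiemLyap.lyapunovFun f xs δ) l t x ∧
        l ≤ -c₃ * RiemLyap.lyapunovFun f xs δ t x) ∧
      (∃ c₄ > 0,
        (ContMDiff 𝓘(ℝ, E) 𝓘(ℝ, ℝ) 1 (fun x : M ↦ dist x xs) →
          ∀ t ≥ 0, ∀ x : M,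
            MDifferentiableAt 𝓘(ℝ, E) 𝓘(ℝ, ℝ) (RiemLyap.lyapunovFun f xs δ t) x ∧
            ‖mvfderiv 𝓘(ℝ, E) (RiemLyap.lyapunovFun f xs δ t) x‖ ≤ c₄) ∧
        (ContMDiffOn 𝓘(ℝ, E) 𝓘(ℝ, ℝ) 1 (fun x : M ↦ dist x xs) {xs}ᶜ →
          ∀ t ≥ 0, ∀ x : M, x ≠ xs →
            MDifferentiableAt 𝓘(ℝ, E) 𝓘(ℝ, ℝ) (RiemLyap.lyapunovFun f xs δ t) x ∧
            ‖mvfderiv 𝓘(ℝ, E) (RiemLyap.lyapunovFun f xs δ t) x‖ ≤ c₄)) := by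
  have hc := hxs.isForwardComplete
  obtain ⟨K, hK, lam, hlam, hexp⟩ := hxs.2
  -- The logarithm is the time after which K exp(-λδ) ≤ 1/2; the maximum with 1 keeps the threshold
  -- positive whatever the sign of log(2K).
  refine ⟨max 1 (Real.log (2 * K) / lam), by positivity, fun δ hδ₀ ↦ ?_⟩
  have hδ : 0 < δ := zero_lt_one.trans_le ((le_max_left _ _).trans hδ₀)
  have hdecay : K * Real.exp (-lam * δ) ≤ 1 / 2 := by
    have h1 : Real.log (2 * K) ≤ lam * δ := by
      rw [mul_comm lam, ← div_le_iff₀ hlam]; exact (le_max_right _ _).trans hδ₀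
    have h2 : 2 * K ≤ Real.exp (lam * δ) := (Real.log_le_iff_le_exp (by positivity)).1 h1
    rw [neg_mul, Real.exp_neg, ← div_eq_mul_inv, div_le_iff₀ (Real.exp_pos _)]
    linarith
  have hlow : ∀ t ≥ 0, ∀ x : M,
      δ * Real.exp (-(L * δ)) * dist x xs ≤ RiemLyap.lyapunovFun f xs δ t x := by
    intro t ht x
    rw [mul_assoc]
    refine hc.le_lyapunovFun hf hδ.le ht fun τ hτ ↦ ?_
    refine le_trans ?_ (hxs.le_dist_flow hf hL.le hLip ht hτ.1 x)
    gcongr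
    linarith [hτ.2]
  have hup : ∀ t ≥ 0, ∀ x : M, RiemLyap.lyapunovFun f xs δ t x ≤ δ * K * dist x xs := by
    intro t ht x
    rw [mul_assoc]
    refine hc.lyapunovFun_le hf hδ.le ht fun τ hτ ↦ ?_
    refine (hexp t ht τ hτ.1 x).2.trans ?_
    gcongr
    refine mul_le_of_le_one_right hK.le (Real.exp_le_one_iff.2 ?_)
    have := mul_nonneg hlam.le (sub_nonneg.2 hτ.1)
    linarith
  have hc₁ : 0 < δ * Real.exp (-(L * δ)) := by positivity
  have hbound : ∀ t ≥ 0, ∀ x : M,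
      (∀ τ ∈ Icc t (t + δ),
        MDifferentiableAt 𝓘(ℝ, E) 𝓘(ℝ, ℝ) (fun z ↦ dist z xs) (RiemLyap.flow f τ t x)) →
      MDifferentiableAt 𝓘(ℝ, E) 𝓘(ℝ, ℝ) (RiemLyap.lyapunovFun f xs δ t) x ∧
      ‖mvfderiv 𝓘(ℝ, E) (RiemLyap.lyapunovFun f xs δ t) x‖ ≤ δ * Real.exp (L * δ) := by
    intro t ht x hd
    have h1 := hc.mdifferentiableAt_lyapunovFun hf hL.le hLip hδ.le ht hd
    exact ⟨h1, RiemLyap.norm_mvfderiv_le (by positivity) h1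
      fun y ↦ hc.abs_lyapunovFun_sub_le hf hL.le hLip hδ.le ht y x⟩
  refine ⟨fun t ht x ↦ ⟨RiemLyap.lyapunovFun_nonneg hδ.le x, fun h ↦ ?_, fun h ↦ ?_⟩,
    ⟨_, hc₁, δ * K, by positivity, fun t ht x ↦ ⟨hlow t ht x, hup t ht x⟩⟩,
    -- The Lie derivative is at most -d(x, xs)/2, and d(x, xs) ≥ V/(δK).
    ⟨(2 * (δ * K))⁻¹, by positivity, fun t ht x ↦
      ⟨_, hc.hasTimedLieDerivAt hf hδ.le ht x, ?_⟩⟩,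
    ⟨δ * Real.exp (L * δ), by positivity, fun hd t ht x ↦ hbound t ht x fun τ _ ↦
      hd.mdifferentiableAt one_ne_zero, fun hd t ht x hx ↦ hbound t ht x fun τ hτ ↦ ?_⟩⟩
  · have h1 := hlow t ht x
    rw [h] at h1
    exact dist_le_zero.1 (nonpos_of_mul_nonpos_right h1 hc₁)
  · have h1 := hup t ht x
    rw [h, dist_self, mul_zero] at h1
    rw [h]
    exact le_antisymm h1 (RiemLyap.lyapunovFun_nonneg hδ.le xs)
  · have h1 := (hexp t ht (t + δ) (by linarith) x).2
    rw [add_sub_cancel_left] at h1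
    have h2 : K * Real.exp (-lam * δ) * dist x xs ≤ 1 / 2 * dist x xs := by gcongr
    have h3 : (2 * (δ * K))⁻¹ * RiemLyap.lyapunovFun f xs δ t x ≤ 1 / 2 * dist x xs := by
      rw [inv_mul_le_iff₀ (by positivity)]
      linarith [hup t ht x]
    linarith
  -- The exponential lower bound keeps the orbit of x ≠ xs off xs, where the distance function may
  -- fail to be differentiable.
  · have hne : RiemLyap.flow f τ t x ≠ xs := by
      rw [← dist_pos]
      have := dist_pos.2 hx
      exact lt_of_lt_of_le (by positivity) (hxs.le_dist_flow hf hL.le hLip ht hτ.1 x)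
    exact ((hd _ hne).contMDiffAt (isOpen_compl_singleton.mem_nhds hne)).mdifferentiableAt
      one_ne_zero
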